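/- Let $\mathbb K$ be an algebraic closure of $\mathbb C(q)$, with fixed square roots $q^{1/2}$ of $q$ and $c$ of $q^{1/2}+q^{-1/2}$. Let $\mathfrak g$ be an untwisted affine Lie algebra of type $A_n^{(1)},B_n^{(1)},C_n^{(1)}$ ($n\ge 1$) or $D_n^{(1)}$ ($n\ge 3$), i.e. $\mathfrak g=\widehat{\mathfrak{sl}}_{n+1},\widehat{\mathfrak{so}}_{2n+1},\widehat{\mathfrak{sp}}_{2n},\widehat{\mathfrak{so}}_{2n}$, put $N=n+1,2n+1,2n,2n$ respectively and $I=\{0,\dots,n\}$. Let $\alpha_1,\dots,\alpha_n\in\mathbb Z^{n+1}$ be the standard simple roots $\alpha_i=\varepsilon_i-\varepsilon_{i+1}$ ($i\le n$ in type $A$, $i<n$ otherwise), $\alpha_n=\varepsilon_n,\,2\varepsilon_n,\,\varepsilon_{n-1}+\varepsilon_n$ in types $B,C,D$, let $\alpha_0$ be minus the highest root, and set $a_{ij}=2(\alpha_i,\alpha_j)/(\alpha_i,\alpha_i)$, $d_i=(\alpha_i,\alpha_i)/2$, $q_i=q^{d_i}$. Let $U_q(\mathfrak g)$ be the unital associative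 $\mathbb K$-algebra with generators $x_i,y_i,k_i^{\pm1}$ ($i\in I$) and relations $$k_ik_j=k_jk_i,\quad k_ix_j=q_i^{a_{ij}}x_jk_i,\quad k_iy_j=q_i^{-a_{ij}}y_jk_i,\quad x_iy_j-y_jx_i=\delta_{ij}\frac{k_i-k_i^{-1}}{q_i-q_i^{-1}},$$ $$\sum_{r=0}^{1-a_{ij}}(-1)^r x_i^{(1-a_{ij}-r)}x_jx_i^{(r)}=\sum_{r=0}^{1-a_{ij}}(-1)^r y_i^{(1-a_{ij}-r)}y_jy_i^{(r)}=0\quad(i\ne j),$$ where $z_i^{(r)}=z_i^r/[r]_{q_i}!$ and $[r]_{q_i}!=\prod_{s=1}^r (q_i^s-q_i^{-s})/(q_i-q_i^{-1})$, with coproduct $\Delta(x_i)=x_i\otimes1+k_i\otimes x_i$, $\Delta(y_i)=y_i\otimes k_i^{-1}+1\otimes y_i$, $\Delta(k_i)=k_i\otimes k_i$. Label the basis of $\mathbb K^N$ by $\langle N\rangle=\{1,\dots,N\}$ for $\mathfrak{sl}_N$, $\{-n,\dots,-1,1,\dots,n\}$ for $\mathfrak{so}_{2n},\mathfrak{sp}_{2n}$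 and $\{-n,\dots,n\}$ for $\mathfrak{so}_{2n+1}$. Let $\vartheta=1$, $\vartheta_i=1$ for $\mathfrak{so}_N$ and $\vartheta=-1$, $\vartheta_i=\mathrm{sgn}(i)$ for $\mathfrak{sp}_N$; in both cases let $\kappa=N/2-\vartheta$; let $\nu_i=i-\mathrm{sgn}(i)(n-\kappa)$ for $\mathfrak{so}_N$ and $\nu_i=i$ for $\mathfrak{sp}_N$. Let $E_{ij}$ be the matrix units, $F_{ij}=E_{ij}-\vartheta_i\vartheta_jE_{-j,-i}$, and $q^{\sum m_iE_{ii}}=\sum q^{m_i}E_{ii}$. For an invertible parameter $u$ let $T_u:U_q(\mathfrak g)\to\mathrm{End}(\mathbb K^N)$ be the vector representation: * for $\widehat{\mathfrak{sl}}_N$: $x_i\mapsto E_{i,i+1}$, $y_i\mapsto E_{i+1,i}$, $k_i\mapsto q^{E_{ii}-E_{i+1,i+1}}$ ($1\le i\le n$), $x_0\mapsto uE_{N1}$, $y_0\mapsto u^{-1}E_{1N}$, $k_0\mapsto q^{E_{NN}-E_{11}}$; * in all other cases, with $\bar\imath=n+1-i$: $x_i\mapsto F_{-\bar\imath,-\bar\imath+1}$,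 $y_i\mapsto F_{-\bar\imath+1,-\bar\imath}$, $k_i\mapsto q^{F_{\bar\imath-1,\bar\imath-1}-F_{\bar\imath\bar\imath}}$ for $1\le i<n$; * for $\widehat{\mathfrak{so}}_{2n+1}$: $x_n\mapsto c(E_{-1,0}-q^{-1/2}E_{01})$, $y_n\mapsto c(E_{0,-1}-q^{1/2}E_{10})$, $k_n\mapsto q^{-F_{11}}$; for $\widehat{\mathfrak{sp}}_{2n}$: $x_n\mapsto\frac12F_{-1,1}$, $y_n\mapsto\frac12F_{1,-1}$, $k_n\mapsto q^{-2F_{11}}$; for $\widehat{\mathfrak{so}}_{2n}$: $x_n\mapsto F_{-2,1}$, $y_n\mapsto F_{1,-2}$, $k_n\mapsto q^{-F_{11}-F_{22}}$; * for $\widehat{\mathfrak{so}}_N$ with $N>3$: $x_0\mapsto uF_{n-1,-n}$, $y_0\mapsto u^{-1}F_{-n,n-1}$, $k_0\mapsto q^{F_{n-1,n-1}+F_{nn}}$; for $\widehat{\mathfrak{so}}_3$: $x_0\mapsto u\,c(E_{0,-1}-q^{1/2}E_{10})$, $y_0\mapsto u^{-1}c(E_{-1,0}-q^{-1/2}E_{01})$,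 $k_0\mapsto q^{F_{11}}$; for $\widehat{\mathfrak{sp}}_{2n}$: $x_0\mapsto\frac12uF_{n,-n}$, $y_0\mapsto\frac12u^{-1}F_{-n,n}$, $k_0\mapsto q^{2F_{nn}}$. Let $P=\sum_{i,j}E_{ij}\otimes E_{ji}$. For $\mathfrak{sl}_N$ put $Q_q=0$ and $R_q=\sum_{i,j}\big(q^{\delta_{ij}}E_{ii}\otimes E_{jj}+\delta_{i<j}(q-q^{-1})E_{ij}\otimes E_{ji}\big)$; otherwise put $Q_q=\sum_{i,j}\vartheta_i\vartheta_jq^{\nu_i-\nu_j}E_{ij}\otimes E_{-i,-j}$ and $$R_q=\sum_{i,j}\Big(q^{\delta_{ij}-\delta_{i,-j}}E_{ii}\otimes E_{jj}+\delta_{i<j}(q-q^{-1})\big(E_{ij}\otimes E_{ji}-\vartheta_i\vartheta_jq^{\nu_i-\nu_j}E_{ij}\otimes E_{-i,-j}\big)\Big).$$ Let $$R(u)=\frac{1-u}{q-q^{-1}u}R_q+\frac{(q-q^{-1})u}{q-q^{-1}u}\Big(P-\frac{1-u}{q^{2\kappa}-u}Q_q\Big),\qquad R_{21}(u)=PR(u)P,$$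 where the last term is absent for $\mathfrak{sl}_N$. Let $\mathcal B\subseteq U_q(\mathfrak g)$ be a right coideal subalgebra, i.e. a unital subalgebra with $\Delta(\mathcal B)\subseteq\mathcal B\otimes U_q(\mathfrak g)$. Let $\eta\in\mathbb K^\times$ and let $K(u)\ne0$ be an $N\times N$ matrix of rational functions of $u$ over $\mathbb K$ such that $$K(u)\,T_{\eta u}(b)=T_{\eta/u}(b)\,K(u)\qquad\text{for all }b\in\mathcal B$$ as an identity of matrix-valued rational functions of $u$. Suppose that $(T_u\otimes T_v)|_{\mathcal B}$ is irreducible for generic $u,v$; that is, there is a nonzero polynomial $p$ in two variables over $\mathbb K$ such that for all $u,v\in\mathbb K^\times$ with $p(u,v)\neq0$ the representation $b\mapsto(T_u\otimes T_v)(\Delta(b))$ of $\mathcal B$ on $\mathbb K^N\otimes\mathbb K^N$ is irreducible. Then, with $K_1(u)=K(u)\otimes 1$ and $K_2(v)=1\otimes K(v)$, $$R_{21}(\tfrac uv)\,K_1(u)\,R(uv)\,K_2(v)=K_2(v)\,R_{21}(uv)\,K_1(u)\,R(\tfrac uv)$$ as an identity of matrix-valued rational functions of $u$ and $v$. -/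

import Mathlib

open scoped TensorProduct Kronecker

namespace QRefl

/-! ## The ground field -/

/-- An algebraic closure of `ℂ(q)`. -/
def 𝕂 : Type := AlgebraicClosure (RatFunc ℂ)

noncomputable instance : Field 𝕂 := inferInstanceAs (Field (AlgebraicClosure (RatFunc ℂ)))

noncomputable instance : Algebra (RatFunc ℂ) 𝕂 :=
  inferInstanceAs (Algebra (RatFunc ℂ) (AlgebraicClosure (RatFunc ℂ)))

instance : IsAlgClosure (RatFunc ℂ) 𝕂 :=
  inferInstanceAs (IsAlgClosure (RatFunc ℂ) (AlgebraicClosure (RatFunc ℂ)))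

instance : IsAlgClosed 𝕂 := IsAlgClosure.isAlgClosed (RatFunc ℂ)

/-- The indeterminate `q`. -/
noncomputable def q : 𝕂 := algebraMap (RatFunc ℂ) 𝕂 RatFunc.X

theorem exists_sqrt (z : 𝕂) : ∃ w : 𝕂, w ^ 2 = z :=
  IsAlgClosed.exists_pow_nat_eq z (by norm_num)

/-- A square root `q^{1/2}` of `q`. -/
noncomputable def qh : 𝕂 := (exists_sqrt q).choose

/-- A square root of `[2]_{q^{1/2}} = q^{1/2} + q^{-1/2}`. -/
noncomputable def cc : 𝕂 := (exists_sqrt (qh + qh⁻¹)).choose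

theorem qh_sq : qh ^ 2 = q := (exists_sqrt q).choose_spec

theorem cc_sq : cc ^ 2 = qh + qh⁻¹ := (exists_sqrt (qh + qh⁻¹)).choose_spec

theorem q_pow_ne_one {m : ℕ} (hm : m ≠ 0) : q ^ m ≠ 1 := by
  intro h
  rw [q, ← map_pow, ← map_one (algebraMap (RatFunc ℂ) 𝕂)] at h
  have h2 := (algebraMap (RatFunc ℂ) 𝕂).injective h
  rw [← RatFunc.algebraMap_X, ← map_pow, ← map_one (algebraMap (Polynomial ℂ) (RatFunc ℂ))] at h2
  have h3 := RatFunc.algebraMap_injective ℂ h2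
  have h4 := congrArg Polynomial.natDegree h3
  simp at h4
  exact hm h4

theorem q_ne_zero : q ≠ 0 := by
  simp [q, RatFunc.X_ne_zero]

theorem qh_ne_zero : qh ≠ 0 := by
  intro h
  apply q_ne_zero
  rw [← qh_sq, h]
  simp

theorem qh_pow_ne_one {m : ℕ} (hm : m ≠ 0) : qh ^ m ≠ 1 := by
  intro h
  apply q_pow_ne_one hm
  rw [← qh_sq, ← pow_mul, mul_comm, pow_mul, h, one_pow]

/-! ## Quantum numbers and the quantum Serre expression -/

/-- `[r]_p = (p^r - p^{-r}) / (p - p^{-1})`. -/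
noncomputable def qInt (p : 𝕂) (r : ℕ) : 𝕂 := (p ^ r - (p ^ r)⁻¹) / (p - p⁻¹)

/-- `[r]_p! = [1]_p [2]_p ⋯ [r]_p`. -/
noncomputable def qFact (p : 𝕂) (r : ℕ) : 𝕂 := ∏ s ∈ Finset.range r, qInt p (s + 1)

section Serre

variable {B : Type*} [Ring B] [Algebra 𝕂 B]

/-- The divided power `a^{(r)} = a^r / [r]_p!`. -/
noncomputable def divPow (p : 𝕂) (a : B) (r : ℕ) : B := (qFact p r)⁻¹ • a ^ r

/-- `∑_{r=0}^{m} (-1)^r a^{(m-r)} b a^{(r)}`. -/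
noncomputable def serre (p : 𝕂) (m : ℕ) (a b : B) : B :=
  ∑ r ∈ Finset.range (m + 1), ((-1 : 𝕂) ^ r) • (divPow p a (m - r) * b * divPow p a r)

theorem map_divPow {C : Type*} [Ring C] [Algebra 𝕂 C] (f : B →ₐ[𝕂] C) (p : 𝕂) (a : B) (r : ℕ) :
    f (divPow p a r) = divPow p (f a) r := by
  rw [divPow, divPow, map_smul, map_pow]

theorem map_serre {C : Type*} [Ring C] [Algebra 𝕂 C] (f : B →ₐ[𝕂] C) (p : 𝕂) (m : ℕ) (a b : B) :
    f (serre p m a b) = serre p m (f a) (f b) := by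
  simp only [serre, map_sum, map_smul, map_mul, map_divPow]

theorem divPow_smul {A : Type*} [CommRing A] [Algebra 𝕂 A] [Algebra A B] [IsScalarTower 𝕂 A B]
    (p : 𝕂) (a : B) (r : ℕ) (w : A) : divPow p (w • a) r = w ^ r • divPow p a r := by
  rw [divPow, divPow, smul_pow, smul_comm]

theorem serre_smul {A : Type*} [CommRing A] [Algebra 𝕂 A] [Algebra A B] [IsScalarTower 𝕂 A B]
    (p : 𝕂) (m : ℕ) (a b : B) (w z : A) :
    serre p m (w • a) (z • b) = (w ^ m * z) • serre p m a b := by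
  rw [serre, serre, Finset.smul_sum]
  refine Finset.sum_congr rfl fun r hr => ?_
  have h : m - r + r = m := Nat.sub_add_cancel (Nat.lt_succ_iff.1 (Finset.mem_range.1 hr))
  rw [divPow_smul, divPow_smul, smul_comm (w ^ m * z)]
  congr 1
  rw [smul_mul_smul_comm, smul_mul_smul_comm]
  congr 1
  rw [mul_right_comm, ← pow_add, h]

theorem serre_comm_mul (p : 𝕂) (m : ℕ) (a b g h : B) (hga : Commute g a) (hgh : Commute g h)
    (hgb : Commute g b) (hha : Commute h a) :
    serre p m (g * a) (h * b) = g ^ m * h * serre p m a b := by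
  simp only [serre, divPow, Finset.mul_sum]
  refine Finset.sum_congr rfl fun r hr => ?_
  have e : m - r + r = m := by simp at hr; omega
  simp only [mul_smul_comm, smul_mul_assoc, hga.mul_pow]
  congr 3
  have h1 : Commute (a ^ (m - r)) h := (hha.pow_right _).symm
  have h2 : Commute (a ^ (m - r)) (g ^ r) := (hga.pow_pow _ _).symm
  have h3 : Commute b (g ^ r) := (hgb.pow_left _).symm
  have h4 : Commute h (g ^ r) := (hgh.pow_left _).symm
  calc g ^ (m - r) * a ^ (m - r) * (h * b) * (g ^ r * a ^ r)
      = g ^ (m - r) * (a ^ (m - r) * h) * (b * g ^ r) * a ^ r := by noncomm_ring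
    _ = g ^ (m - r) * h * (a ^ (m - r) * g ^ r) * b * a ^ r := by
        rw [h1.eq, h3.eq]; noncomm_ring
    _ = g ^ (m - r) * (h * g ^ r) * a ^ (m - r) * b * a ^ r := by
        rw [h2.eq]; noncomm_ring
    _ = g ^ (m - r + r) * h * (a ^ (m - r) * b * a ^ r) := by
        rw [h4.eq, pow_add]; noncomm_ring
    _ = _ := by rw [e]
theorem qInt_one {p : 𝕂} (hp : p - p⁻¹ ≠ 0) : qInt p 1 = 1 := by
  simp [qInt, div_self hp]

theorem qInt_two {p : 𝕂} (hp : p - p⁻¹ ≠ 0) : qInt p 2 = p + p⁻¹ := by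
  rw [qInt, div_eq_iff hp]; ring

theorem qInt_three {p : 𝕂} (hp0 : p ≠ 0) (hp : p - p⁻¹ ≠ 0) :
    qInt p 3 = p ^ 2 + 1 + p⁻¹ ^ 2 := by
  rw [qInt, div_eq_iff hp]; field_simp; ring

theorem serre_one {p : 𝕂} (hp : p - p⁻¹ ≠ 0) (a b : B) : serre p 1 a b = a * b - b * a := by
  simp [serre, divPow, qFact, Finset.sum_range_succ, qInt_one hp, sub_eq_add_neg]

theorem serre_two {p : 𝕂} (hp : p - p⁻¹ ≠ 0) (h2 : p + p⁻¹ ≠ 0) (a b : B) :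
    serre p 2 a b =
      (p + p⁻¹)⁻¹ • (a * a * b - (p + p⁻¹) • (a * b * a) + b * a * a) := by
  have q2 := qInt_two hp
  generalize p + p⁻¹ = d at q2 h2 ⊢
  simp only [serre, divPow, qFact, Finset.sum_range_succ, Finset.prod_range_succ, qInt_one hp,
    q2, Finset.sum_range_zero, Finset.prod_range_zero, zero_add, Nat.sub_zero,
    Nat.reduceSub, Nat.reduceAdd, pow_zero, pow_one, pow_two, mul_one, one_mul, inv_one, one_smul,
    smul_mul_assoc, mul_smul_comm, Nat.sub_self]
  simp only [mul_assoc]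
  match_scalars <;> field_simp

theorem serre_three {p : 𝕂} (hp0 : p ≠ 0) (hp : p - p⁻¹ ≠ 0) (h2 : p + p⁻¹ ≠ 0)
    (h3 : p ^ 2 + 1 + p⁻¹ ^ 2 ≠ 0) (a b : B) :
    serre p 3 a b = ((p + p⁻¹) * (p ^ 2 + 1 + p⁻¹ ^ 2))⁻¹ •
      (a * a * a * b - (p ^ 2 + 1 + p⁻¹ ^ 2) • (a * a * b * a)
        + (p ^ 2 + 1 + p⁻¹ ^ 2) • (a * b * a * a) - b * a * a * a) := by
  have q2 := qInt_two hp
  have q3 := qInt_three hp0 hp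
  generalize p ^ 2 + 1 + p⁻¹ ^ 2 = e at q3 h3 ⊢
  generalize p + p⁻¹ = d at q2 h2 ⊢
  simp only [serre, divPow, qFact, Finset.sum_range_succ, Finset.prod_range_succ, qInt_one hp,
    q2, q3,
    Finset.sum_range_zero, Finset.prod_range_zero, zero_add, Nat.sub_zero,
    Nat.reduceSub, Nat.reduceAdd, pow_zero, pow_succ, mul_one, one_mul, inv_one, one_smul,
    smul_mul_assoc, mul_smul_comm, Nat.sub_self]
  simp only [mul_assoc]
  match_scalars <;> field_simp

/-- The quantum Serre expression is additive on suitably `q`-commuting pairs. -/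
theorem serre_add {p : 𝕂} (hp0 : p ≠ 0) (hp : ∀ m : ℕ, m ≠ 0 → p ^ m ≠ 1) {m : ℕ}
    (hm : m = 1 ∨ m = 2 ∨ m = 3) {a b a' b' : B}
    (haa : a' * a = (p ^ 2) • (a * a')) (hab : a' * b = (p ^ (1 - m : ℤ)) • (b * a'))
    (hba : b' * a = (p ^ (1 - m : ℤ)) • (a * b'))
    (h : serre p m a b = 0) (h' : serre p m a' b' = 0) : serre p m (a + a') (b + b') = 0 := by
  have hp2 : p ^ 2 - 1 ≠ 0 := sub_ne_zero.2 (hp 2 (by norm_num))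
  have e1 : p - p⁻¹ ≠ 0 := by
    have : p - p⁻¹ = (p ^ 2 - 1) / p := by field_simp
    rw [this]; exact div_ne_zero hp2 hp0
  have e2 : p + p⁻¹ ≠ 0 := by
    intro h0
    apply hp 4 (by norm_num)
    field_simp at h0
    linear_combination (p ^ 2 - 1) * h0
  have e3 : p ^ 2 + 1 + p⁻¹ ^ 2 ≠ 0 := by
    intro h0
    apply hp 6 (by norm_num)
    field_simp at h0
    linear_combination (p ^ 2 - 1) * h0
  have aux : ∀ {c : 𝕂} {s t : B}, s * t = c • (t * s) → ∀ z, s * (t * z) = c • (t * (s * z)) := by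
    intro c s t hst z
    rw [← mul_assoc, hst, smul_mul_assoc, mul_assoc]
  rcases hm with rfl | rfl | rfl
  · rw [serre_one e1] at *
    simp only [Nat.cast_one, sub_self, zpow_zero, one_smul] at hab hba
    have : (a + a') * (b + b') - (b + b') * (a + a') =
      (a * b - b * a) + (a' * b' - b' * a') + (a' * b - b * a') - (b' * a - a * b') := by
      noncomm_ring
    rw [this, h, h', hab, hba]; simp
  · rw [serre_two e1 e2] at *
    rw [smul_eq_zero_iff_right (inv_ne_zero e2)] at *
    have hc : (p ^ (1 - ((2 : ℕ) : ℤ))) = p⁻¹ := by norm_num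
    rw [hc] at hab hba
    rw [← add_zero (0 : B)]
    nth_rw 1 [← h]
    rw [← h']
    simp only [mul_add, add_mul, mul_assoc, haa, hab, hba, aux haa, aux hab, aux hba,
      mul_smul_comm, smul_mul_assoc, smul_smul, smul_add]
    match_scalars <;> field_simp <;> ring
  · rw [serre_three hp0 e1 e2 e3] at *
    rw [smul_eq_zero_iff_right (inv_ne_zero (mul_ne_zero e2 e3))] at *
    have hc : (p ^ (1 - ((3 : ℕ) : ℤ))) = (p ^ 2)⁻¹ := by
      rw [show (1 - ((3 : ℕ) : ℤ)) = -2 by norm_num, zpow_neg]; norm_cast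
    rw [hc] at hab hba
    rw [← add_zero (0 : B)]
    nth_rw 1 [← h]
    rw [← h']
    simp only [mul_add, add_mul, mul_assoc, haa, hab, hba, aux haa, aux hab, aux hba,
      mul_smul_comm, smul_mul_assoc, smul_smul, smul_add]
    match_scalars <;> field_simp <;> ring

end Serre

/-! ## Untwisted affine types of classical Lie type -/

/-- The four classical series. -/
inductive Letter
  | A | B | C | D

/-- Smallest rank considered in each series. -/
def Letter.minRank : Letter → ℕ
  | .A => 1
  | .B => 1
  | .C => 1
  | .D => 3

/-- An untwisted affine type `A_n^{(1)}`, `B_n^{(1)}`, `C_n^{(1)}` (`n ≥ 1`) or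
`D_n^{(1)}` (`n ≥ 3`). -/
structure AffineType where
  letter : Letter
  n : ℕ
  le_n : letter.minRank ≤ n

/-- The standard coordinate vector `ε_k`. -/
def eps (k : ℤ) : ℤ → ℤ := fun l => if l = k then 1 else 0

namespace AffineType

variable (t : AffineType)

/-- The index set `I = {0, 1, …, n}` of the affine Dynkin diagram. -/
abbrev I : Type := Fin (t.n + 1)

/-- The simple roots, with `α_1, …, α_n` the standard simple roots of the finite root
system in the coordinates `ε_k`, and `α_0` the negative of its highest root. -/
def root (i : ℕ) : ℤ → ℤ :=
  match t.letter with
  | .A => if i = 0 then eps (t.n + 1) - eps 1 else eps i - eps (i + 1)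
  | .B => if i = 0 then (if t.n = 1 then - eps 1 else - eps 1 - eps 2)
      else if i = t.n then eps t.n else eps i - eps (i + 1)
  | .C => if i = 0 then (-2 : ℤ) • eps 1
      else if i = t.n then (2 : ℤ) • eps t.n else eps i - eps (i + 1)
  | .D => if i = 0 then - eps 1 - eps 2
      else if i = t.n then eps (t.n - 1) + eps t.n else eps i - eps (i + 1)

/-- The standard inner product `(ε_k, ε_l) = δ_{kl}`. -/
noncomputable def ip (v w : ℤ → ℤ) : ℤ := ∑ k ∈ Finset.Icc (1 : ℤ) (t.n + 1), v k * w k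

/-- The affine Cartan matrix `a_{ij} = 2 (α_i, α_j) / (α_i, α_i)`. -/
noncomputable def cartan (i j : t.I) : ℤ :=
  2 * t.ip (t.root i) (t.root j) / t.ip (t.root i) (t.root i)

/-- `q_i = q^{d_i}`, where `d_i = (α_i, α_i) / 2`. -/
noncomputable def qi (i : t.I) : 𝕂 := qh ^ t.ip (t.root i) (t.root i)

/-! ### Inner products of simple roots -/

theorem ip_eps (k l : ℤ) :
    t.ip (eps k) (eps l) = if k = l ∧ 1 ≤ k ∧ k ≤ t.n + 1 then 1 else 0 := by
  simp only [ip, eps, ite_mul, one_mul, zero_mul, Finset.sum_ite_eq', Finset.mem_Icc]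
  split_ifs <;> first | rfl | (exfalso; omega)

theorem ip_comm (v w : ℤ → ℤ) : t.ip v w = t.ip w v := by
  simp only [ip, mul_comm]

theorem ip_add_left (u v w : ℤ → ℤ) : t.ip (u + v) w = t.ip u w + t.ip v w := by
  simp only [ip, Pi.add_apply, add_mul, Finset.sum_add_distrib]

theorem ip_smul_left (c : ℤ) (v w : ℤ → ℤ) : t.ip (c • v) w = c * t.ip v w := by
  simp only [ip, Pi.smul_apply, smul_eq_mul, Finset.mul_sum, mul_assoc]

theorem ip_neg_left (v w : ℤ → ℤ) : t.ip (-v) w = - t.ip v w := by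
  simp only [ip, Pi.neg_apply, neg_mul, Finset.sum_neg_distrib]

theorem ip_sub_left (u v w : ℤ → ℤ) : t.ip (u - v) w = t.ip u w - t.ip v w := by
  rw [sub_eq_add_neg, ip_add_left, ip_neg_left, sub_eq_add_neg]

theorem ip_add_right (u v w : ℤ → ℤ) : t.ip w (u + v) = t.ip w u + t.ip w v := by
  rw [ip_comm, ip_add_left, ip_comm, t.ip_comm v]

theorem ip_smul_right (c : ℤ) (v w : ℤ → ℤ) : t.ip w (c • v) = c * t.ip w v := by
  rw [ip_comm, ip_smul_left, ip_comm]

theorem ip_neg_right (v w : ℤ → ℤ) : t.ip w (-v) = - t.ip w v := by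
  rw [ip_comm, ip_neg_left, ip_comm]

theorem ip_sub_right (u v w : ℤ → ℤ) : t.ip w (u - v) = t.ip w u - t.ip w v := by
  rw [ip_comm, ip_sub_left, ip_comm, t.ip_comm v]

set_option maxHeartbeats 2000000 in
/-- The possible values of the inner products of two distinct simple roots. -/
theorem root_cases (i j : t.I) (hij : i ≠ j) :
    let a := t.ip (t.root i) (t.root i)
    let b := t.ip (t.root j) (t.root j)
    let c := t.ip (t.root i) (t.root j)
    (a = 1 ∨ a = 2 ∨ a = 4) ∧ (b = 1 ∨ b = 2 ∨ b = 4) ∧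
      (c = 0 ∨ (c = -1 ∧ a = 1 ∧ b = 1 ∧ t.letter = .B ∧ t.n = 1) ∨
        (c = -1 ∧ a = 2 ∧ b = 2) ∨ (c = -1 ∧ a = 1 ∧ b = 2) ∨ (c = -1 ∧ a = 2 ∧ b = 1) ∨
        (c = -2 ∧ a = 2 ∧ b = 2) ∨ (c = -2 ∧ a = 2 ∧ b = 4) ∨ (c = -2 ∧ a = 4 ∧ b = 2) ∨
        (c = -4 ∧ a = 4 ∧ b = 4)) := by
  have hne : (i : ℕ) ≠ (j : ℕ) := fun h => hij (Fin.ext h)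
  have hi := i.2
  have hj := j.2
  generalize (i : ℕ) = i' at *
  generalize (j : ℕ) = j' at *
  obtain ⟨l, n, hn⟩ := t
  have h3 : i' + 1 = j' ∨ j' + 1 = i' ∨ i' + 1 < j' ∨ j' + 1 < i' := by omega
  dsimp only at hi hj
  cases l <;> simp only [Letter.minRank] at hn <;>
    simp only [root] <;> split_ifs <;>
    simp only [ip_add_left, ip_sub_left, ip_neg_left, ip_smul_left, ip_add_right, ip_sub_right,
      ip_neg_right, ip_smul_right, ip_eps, false_and, and_false, true_and, false_or]
  all_goals rcases h3 with h3 | h3 | h3 | h3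
  all_goals try (exfalso; omega)
  all_goals simp (disch := omega) only [if_pos, if_neg]
  all_goals first
    | (norm_num; done)
    | (norm_num; omega)

theorem root_ne_zero (i : t.I) : t.ip (t.root i) (t.root i) ≠ 0 := by
  by_cases h : (i : ℕ) = 0
  · have hn : 1 ≤ t.n := by
      have := t.le_n
      revert this
      cases t.letter <;> simp only [Letter.minRank] <;> omega
    have := (t.root_cases i ⟨1, by omega⟩ (by intro e; simp [e] at h)).1
    omega
  · have := (t.root_cases i 0 (by intro e; simp [e] at h)).1
    omega

theorem cartan_mul (i j : t.I) (hij : i ≠ j) :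
    t.ip (t.root i) (t.root i) * t.cartan i j = 2 * t.ip (t.root i) (t.root j) := by
  rw [cartan]
  apply Int.mul_ediv_cancel'
  have := t.root_cases i j hij
  dsimp only at this
  obtain ⟨h1, h2, h3⟩ := this
  rcases h1 with h | h | h <;> rw [h] at h3 ⊢ <;> omega

theorem cartan_self (i : t.I) : t.cartan i i = 2 := by
  rw [cartan]
  exact Int.mul_ediv_cancel _ (t.root_ne_zero i)

theorem cartan_mul' (i j : t.I) :
    t.ip (t.root i) (t.root i) * t.cartan i j = 2 * t.ip (t.root i) (t.root j) := by
  by_cases h : i = j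
  · subst h; rw [cartan_self, mul_comm]
  · exact t.cartan_mul i j h

theorem cartan_cases (i j : t.I) (hij : i ≠ j) :
    t.cartan i j = 0 ∨ t.cartan i j = -1 ∨ t.cartan i j = -2 := by
  have h0 := t.cartan_mul i j hij
  obtain ⟨h1, h2, h3⟩ := t.root_cases i j hij
  rcases h1 with h | h | h <;> rw [h] at h3 h0 <;> omega

theorem qi_zpow_cartan (i j : t.I) : t.qi i ^ t.cartan i j = q ^ t.ip (t.root i) (t.root j) := by
  rw [qi, ← zpow_mul, cartan_mul', zpow_mul, ← qh_sq]; norm_cast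

theorem qi_ne_zero (i : t.I) : t.qi i ≠ 0 := zpow_ne_zero _ qh_ne_zero

theorem qi_pow_ne_one (i : t.I) {m : ℕ} (hm : m ≠ 0) : t.qi i ^ m ≠ 1 := by
  have hpos : ∃ d : ℕ, d ≠ 0 ∧ t.ip (t.root i) (t.root i) = d := by
    refine ⟨(t.ip (t.root i) (t.root i)).toNat, ?_, ?_⟩
    · have := t.root_ne_zero i
      have h2 : 0 ≤ t.ip (t.root i) (t.root i) := Finset.sum_nonneg fun k _ => mul_self_nonneg _
      omega
    · have h2 : 0 ≤ t.ip (t.root i) (t.root i) := Finset.sum_nonneg fun k _ => mul_self_nonneg _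
      omega
  obtain ⟨d, hd, h⟩ := hpos
  rw [qi, h, zpow_natCast, ← pow_mul]
  exact qh_pow_ne_one (mul_ne_zero hd hm)

end AffineType

/-! ## The quantum affine algebra -/

/-- The generators `x_i`, `y_i`, `k_i`, `k_i^{-1}`. -/
inductive Gen (t : AffineType)
  | x (i : t.I)
  | y (i : t.I)
  | k (i : t.I)
  | k' (i : t.I)

section Relations

variable (t : AffineType) {B : Type*} [Ring B] [Algebra 𝕂 B]

/-- The Drinfeld-Jimbo relations for elements `x_i`, `y_i`, `k_i`, `k'_i = k_i^{-1}` of an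
algebra. -/
structure DJRelations (x y k k' : t.I → B) : Prop where
  k_mul_k' : ∀ i, k i * k' i = 1
  k'_mul_k : ∀ i, k' i * k i = 1
  k_comm : ∀ i j, k i * k j = k j * k i
  k_x : ∀ i j, k i * x j = (t.qi i ^ t.cartan i j) • (x j * k i)
  k_y : ∀ i j, k i * y j = (t.qi i ^ (-t.cartan i j)) • (y j * k i)
  x_y : ∀ i j, x i * y j - y j * x i =
    if i = j then (t.qi i - (t.qi i)⁻¹)⁻¹ • (k i - k' i) else 0
  serre_x : ∀ i j, i ≠ j → serre (t.qi i) (1 - t.cartan i j).toNat (x i) (x j) = 0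
  serre_y : ∀ i j, i ≠ j → serre (t.qi i) (1 - t.cartan i j).toNat (y i) (y j) = 0

end Relations

section Uq

variable (t : AffineType)

/-- Words in the generators. -/
abbrev FreeGen : Type := FreeAlgebra 𝕂 (Gen t)

/-- The defining relations of the quantum affine algebra. -/
inductive UqRel : FreeGen t → FreeGen t → Prop
  | k_mul_k' (i : t.I) :
      UqRel (FreeAlgebra.ι 𝕂 (Gen.k i) * FreeAlgebra.ι 𝕂 (Gen.k' i)) 1
  | k'_mul_k (i : t.I) :
      UqRel (FreeAlgebra.ι 𝕂 (Gen.k' i) * FreeAlgebra.ι 𝕂 (Gen.k i)) 1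
  | k_comm (i j : t.I) :
      UqRel (FreeAlgebra.ι 𝕂 (Gen.k i) * FreeAlgebra.ι 𝕂 (Gen.k j))
        (FreeAlgebra.ι 𝕂 (Gen.k j) * FreeAlgebra.ι 𝕂 (Gen.k i))
  | k_x (i j : t.I) :
      UqRel (FreeAlgebra.ι 𝕂 (Gen.k i) * FreeAlgebra.ι 𝕂 (Gen.x j))
        ((t.qi i ^ t.cartan i j) • (FreeAlgebra.ι 𝕂 (Gen.x j) * FreeAlgebra.ι 𝕂 (Gen.k i)))
  | k_y (i j : t.I) :
      UqRel (FreeAlgebra.ι 𝕂 (Gen.k i) * FreeAlgebra.ι 𝕂 (Gen.y j))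
        ((t.qi i ^ (-t.cartan i j)) • (FreeAlgebra.ι 𝕂 (Gen.y j) * FreeAlgebra.ι 𝕂 (Gen.k i)))
  | x_y (i j : t.I) :
      UqRel (FreeAlgebra.ι 𝕂 (Gen.x i) * FreeAlgebra.ι 𝕂 (Gen.y j)
          - FreeAlgebra.ι 𝕂 (Gen.y j) * FreeAlgebra.ι 𝕂 (Gen.x i))
        (if i = j then (t.qi i - (t.qi i)⁻¹)⁻¹ •
          (FreeAlgebra.ι 𝕂 (Gen.k i) - FreeAlgebra.ι 𝕂 (Gen.k' i)) else 0)
  | serre_x (i j : t.I) (h : i ≠ j) :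
      UqRel (serre (t.qi i) (1 - t.cartan i j).toNat
        (FreeAlgebra.ι 𝕂 (Gen.x i)) (FreeAlgebra.ι 𝕂 (Gen.x j))) 0
  | serre_y (i j : t.I) (h : i ≠ j) :
      UqRel (serre (t.qi i) (1 - t.cartan i j).toNat
        (FreeAlgebra.ι 𝕂 (Gen.y i)) (FreeAlgebra.ι 𝕂 (Gen.y j))) 0

/-- The Drinfeld-Jimbo quantum affine algebra `U_q(ĝ)` over `𝕂`. -/
def Uq : Type := RingQuot (UqRel t)

noncomputable instance : Ring (Uq t) := inferInstanceAs (Ring (RingQuot (UqRel t)))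

noncomputable instance : Algebra 𝕂 (Uq t) := inferInstanceAs (Algebra 𝕂 (RingQuot (UqRel t)))

/-- The canonical projection from words in the generators. -/
noncomputable def Uq.mk : FreeGen t →ₐ[𝕂] Uq t := RingQuot.mkAlgHom 𝕂 (UqRel t)

variable {t}

theorem Uq.mk_rel {a b : FreeGen t} (h : UqRel t a b) : Uq.mk t a = Uq.mk t b :=
  RingQuot.mkAlgHom_rel 𝕂 h

/-- The generator `x_i`. -/
noncomputable def Uq.x (i : t.I) : Uq t := Uq.mk t (FreeAlgebra.ι 𝕂 (Gen.x i))
/-- The generator `y_i`. -/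
noncomputable def Uq.y (i : t.I) : Uq t := Uq.mk t (FreeAlgebra.ι 𝕂 (Gen.y i))
/-- The generator `k_i`. -/
noncomputable def Uq.k (i : t.I) : Uq t := Uq.mk t (FreeAlgebra.ι 𝕂 (Gen.k i))
/-- The generator `k_i^{-1}`. -/
noncomputable def Uq.k' (i : t.I) : Uq t := Uq.mk t (FreeAlgebra.ι 𝕂 (Gen.k' i))

theorem Uq.relations : DJRelations t (Uq.x (t := t)) Uq.y Uq.k Uq.k' where
  k_mul_k' i := by
    have h := Uq.mk_rel (.k_mul_k' i)
    simp only [map_mul, map_one] at h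
    exact h
  k'_mul_k i := by
    have h := Uq.mk_rel (.k'_mul_k i)
    simp only [map_mul, map_one] at h
    exact h
  k_comm i j := by
    have h := Uq.mk_rel (.k_comm i j)
    simp only [map_mul] at h
    exact h
  k_x i j := by
    have h := Uq.mk_rel (.k_x i j)
    simp only [map_mul, map_smul] at h
    exact h
  k_y i j := by
    have h := Uq.mk_rel (.k_y i j)
    simp only [map_mul, map_smul] at h
    exact h
  x_y i j := by
    have h := Uq.mk_rel (.x_y i j)
    simp only [map_sub, map_mul, apply_ite (Uq.mk t), map_smul, map_zero] at h
    exact h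
  serre_x i j hij := by
    have h := Uq.mk_rel (.serre_x i j hij)
    simp only [map_serre, map_zero] at h
    exact h
  serre_y i j hij := by
    have h := Uq.mk_rel (.serre_y i j hij)
    simp only [map_serre, map_zero] at h
    exact h

/-- The assignment of values to the generators. -/
def genFun {B : Type*} (x y k k' : t.I → B) : Gen t → B
  | .x i => x i
  | .y i => y i
  | .k i => k i
  | .k' i => k' i

/-- The universal property of `U_q(ĝ)`. -/
noncomputable def Uq.lift {B : Type*} [Ring B] [Algebra 𝕂 B] {x y k k' : t.I → B}
    (h : DJRelations t x y k k') : Uq t →ₐ[𝕂] B :=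
  RingQuot.liftAlgHom 𝕂 ⟨FreeAlgebra.lift 𝕂 (genFun x y k k'), fun a b hab => by
    induction hab with
    | k_mul_k' i => simpa [genFun] using h.k_mul_k' i
    | k'_mul_k i => simpa [genFun] using h.k'_mul_k i
    | k_comm i j => simpa [genFun] using h.k_comm i j
    | k_x i j => simpa only [map_mul, map_smul, FreeAlgebra.lift_ι_apply, genFun] using h.k_x i j
    | k_y i j => simpa only [map_mul, map_smul, FreeAlgebra.lift_ι_apply, genFun] using h.k_y i j
    | x_y i j =>
      rw [apply_ite (FreeAlgebra.lift 𝕂 (genFun x y k k'))]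
      simpa only [map_sub, map_mul, map_smul, map_zero, FreeAlgebra.lift_ι_apply, genFun] using h.x_y i j
    | serre_x i j hij =>
      simpa only [map_serre, map_zero, FreeAlgebra.lift_ι_apply, genFun] using h.serre_x i j hij
    | serre_y i j hij =>
      simpa only [map_serre, map_zero, FreeAlgebra.lift_ι_apply, genFun] using h.serre_y i j hij⟩

section

variable {B : Type*} [Ring B] [Algebra 𝕂 B] {x y k k' : t.I → B} (h : DJRelations t x y k k')

theorem Uq.lift_mk (g : Gen t) :
    Uq.lift h (Uq.mk t (FreeAlgebra.ι 𝕂 g)) = genFun x y k k' g :=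
  (RingQuot.liftAlgHom_mkAlgHom_apply 𝕂 _ _ _).trans (FreeAlgebra.lift_ι_apply _ _)

@[simp] theorem Uq.lift_x (i : t.I) : Uq.lift h (Uq.x i) = x i := Uq.lift_mk h _
@[simp] theorem Uq.lift_y (i : t.I) : Uq.lift h (Uq.y i) = y i := Uq.lift_mk h _
@[simp] theorem Uq.lift_k (i : t.I) : Uq.lift h (Uq.k i) = k i := Uq.lift_mk h _
@[simp] theorem Uq.lift_k' (i : t.I) : Uq.lift h (Uq.k' i) = k' i := Uq.lift_mk h _

end

/-! ### The coproduct -/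

section Comul

variable {B : Type*} [Ring B] [Algebra 𝕂 B] {x y k k' : t.I → B}

theorem DJRelations.x_k' (h : DJRelations t x y k k') (i j : t.I) : x j * k' i = (t.qi i ^ t.cartan i j) • (k' i * x j) := by
  calc x j * k' i = k' i * (k i * x j) * k' i := by
        rw [← mul_assoc (k' i), h.k'_mul_k, one_mul]
    _ = (t.qi i ^ t.cartan i j) • (k' i * x j * (k i * k' i)) := by
        rw [h.k_x]; simp only [mul_smul_comm, smul_mul_assoc, mul_assoc]
    _ = _ := by rw [h.k_mul_k', mul_one]

theorem DJRelations.y_k' (h : DJRelations t x y k k') (i j : t.I) : 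
    y j * k' i = (t.qi i ^ (-t.cartan i j)) • (k' i * y j) := by
  calc y j * k' i = k' i * (k i * y j) * k' i := by
        rw [← mul_assoc (k' i), h.k'_mul_k, one_mul]
    _ = (t.qi i ^ (-t.cartan i j)) • (k' i * y j * (k i * k' i)) := by
        rw [h.k_y]; simp only [mul_smul_comm, smul_mul_assoc, mul_assoc]
    _ = _ := by rw [h.k_mul_k', mul_one]

theorem DJRelations.k'_y (h : DJRelations t x y k k') (i j : t.I) :
    k' i * y j = (t.qi i ^ t.cartan i j) • (y j * k' i) := by
  rw [h.y_k', smul_smul, ← zpow_add₀ (t.qi_ne_zero i), add_neg_cancel, zpow_zero, one_smul]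

theorem DJRelations.k_k' (h : DJRelations t x y k k') (i j : t.I) : k i * k' j = k' j * k i := by
  calc k i * k' j = k' j * (k j * k i) * k' j := by
        rw [← mul_assoc (k' j), h.k'_mul_k, one_mul]
    _ = k' j * k i * (k j * k' j) := by rw [h.k_comm j i]; simp only [mul_assoc]
    _ = _ := by rw [h.k_mul_k', mul_one]

theorem DJRelations.k'_comm (h : DJRelations t x y k k') (i j : t.I) :
    k' i * k' j = k' j * k' i := by
  calc k' i * k' j = k' i * k' j * (k i * k' i) := by rw [h.k_mul_k', mul_one]
    _ = k' i * (k' j * k i) * k' i := by simp only [mul_assoc]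
    _ = k' i * k i * k' j * k' i := by rw [← h.k_k' i j]; simp only [mul_assoc]
    _ = _ := by rw [h.k'_mul_k, one_mul]

end Comul

theorem qi_zpow_symm (i j : t.I) : t.qi i ^ t.cartan i j = t.qi j ^ t.cartan j i := by
  rw [t.qi_zpow_cartan, t.qi_zpow_cartan, t.ip_comm]

theorem serre_exponent (i j : t.I) (hij : i ≠ j) :
    ((1 - t.cartan i j).toNat = 1 ∨ (1 - t.cartan i j).toNat = 2 ∨
      (1 - t.cartan i j).toNat = 3) ∧
    t.qi i ^ (1 - ((1 - t.cartan i j).toNat : ℤ)) = t.qi i ^ t.cartan i j := by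
  have h := t.cartan_cases i j hij
  refine ⟨by omega, ?_⟩
  congr 1
  omega

theorem comul_relations :
    DJRelations t (B := Uq t ⊗[𝕂] Uq t)
      (fun i => Uq.x i ⊗ₜ 1 + Uq.k i ⊗ₜ Uq.x i)
      (fun i => Uq.y i ⊗ₜ Uq.k' i + 1 ⊗ₜ Uq.y i)
      (fun i => Uq.k i ⊗ₜ Uq.k i)
      (fun i => Uq.k' i ⊗ₜ Uq.k' i) where
  k_mul_k' i := by
    rw [Algebra.TensorProduct.tmul_mul_tmul, Uq.relations.k_mul_k', Algebra.TensorProduct.one_def]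
  k'_mul_k i := by
    rw [Algebra.TensorProduct.tmul_mul_tmul, Uq.relations.k'_mul_k, Algebra.TensorProduct.one_def]
  k_comm i j := by
    simp only [Algebra.TensorProduct.tmul_mul_tmul, Uq.relations.k_comm i j]
  k_x i j := by
    simp only [mul_add, add_mul, Algebra.TensorProduct.tmul_mul_tmul, Uq.relations.k_x i j,
      Uq.relations.k_comm i j, mul_one, one_mul, smul_add, TensorProduct.smul_tmul',
      TensorProduct.tmul_smul]
  k_y i j := by
    simp only [mul_add, add_mul, Algebra.TensorProduct.tmul_mul_tmul, Uq.relations.k_y i j,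
      Uq.relations.k_k' i j, mul_one, one_mul, smul_add, TensorProduct.smul_tmul',
      TensorProduct.tmul_smul]
  x_y i j := by
    have e1 := Uq.relations.k_y i j
    have e2 := Uq.relations.x_k' j i
    have e3 := Uq.relations.x_y i j
    have e4 : (t.qi i ^ (-t.cartan i j)) * (t.qi j ^ t.cartan j i) = 1 := by
      rw [qi_zpow_symm j i, ← zpow_add₀ (t.qi_ne_zero i), neg_add_cancel, zpow_zero]
    have h0 : (Uq.x i ⊗ₜ[𝕂] 1 + Uq.k i ⊗ₜ Uq.x i) * (Uq.y j ⊗ₜ Uq.k' j + 1 ⊗ₜ Uq.y j)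
        - (Uq.y j ⊗ₜ Uq.k' j + 1 ⊗ₜ Uq.y j) * (Uq.x i ⊗ₜ[𝕂] 1 + Uq.k i ⊗ₜ Uq.x i)
        = (Uq.x i * Uq.y j - Uq.y j * Uq.x i) ⊗ₜ[𝕂] Uq.k' j
          + Uq.k (t := t) i ⊗ₜ[𝕂] (Uq.x i * Uq.y j - Uq.y j * Uq.x i) := by
      simp only [mul_add, add_mul, Algebra.TensorProduct.tmul_mul_tmul, mul_one, one_mul, e1, e2,
        TensorProduct.sub_tmul, TensorProduct.tmul_sub, TensorProduct.tmul_smul,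
        ← TensorProduct.smul_tmul', smul_smul, mul_comm (t.qi j ^ t.cartan j i), e4, one_smul]
      abel
    rw [h0, e3]
    split_ifs with hij
    · subst hij
      rw [← TensorProduct.smul_tmul', TensorProduct.tmul_smul, ← smul_add]
      congr 1
      rw [TensorProduct.sub_tmul, TensorProduct.tmul_sub]
      abel
    · simp
  serre_x i j hij := by
    obtain ⟨h1, h2⟩ := serre_exponent i j hij
    refine serre_add (t.qi_ne_zero i) (fun m hm => t.qi_pow_ne_one i hm) h1 ?_ ?_ ?_ ?_ ?_
    · simp only [Algebra.TensorProduct.tmul_mul_tmul, mul_one, one_mul, Uq.relations.k_x i i,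
        t.cartan_self, TensorProduct.smul_tmul']
      norm_cast
    · simp only [Algebra.TensorProduct.tmul_mul_tmul, mul_one, one_mul, Uq.relations.k_x i j,
        h2, TensorProduct.smul_tmul']
    · simp only [Algebra.TensorProduct.tmul_mul_tmul, mul_one, one_mul, Uq.relations.k_x j i,
        h2, TensorProduct.smul_tmul', qi_zpow_symm j i]
    · have h := map_serre (Algebra.TensorProduct.includeLeft : Uq t →ₐ[𝕂] Uq t ⊗[𝕂] Uq t) (t.qi i)
        (1 - t.cartan i j).toNat (Uq.x i) (Uq.x j)
      rw [Uq.relations.serre_x i j hij, map_zero] at h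
      exact h.symm
    · have h := serre_comm_mul (t.qi i) (1 - t.cartan i j).toNat
        ((1 : Uq t) ⊗ₜ[𝕂] Uq.x (t := t) i) (1 ⊗ₜ Uq.x j) (Uq.k i ⊗ₜ 1) (Uq.k j ⊗ₜ 1)
        (by simp [Commute, SemiconjBy]) (by simp [Commute, SemiconjBy, Uq.relations.k_comm i j])
        (by simp [Commute, SemiconjBy]) (by simp [Commute, SemiconjBy])
      have h' := map_serre (Algebra.TensorProduct.includeRight : Uq t →ₐ[𝕂] Uq t ⊗[𝕂] Uq t)
        (t.qi i) (1 - t.cartan i j).toNat (Uq.x i) (Uq.x j)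
      rw [Uq.relations.serre_x i j hij, map_zero] at h'
      simp only [Algebra.TensorProduct.includeRight_apply] at h'
      rw [← h', mul_zero] at h
      simpa only [Algebra.TensorProduct.tmul_mul_tmul, mul_one, one_mul] using h
  serre_y i j hij := by
    obtain ⟨h1, h2⟩ := serre_exponent i j hij
    rw [add_comm (Uq.y i ⊗ₜ[𝕂] Uq.k' i), add_comm (Uq.y j ⊗ₜ[𝕂] Uq.k' j)]
    refine serre_add (t.qi_ne_zero i) (fun m hm => t.qi_pow_ne_one i hm) h1 ?_ ?_ ?_ ?_ ?_
    · simp only [Algebra.TensorProduct.tmul_mul_tmul, mul_one, one_mul, Uq.relations.k'_y i i,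
        t.cartan_self, TensorProduct.tmul_smul]
      norm_cast
    · simp only [Algebra.TensorProduct.tmul_mul_tmul, mul_one, one_mul, Uq.relations.k'_y i j,
        h2, TensorProduct.tmul_smul]
    · simp only [Algebra.TensorProduct.tmul_mul_tmul, mul_one, one_mul, Uq.relations.k'_y j i,
        h2, TensorProduct.tmul_smul, qi_zpow_symm j i]
    · have h := map_serre (Algebra.TensorProduct.includeRight : Uq t →ₐ[𝕂] Uq t ⊗[𝕂] Uq t) (t.qi i)
        (1 - t.cartan i j).toNat (Uq.y i) (Uq.y j)
      rw [Uq.relations.serre_y i j hij, map_zero] at h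
      exact h.symm
    · have h := serre_comm_mul (t.qi i) (1 - t.cartan i j).toNat
        (Uq.y (t := t) i ⊗ₜ[𝕂] (1 : Uq t)) (Uq.y j ⊗ₜ 1) (1 ⊗ₜ Uq.k' i) (1 ⊗ₜ Uq.k' j)
        (by simp [Commute, SemiconjBy]) (by simp [Commute, SemiconjBy, Uq.relations.k'_comm i j])
        (by simp [Commute, SemiconjBy]) (by simp [Commute, SemiconjBy])
      have h' := map_serre (Algebra.TensorProduct.includeLeft : Uq t →ₐ[𝕂] Uq t ⊗[𝕂] Uq t)
        (t.qi i) (1 - t.cartan i j).toNat (Uq.y i) (Uq.y j)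
      rw [Uq.relations.serre_y i j hij, map_zero] at h'
      simp only [Algebra.TensorProduct.includeLeft_apply] at h'
      rw [← h', mul_zero] at h
      simpa only [Algebra.TensorProduct.tmul_mul_tmul, mul_one, one_mul] using h

/-- The coproduct of `U_q(ĝ)`. -/
noncomputable def Uq.comul (t : AffineType) : Uq t →ₐ[𝕂] Uq t ⊗[𝕂] Uq t :=
  Uq.lift comul_relations

end Uq

/-! ## The vector representation -/

namespace AffineType

variable (t : AffineType)

/-- The labels of the standard basis of `𝕂^N`: `{1, …, n+1}` in type `A`, `{-n, …, n}` in
type `B` and `{-n, …, -1, 1, …, n}` in types `C` and `D`. -/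
noncomputable def labels : Finset ℤ :=
  match t.letter with
  | .A => Finset.Icc 1 (t.n + 1)
  | .B => Finset.Icc (-t.n) t.n
  | .C => (Finset.Icc (-t.n : ℤ) t.n).erase 0
  | .D => (Finset.Icc (-t.n : ℤ) t.n).erase 0

/-- The index type of the standard basis of `𝕂^N`. -/
abbrev Idx : Type := {a : ℤ // a ∈ t.labels}

/-- `N × N` matrices. -/
abbrev Mat (A : Type) : Type := Matrix t.Idx t.Idx A

/-- The elementary matrix `E_{ij}`. -/
noncomputable def E (i j : ℤ) : t.Mat 𝕂 :=
  Matrix.of fun a b => if (a : ℤ) = i ∧ (b : ℤ) = j then 1 else 0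

/-- The sign `ϑ_i` in the orthogonal and symplectic cases. -/
def sgn (i : ℤ) : ℤ :=
  match t.letter with
  | .C => i.sign
  | _ => 1

/-- `F_{ij} = E_{ij} - ϑ_i ϑ_j E_{-j,-i}`. -/
noncomputable def F (i j : ℤ) : t.Mat 𝕂 := t.E i j - (t.sgn i * t.sgn j) • t.E (-j) (-i)

/-- The diagonal of `E_{jj}`. -/
def Ed (j : ℤ) : t.Idx → ℤ := fun a => if (a : ℤ) = j then 1 else 0

/-- The diagonal of `F_{jj} = E_{jj} - E_{-j,-j}`. -/
def Fd (j : ℤ) : t.Idx → ℤ := t.Ed j - t.Ed (-j)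

/-- The matrix `q^{∑ m_a E_{aa}} = ∑ q^{m_a} E_{aa}`. -/
noncomputable def qDiag (m : t.Idx → ℤ) : t.Mat 𝕂 := Matrix.diagonal fun a => q ^ m a

/-- The action of `x_i` at spectral parameter `1`. -/
noncomputable def xMat (i : ℕ) : t.Mat 𝕂 :=
  match t.letter with
  | .A => if i = 0 then t.E (t.n + 1) 1 else t.E i (i + 1)
  | .B =>
    if i = 0 then
      if t.n = 1 then cc • (t.E 0 (-1) - qh • t.E 1 0) else t.F (t.n - 1) (-t.n)
    else if i = t.n then cc • (t.E (-1) 0 - qh⁻¹ • t.E 0 1)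
    else t.F (-(t.n + 1 - i)) (-(t.n + 1 - i) + 1)
  | .C =>
    if i = 0 then (2⁻¹ : 𝕂) • t.F t.n (-t.n)
    else if i = t.n then (2⁻¹ : 𝕂) • t.F (-1) 1
    else t.F (-(t.n + 1 - i)) (-(t.n + 1 - i) + 1)
  | .D =>
    if i = 0 then t.F (t.n - 1) (-t.n)
    else if i = t.n then t.F (-2) 1
    else t.F (-(t.n + 1 - i)) (-(t.n + 1 - i) + 1)

/-- The action of `y_i` at spectral parameter `1`. -/
noncomputable def yMat (i : ℕ) : t.Mat 𝕂 :=
  match t.letter with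
  | .A => if i = 0 then t.E 1 (t.n + 1) else t.E (i + 1) i
  | .B =>
    if i = 0 then
      if t.n = 1 then cc • (t.E (-1) 0 - qh⁻¹ • t.E 0 1) else t.F (-t.n) (t.n - 1)
    else if i = t.n then cc • (t.E 0 (-1) - qh • t.E 1 0)
    else t.F (-(t.n + 1 - i) + 1) (-(t.n + 1 - i))
  | .C =>
    if i = 0 then (2⁻¹ : 𝕂) • t.F (-t.n) t.n
    else if i = t.n then (2⁻¹ : 𝕂) • t.F 1 (-1)
    else t.F (-(t.n + 1 - i) + 1) (-(t.n + 1 - i))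
  | .D =>
    if i = 0 then t.F (-t.n) (t.n - 1)
    else if i = t.n then t.F 1 (-2)
    else t.F (-(t.n + 1 - i) + 1) (-(t.n + 1 - i))

/-- The exponents of `q` in the diagonal matrix by which `k_i` acts. -/
def kExp (i : ℕ) : t.Idx → ℤ :=
  match t.letter with
  | .A => if i = 0 then t.Ed (t.n + 1) - t.Ed 1 else t.Ed i - t.Ed (i + 1)
  | .B =>
    if i = 0 then t.Fd (t.n - 1) + t.Fd t.n
    else if i = t.n then - t.Fd 1
    else t.Fd (t.n + 1 - i - 1) - t.Fd (t.n + 1 - i)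
  | .C =>
    if i = 0 then (2 : ℤ) • t.Fd t.n
    else if i = t.n then (-2 : ℤ) • t.Fd 1
    else t.Fd (t.n + 1 - i - 1) - t.Fd (t.n + 1 - i)
  | .D =>
    if i = 0 then t.Fd (t.n - 1) + t.Fd t.n
    else if i = t.n then - t.Fd 1 - t.Fd 2
    else t.Fd (t.n + 1 - i - 1) - t.Fd (t.n + 1 - i)

/-! ### Verification of the relations -/

theorem E_mul_E (i j k l : ℤ) :
    t.E i j * t.E k l = if j = k ∧ j ∈ t.labels then t.E i l else 0 := by
  ext a b
  rw [Matrix.mul_apply]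
  simp only [E, Matrix.of_apply]
  split_ifs with h
  · rw [Finset.sum_eq_single (⟨j, h.2⟩ : t.Idx)]
    · simp only [and_true, h.1, true_and, Matrix.of_apply]
      split_ifs <;> simp_all
    · intro c _ hc
      have : (c : ℤ) ≠ j := fun e => hc (Subtype.ext e)
      simp [this]
    · simp
  · refine Finset.sum_eq_zero fun c _ => ?_
    rw [mul_ite, mul_one, mul_zero]
    split_ifs with h1 h2
    · exact absurd ⟨by omega, by rw [← h2.2]; exact c.2⟩ h
    · rfl
    · rfl

/-- The weight of a basis vector. -/
def wt (a : ℤ) : ℤ → ℤ :=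
  match t.letter with
  | .A => eps a
  | _ => if a < 0 then eps (t.n + 1 + a) else if 0 < a then - eps (t.n + 1 - a) else 0

theorem mem_labels (a : ℤ) : a ∈ t.labels ↔
    match t.letter with
    | .A => 1 ≤ a ∧ a ≤ t.n + 1
    | .B => -t.n ≤ a ∧ a ≤ t.n
    | .C => a ≠ 0 ∧ -t.n ≤ a ∧ a ≤ t.n
    | .D => a ≠ 0 ∧ -t.n ≤ a ∧ a ≤ t.n := by
  unfold labels
  split <;> simp

theorem ip_zero_right (v : ℤ → ℤ) : t.ip v 0 = 0 := by
  simp [ip]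

theorem kExp_eq (i : t.I) (a : t.Idx) : t.kExp i a = t.ip (t.root i) (t.wt a) := by
  obtain ⟨a, ha⟩ := a
  rw [mem_labels] at ha
  have hi := i.2
  generalize (i : ℕ) = i' at *
  have hn := t.le_n
  have h3 : a < 0 ∨ a = 0 ∨ 0 < a := by omega
  cases hl : t.letter <;> rw [hl] at hn <;> simp only [hl, Letter.minRank] at hn ha
  · simp only [kExp, root, wt, hl]
    split_ifs <;> simp only [ip_sub_left, ip_eps, Pi.sub_apply, Ed] <;>
      omega
  all_goals
    simp only [kExp, root, wt, hl]
    rcases h3 with h3 | h3 | h3 <;> simp (disch := omega) only [if_pos, if_neg] <;>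
      (try (exfalso; omega)) <;> split_ifs <;>
    simp only [ip_add_left, ip_sub_left, ip_neg_left, ip_smul_left, ip_neg_right,
        ip_zero_right, ip_eps, Pi.sub_apply, Pi.add_apply, Pi.neg_apply, Pi.smul_apply, smul_eq_mul,
        Fd, Ed] <;>
      omega

/-- `M` shifts weights by `β`. -/
def HasWt (β : ℤ → ℤ) (M : t.Mat 𝕂) : Prop := ∀ a b : t.Idx, M a b ≠ 0 → t.wt a = t.wt b + β


variable {t}

theorem HasWt.E {β : ℤ → ℤ} {i j : ℤ} (h : i ∈ t.labels → j ∈ t.labels → t.wt i = t.wt j + β) :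
    t.HasWt β (t.E i j) := by
  intro a b hab
  simp only [AffineType.E, Matrix.of_apply, ne_eq, ite_eq_right_iff, not_forall] at hab
  obtain ⟨⟨rfl, rfl⟩, -⟩ := hab
  exact h a.2 b.2

theorem HasWt.smul {S : Type*} [SMulZeroClass S 𝕂] {β : ℤ → ℤ} {M : t.Mat 𝕂} (h : t.HasWt β M)
    (c : S) : t.HasWt β (c • M) := by
  intro a b hab
  refine h a b fun e => hab ?_
  rw [Matrix.smul_apply, e, smul_zero]

theorem HasWt.add {β : ℤ → ℤ} {M N : t.Mat 𝕂} (h : t.HasWt β M) (h' : t.HasWt β N) :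
    t.HasWt β (M + N) := by
  intro a b hab
  by_cases e : M a b = 0
  · refine h' a b fun e' => hab ?_
    rw [Matrix.add_apply, e, e', add_zero]
  · exact h a b e

theorem HasWt.sub {β : ℤ → ℤ} {M N : t.Mat 𝕂} (h : t.HasWt β M) (h' : t.HasWt β N) :
    t.HasWt β (M - N) := by
  intro a b hab
  by_cases e : M a b = 0
  · refine h' a b fun e' => hab ?_
    rw [Matrix.sub_apply, e, e', sub_zero]
  · exact h a b e

theorem HasWt.mul {β γ : ℤ → ℤ} {M N : t.Mat 𝕂} (h : t.HasWt β M) (h' : t.HasWt γ N) :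
    t.HasWt (β + γ) (M * N) := by
  intro a b hab
  rw [Matrix.mul_apply] at hab
  obtain ⟨c, -, hc⟩ := Finset.exists_ne_zero_of_sum_ne_zero hab
  rw [h a c (left_ne_zero_of_mul hc), h' c b (right_ne_zero_of_mul hc)]
  abel

theorem HasWt.pow {β : ℤ → ℤ} {M : t.Mat 𝕂} (h : t.HasWt β M) (r : ℕ) :
    t.HasWt ((r : ℤ) • β) (M ^ r) := by
  induction r with
  | zero =>
    intro a b hab
    rw [pow_zero, Matrix.one_apply] at hab
    simp only [ne_eq, ite_eq_right_iff, not_forall] at hab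
    rw [hab.1]; simp
  | succ r ih =>
    rw [pow_succ]
    have := ih.mul h
    rwa [show (((r + 1 : ℕ) : ℤ)) • β = (r : ℤ) • β + β by push_cast; rw [add_smul, one_smul]]

theorem HasWt.serre {β γ : ℤ → ℤ} {M N : t.Mat 𝕂} (h : t.HasWt β M) (h' : t.HasWt γ N) (p : 𝕂)
    (m : ℕ) : t.HasWt ((m : ℤ) • β + γ) (QRefl.serre p m M N) := by
  rw [QRefl.serre]
  refine Finset.sum_induction _ (fun M => t.HasWt ((m : ℤ) • β + γ) M) (fun _ _ => HasWt.add) ?_ ?_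
  · intro a b hab
    exact absurd rfl hab
  · intro r hr
    have h1 := (((h.pow (m - r)).smul (qFact p (m - r))⁻¹).mul h').mul
      ((h.pow r).smul (qFact p r)⁻¹)
    have e : ((m - r : ℕ) : ℤ) = m - r := by
      have := Finset.mem_range.1 hr
      omega
    rw [e, show ((m : ℤ) - r) • β + γ + (r : ℤ) • β = (m : ℤ) • β + γ by rw [sub_smul]; abel] at h1
    exact h1.smul _

theorem HasWt.qDiag_mul {β : ℤ → ℤ} {M : t.Mat 𝕂} (h : t.HasWt β M) (i : t.I) :
    t.qDiag (t.kExp i) * M = (q ^ t.ip (t.root i) β) • (M * t.qDiag (t.kExp i)) := by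
  ext a b
  rw [qDiag, Matrix.diagonal_mul, Matrix.smul_apply, Matrix.mul_diagonal, smul_eq_mul]
  by_cases e : M a b = 0
  · simp [e]
  · rw [kExp_eq, kExp_eq, h a b e, ip_add_right, zpow_add₀ q_ne_zero]
    ring

/-- Differences of weights are short. -/
theorem ip_wt_sub (a b : ℤ) :
    t.ip (t.wt a - t.wt b) (t.wt a - t.wt b) ≤ 4 ∧
      (t.letter = .A → t.ip (t.wt a - t.wt b) (t.wt a - t.wt b) ≤ 2) := by
  cases hl : t.letter <;> simp only [wt, hl, reduceCtorEq, false_imp_iff, and_true, true_imp_iff]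
  · simp only [ip_sub_left, ip_sub_right, ip_eps]
    (repeat split_ifs) <;> omega
  all_goals
    split_ifs <;>
    simp only [ip_sub_left, ip_sub_right, ip_neg_left, ip_neg_right, ip_zero_right, ip_eps,
      t.ip_comm 0] <;>
    (repeat split_ifs) <;> omega

theorem HasWt.eq_zero {β : ℤ → ℤ} {M : t.Mat 𝕂} (h : t.HasWt β M)
    (hβ : 4 < t.ip β β ∨ (t.letter = .A ∧ 2 < t.ip β β)) : M = 0 := by
  ext a b
  by_contra e
  have h1 := h a b e
  have h2 := ip_wt_sub (t := t) a b
  rw [h1, add_sub_cancel_left] at h2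
  rcases hβ with h3 | ⟨h3, h4⟩
  · omega
  · have := h2.2 h3
    omega

variable (t)

theorem xMat_wt (i : t.I) : t.HasWt (t.root i) (t.xMat i) := by
  have hi := i.2
  generalize (i : ℕ) = i' at *
  have hn := t.le_n
  cases hl : t.letter <;> rw [hl] at hn <;> simp only [Letter.minRank] at hn <;>
    simp only [xMat, root, hl, F] <;> split_ifs
  all_goals
    repeat' first | apply HasWt.smul | apply HasWt.sub | apply HasWt.E
  all_goals
    intro h1 h2
    rw [mem_labels] at h1 h2
    simp only [hl] at h1 h2
    simp only [wt, hl]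
    try simp (disch := omega) only [if_pos, if_neg]
    funext k
    simp only [Pi.add_apply, Pi.sub_apply, Pi.neg_apply, Pi.smul_apply, Pi.zero_apply, smul_eq_mul, eps]
    omega

theorem yMat_wt (i : t.I) : t.HasWt (- t.root i) (t.yMat i) := by
  have hi := i.2
  generalize (i : ℕ) = i' at *
  have hn := t.le_n
  cases hl : t.letter <;> rw [hl] at hn <;> simp only [Letter.minRank] at hn <;>
    simp only [yMat, root, hl, F] <;> split_ifs
  all_goals
    repeat' first | apply HasWt.smul | apply HasWt.sub | apply HasWt.E
  all_goals
    intro h1 h2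
    rw [mem_labels] at h1 h2
    simp only [hl] at h1 h2
    simp only [wt, hl]
    try simp (disch := omega) only [if_pos, if_neg]
    funext k
    simp only [Pi.add_apply, Pi.sub_apply, Pi.neg_apply, Pi.smul_apply, Pi.zero_apply, smul_eq_mul, eps]
    omega

end AffineType
namespace AffineType

variable {t : AffineType}

/-! Explicit forms of the matrices. -/

theorem F_neg {i j : ℤ} (hi : i < 0) (hj : j < 0) : t.F i j = t.E i j - t.E (-j) (-i) := by
  have : t.sgn i * t.sgn j = 1 := by
    unfold sgn
    split
    · rw [Int.sign_eq_neg_one_of_neg hi, Int.sign_eq_neg_one_of_neg hj]; norm_num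
    · norm_num
  rw [F, this, one_smul]

theorem F_of_ne (h : t.letter ≠ .C) (i j : ℤ) : t.F i j = t.E i j - t.E (-j) (-i) := by
  have : t.sgn i * t.sgn j = 1 := by
    unfold sgn
    split
    · contradiction
    · norm_num
  rw [F, this, one_smul]

theorem F_opp (h : t.letter = .C) {i : ℤ} (hi : i ≠ 0) :
    (2⁻¹ : 𝕂) • t.F i (-i) = t.E i (-i) := by
  have : t.sgn i * t.sgn (-i) = -1 := by
    unfold sgn
    rw [h]
    rcases lt_or_gt_of_ne hi with h | h
    · rw [Int.sign_eq_neg_one_of_neg h, Int.sign_eq_one_of_pos (by omega)]; norm_num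
    · rw [Int.sign_eq_one_of_pos h, Int.sign_eq_neg_one_of_neg (by omega)]; norm_num
  rw [F, this, neg_neg, neg_smul, one_smul, sub_neg_eq_add, ← two_smul 𝕂, smul_smul]
  have h2 : (2 : 𝕂) ≠ 0 := by
    have := charZero_of_injective_algebraMap (algebraMap (RatFunc ℂ) 𝕂).injective
    norm_num
  rw [inv_mul_cancel₀ h2, one_smul]

theorem xMat_A (h : t.letter = .A) (i : ℕ) :
    t.xMat i = if i = 0 then t.E (t.n + 1) 1 else t.E i (i + 1) := by
  simp only [xMat, h]

theorem yMat_A (h : t.letter = .A) (i : ℕ) :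
    t.yMat i = if i = 0 then t.E 1 (t.n + 1) else t.E (i + 1) i := by
  simp only [yMat, h]

theorem xMat_B (h : t.letter = .B) (i : ℕ) :
    t.xMat i = if i = 0 then
        if t.n = 1 then cc • (t.E 0 (-1) - qh • t.E 1 0)
        else t.E (t.n - 1) (-t.n) - t.E t.n (1 - t.n)
      else if i = t.n then cc • (t.E (-1) 0 - qh⁻¹ • t.E 0 1)
      else t.E (i - t.n - 1) (i - t.n) - t.E (t.n - i) (t.n + 1 - i) := by
  simp only [xMat, h]
  split_ifs
  · rfl
  · rw [F_of_ne (by simp [h])]; ring_nf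
  · rfl
  · rw [F_of_ne (by simp [h])]; ring_nf

theorem yMat_B (h : t.letter = .B) (i : ℕ) :
    t.yMat i = if i = 0 then
        if t.n = 1 then cc • (t.E (-1) 0 - qh⁻¹ • t.E 0 1)
        else t.E (-t.n) (t.n - 1) - t.E (1 - t.n) t.n
      else if i = t.n then cc • (t.E 0 (-1) - qh • t.E 1 0)
      else t.E (i - t.n) (i - t.n - 1) - t.E (t.n + 1 - i) (t.n - i) := by
  simp only [yMat, h]
  split_ifs
  · rfl
  · rw [F_of_ne (by simp [h])]; ring_nf
  · rfl
  · rw [F_of_ne (by simp [h])]; ring_nf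

theorem xMat_C (h : t.letter = .C) {i : ℕ} (hi : i < t.n + 1) :
    t.xMat i = if i = 0 then t.E t.n (-t.n) else if i = t.n then t.E (-1) 1
      else t.E (i - t.n - 1) (i - t.n) - t.E (t.n - i) (t.n + 1 - i) := by
  simp only [xMat, h]
  split_ifs
  · rw [F_opp h (by have := t.le_n; simp only [h, Letter.minRank] at this; omega)]
  · simpa using F_opp h (i := -1) (by omega)
  · rw [F_neg (by omega) (by omega)]; ring_nf

theorem yMat_C (h : t.letter = .C) {i : ℕ} (hi : i < t.n + 1) :
    t.yMat i = if i = 0 then t.E (-t.n) t.n else if i = t.n then t.E 1 (-1)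
      else t.E (i - t.n) (i - t.n - 1) - t.E (t.n + 1 - i) (t.n - i) := by
  simp only [yMat, h]
  split_ifs
  · simpa using F_opp h (i := -t.n)
      (by have := t.le_n; simp only [h, Letter.minRank] at this; omega)
  · rw [F_opp h (by omega)]
  · rw [F_neg (by omega) (by omega)]; ring_nf

theorem xMat_D (h : t.letter = .D) (i : ℕ) :
    t.xMat i = if i = 0 then t.E (t.n - 1) (-t.n) - t.E t.n (1 - t.n)
      else if i = t.n then t.E (-2) 1 - t.E (-1) 2
      else t.E (i - t.n - 1) (i - t.n) - t.E (t.n - i) (t.n + 1 - i) := by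
  simp only [xMat, h]
  split_ifs <;> rw [F_of_ne (by simp [h])] <;> ring_nf

theorem yMat_D (h : t.letter = .D) (i : ℕ) :
    t.yMat i = if i = 0 then t.E (-t.n) (t.n - 1) - t.E (1 - t.n) t.n
      else if i = t.n then t.E 1 (-2) - t.E 2 (-1)
      else t.E (i - t.n) (i - t.n - 1) - t.E (t.n + 1 - i) (t.n - i) := by
  simp only [yMat, h]
  split_ifs <;> rw [F_of_ne (by simp [h])] <;> ring_nf

theorem E_congr {i j i' j' : ℤ} (hi : i = i') (hj : j = j') : t.E i j = t.E i' j' := by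
  rw [hi, hj]

theorem x_comm (i j : t.I) (hij : i ≠ j) (h0 : t.ip (t.root i) (t.root j) = 0) :
    t.xMat i * t.xMat j = t.xMat j * t.xMat i := by
  have hi := i.2
  have hj := j.2
  have hne : (i : ℕ) ≠ (j : ℕ) := fun h => hij (Fin.ext h)
  clear hij
  generalize (i : ℕ) = i' at *
  generalize (j : ℕ) = j' at *
  have hn := t.le_n
  have h3 : i' + 1 = j' ∨ j' + 1 = i' ∨ i' + 1 < j' ∨ j' + 1 < i' := by omega
  cases hl : t.letter <;> rw [hl] at hn <;> simp only [Letter.minRank] at hn <;>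
    simp only [xMat_A, xMat_B, xMat_C, xMat_D, hl, hi, hj] <;>
    simp only [root, hl] at h0 <;> split_ifs at h0 ⊢ <;>
    simp only [ip_add_left, ip_sub_left, ip_neg_left, ip_smul_left, ip_add_right, ip_sub_right,
      ip_neg_right, ip_smul_right, ip_eps] at h0
  all_goals rcases h3 with h3 | h3 | h3 | h3
  all_goals try (exfalso; omega)
  all_goals simp only [mul_sub, sub_mul, smul_mul_assoc, mul_smul_comm, E_mul_E, mem_labels, hl]
  all_goals simp (disch := omega) only [if_pos, if_neg, sub_zero, zero_sub, smul_zero, neg_neg]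
  all_goals first
    | done
    | exact E_congr (by omega) (by omega)
    | exact congrArg Neg.neg (E_congr (by omega) (by omega))

theorem y_comm (i j : t.I) (hij : i ≠ j) (h0 : t.ip (t.root i) (t.root j) = 0) :
    t.yMat i * t.yMat j = t.yMat j * t.yMat i := by
  have hi := i.2
  have hj := j.2
  have hne : (i : ℕ) ≠ (j : ℕ) := fun h => hij (Fin.ext h)
  clear hij
  generalize (i : ℕ) = i' at *
  generalize (j : ℕ) = j' at *
  have hn := t.le_n
  have h3 : i' + 1 = j' ∨ j' + 1 = i' ∨ i' + 1 < j' ∨ j' + 1 < i' := by omega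
  cases hl : t.letter <;> rw [hl] at hn <;> simp only [Letter.minRank] at hn <;>
    simp only [yMat_A, yMat_B, yMat_C, yMat_D, hl, hi, hj] <;>
    simp only [root, hl] at h0 <;> split_ifs at h0 ⊢ <;>
    simp only [ip_add_left, ip_sub_left, ip_neg_left, ip_smul_left, ip_add_right, ip_sub_right,
      ip_neg_right, ip_smul_right, ip_eps] at h0
  all_goals rcases h3 with h3 | h3 | h3 | h3
  all_goals try (exfalso; omega)
  all_goals simp only [mul_sub, sub_mul, smul_mul_assoc, mul_smul_comm, E_mul_E, mem_labels, hl]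
  all_goals simp (disch := omega) only [if_pos, if_neg, sub_zero, zero_sub, smul_zero, neg_neg]
  all_goals first
    | done
    | exact E_congr (by omega) (by omega)
    | exact congrArg Neg.neg (E_congr (by omega) (by omega))

theorem x_y_comm (i j : t.I) (hij : i ≠ j) :
    t.xMat i * t.yMat j = t.yMat j * t.xMat i := by
  have hi := i.2
  have hj := j.2
  have hne : (i : ℕ) ≠ (j : ℕ) := fun h => hij (Fin.ext h)
  clear hij
  generalize (i : ℕ) = i' at *
  generalize (j : ℕ) = j' at *
  have hn := t.le_n
  have h3 : i' + 1 = j' ∨ j' + 1 = i' ∨ i' + 1 < j' ∨ j' + 1 < i' := by omega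
  cases hl : t.letter <;> rw [hl] at hn <;> simp only [Letter.minRank] at hn <;>
    simp only [xMat_A, xMat_B, xMat_C, xMat_D, yMat_A, yMat_B, yMat_C, yMat_D, hl, hi, hj] <;>
    split_ifs
  all_goals rcases h3 with h3 | h3 | h3 | h3
  all_goals try (exfalso; omega)
  all_goals simp only [mul_sub, sub_mul, smul_mul_assoc, mul_smul_comm, E_mul_E, mem_labels, hl]
  all_goals simp (disch := omega) only [if_pos, if_neg, sub_zero, zero_sub, smul_zero, neg_neg]
  all_goals first
    | done
    | exact E_congr (by omega) (by omega)
    | exact congrArg Neg.neg (E_congr (by omega) (by omega))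

end AffineType

namespace AffineType

variable {t : AffineType}

theorem E_self (i : ℤ) :
    t.E i i = Matrix.diagonal fun a : t.Idx => ((if (a : ℤ) = i then 1 else 0 : ℤ) : 𝕂) := by
  ext a b
  rw [E, Matrix.of_apply, Matrix.diagonal_apply]
  by_cases h : a = b
  · subst h; simp
  · have : (a : ℤ) ≠ b := fun e => h (Subtype.ext e)
    rw [if_neg h, if_neg (by omega)]

theorem pow_sub_inv_ne_zero {p : 𝕂} (h0 : p ≠ 0) (h : p ^ 2 ≠ 1) : p - p⁻¹ ≠ 0 := by
  intro e
  apply h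
  field_simp at e
  linear_combination e

/-- Values of `(q^m - q^{-m}) / (q_i - q_i^{-1})`. -/
theorem qdiff (w m : ℤ)
    (h : (w = 1 ∧ (m = -1 ∨ m = 0 ∨ m = 1)) ∨ (w = 2 ∧ (m = -1 ∨ m = 0 ∨ m = 1)) ∨
      (w = 4 ∧ (m = -2 ∨ m = 0 ∨ m = 2))) :
    (qh ^ w - (qh ^ w)⁻¹)⁻¹ * (q ^ m - q ^ (-m)) =
      (if w = 1 then cc ^ 2 * m else if w = 2 then (m : 𝕂) else m / 2) := by
  have h0 := qh_ne_zero
  have hq := q_ne_zero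
  have h1 : qh - qh⁻¹ ≠ 0 := pow_sub_inv_ne_zero h0 (qh_pow_ne_one two_ne_zero)
  have h2 : q - q⁻¹ ≠ 0 := pow_sub_inv_ne_zero hq (q_pow_ne_one two_ne_zero)
  have h3 : q ^ 2 - (q ^ 2)⁻¹ ≠ 0 := pow_sub_inv_ne_zero (pow_ne_zero 2 hq)
    (by rw [← pow_mul]; exact q_pow_ne_one (by norm_num))
  have e2 : qh ^ (2 : ℤ) = q := by rw [← qh_sq]; norm_cast
  have e4 : qh ^ (4 : ℤ) = q ^ 2 := by rw [← qh_sq, ← pow_mul]; norm_cast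
  have ct : (2 : 𝕂) ≠ 0 := by
    have := charZero_of_injective_algebraMap (algebraMap (RatFunc ℂ) 𝕂).injective
    norm_num
  have hz2 : q ^ (2 : ℤ) = q ^ 2 := by norm_cast
  rcases h with ⟨rfl, h⟩ | ⟨rfl, h⟩ | ⟨rfl, h⟩
  · rw [if_pos rfl, inv_mul_eq_iff_eq_mul₀ (by simpa using h1), zpow_one, cc_sq]
    have e : q - q⁻¹ = (qh - qh⁻¹) * (qh + qh⁻¹) := by
      rw [← qh_sq]; field_simp; ring
    rcases h with rfl | rfl | rfl
    · simp only [zpow_neg, zpow_one, neg_neg, Int.cast_neg, Int.cast_one]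
      linear_combination -e
    · simp
    · simp only [zpow_neg, zpow_one, Int.cast_one]
      linear_combination e
  · rw [if_neg (by norm_num), if_pos rfl, e2, inv_mul_eq_iff_eq_mul₀ h2]
    rcases h with rfl | rfl | rfl
    · simp only [zpow_neg, zpow_one, neg_neg, Int.cast_neg, Int.cast_one]; ring
    · simp
    · simp only [zpow_neg, zpow_one, Int.cast_one, mul_one]
  · rw [if_neg (by norm_num), if_neg (by norm_num), e4, inv_mul_eq_iff_eq_mul₀ h3]
    rcases h with rfl | rfl | rfl
    · simp only [zpow_neg, neg_neg, Int.cast_neg, Int.cast_ofNat, hz2]; field_simp; ring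
    · simp
    · simp only [zpow_neg, Int.cast_ofNat, hz2]; field_simp

theorem kExp_cases (i : t.I) (a : t.Idx) :
    (t.ip (t.root i) (t.root i) = 1 ∧ (t.kExp i a = -1 ∨ t.kExp i a = 0 ∨ t.kExp i a = 1)) ∨
    (t.ip (t.root i) (t.root i) = 2 ∧ (t.kExp i a = -1 ∨ t.kExp i a = 0 ∨ t.kExp i a = 1)) ∨
    (t.ip (t.root i) (t.root i) = 4 ∧ (t.kExp i a = -2 ∨ t.kExp i a = 0 ∨ t.kExp i a = 2)) := by
  have hi := i.2
  generalize (i : ℕ) = i' at *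
  clear i
  have hn := t.le_n
  obtain ⟨a, ha⟩ := a
  rw [mem_labels] at ha
  cases hl : t.letter <;> rw [hl] at hn <;> simp only [hl, Letter.minRank] at hn ha <;>
    simp only [kExp, root, hl] <;> split_ifs <;>
    simp only [ip_add_left, ip_sub_left, ip_neg_left, ip_smul_left, ip_add_right, ip_sub_right,
      ip_neg_right, ip_smul_right, ip_eps, Pi.sub_apply, Pi.add_apply, Pi.neg_apply, Pi.smul_apply,
      smul_eq_mul, Fd, Ed, true_and] <;>
    omega

theorem cc_aux (a b c d : ℤ) :
    cc * (cc * (a : 𝕂) - qh⁻¹ * (cc * -(qh * (b : 𝕂))))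
      - cc * (cc * (c : 𝕂) - qh * (cc * -(qh⁻¹ * (d : 𝕂)))) =
    cc ^ 2 * ((a + b - c - d : ℤ) : 𝕂) := by
  have h0 := qh_ne_zero
  push_cast
  field_simp
  ring

theorem cc_aux' (a b c d : ℤ) :
    cc * (cc * (c : 𝕂) - qh * (cc * -(qh⁻¹ * (d : 𝕂))))
      - cc * (cc * (a : 𝕂) - qh⁻¹ * (cc * -(qh * (b : 𝕂)))) =
    cc ^ 2 * ((c + d - a - b : ℤ) : 𝕂) := by
  have h0 := qh_ne_zero
  push_cast
  field_simp
  ring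

set_option maxHeartbeats 1000000 in
theorem x_y_diag (i : t.I) :
    t.xMat i * t.yMat i - t.yMat i * t.xMat i = Matrix.diagonal fun a =>
        if t.ip (t.root i) (t.root i) = 1 then cc ^ 2 * (t.kExp i a : 𝕂)
        else if t.ip (t.root i) (t.root i) = 2 then (t.kExp i a : 𝕂) else t.kExp i a / 2 := by
  have hi := i.2
  generalize (i : ℕ) = i' at *
  clear i
  have hn := t.le_n
  have h0 := qh_ne_zero
  have ct : (2 : 𝕂) ≠ 0 := by
    have := charZero_of_injective_algebraMap (algebraMap (RatFunc ℂ) 𝕂).injective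
    norm_num
  by_cases h1 : i' = 0 <;> by_cases h2 : i' = t.n <;> by_cases h3 : t.n = 1
  all_goals
    cases hl : t.letter <;> rw [hl] at hn <;> simp only [Letter.minRank] at hn <;>
    simp only [xMat_A, xMat_B, xMat_C, xMat_D, yMat_A, yMat_B, yMat_C, yMat_D, hl, hi] <;>
    simp only [kExp, root, hl]
  all_goals try (exfalso; omega)
  all_goals
    simp (disch := omega) only [if_pos, if_neg]
    simp only [ip_add_left, ip_sub_left, ip_neg_left, ip_smul_left, ip_add_right, ip_sub_right,
      ip_neg_right, ip_smul_right, ip_eps, Pi.sub_apply, Pi.add_apply, Pi.neg_apply, Pi.smul_apply,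
      smul_eq_mul, Fd, Ed, true_and, mul_sub, sub_mul, smul_mul_assoc, mul_smul_comm, E_mul_E,
      mem_labels, hl]
    simp (disch := omega) only [if_pos, if_neg, sub_zero, zero_sub, smul_zero, neg_neg]
  all_goals
    ext a b
    simp only [E_self, Matrix.sub_apply, Matrix.neg_apply, Matrix.smul_apply,
      Matrix.diagonal_apply, smul_eq_mul]
    by_cases hab : a = b
    · subst hab
      obtain ⟨a, ha⟩ := a
      rw [mem_labels] at ha
      simp only [hl] at ha
      dsimp only
      simp only [if_true]
      try simp only [← Int.cast_sub, ← Int.cast_neg]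
      first
        | done
        | exact congrArg Int.cast (by omega)
        | (rw [eq_div_iff ct, ← Int.cast_two, ← Int.cast_mul]; exact congrArg Int.cast (by omega))
        | (rw [cc_aux]; refine congrArg (fun z : ℤ => cc ^ 2 * (z : 𝕂)) ?_; omega)
        | (rw [cc_aux']; refine congrArg (fun z : ℤ => cc ^ 2 * (z : 𝕂)) ?_; omega)
    · simp only [if_neg hab]; norm_num

theorem x_y_self (i : t.I) :
    t.xMat i * t.yMat i - t.yMat i * t.xMat i =
      (t.qi i - (t.qi i)⁻¹)⁻¹ • (t.qDiag (t.kExp i) - t.qDiag (-t.kExp i)) := by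
  rw [x_y_diag]
  ext a b
  rw [Matrix.smul_apply, Matrix.sub_apply, qDiag, qDiag, Matrix.diagonal_apply,
    Matrix.diagonal_apply, Matrix.diagonal_apply]
  by_cases h : a = b
  · rw [if_pos h, if_pos h, if_pos h, ← qdiff _ _ (kExp_cases i a)]; rfl
  · rw [if_neg h, if_neg h, if_neg h, sub_zero, smul_zero]

end AffineType

namespace AffineType

variable {t : AffineType}

theorem serre_three_aux {p : 𝕂} (hp0 : p ≠ 0) (hp : p - p⁻¹ ≠ 0) (h2 : p + p⁻¹ ≠ 0)
    (h3 : p ^ 2 + 1 + p⁻¹ ^ 2 ≠ 0) {B : Type*} [Ring B] [Algebra 𝕂 B] (c : 𝕂) (x y : B)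
    (hx : x * x * x = 0) (hxy : x * x * y * x = x * y * x * x) :
    serre p 3 (c • x) (c • y) = 0 := by
  have h := serre_smul p 3 x y c c
  rw [h, serre_three hp0 hp h2 h3, hxy, hx, mul_assoc (y * x), mul_assoc y, ← mul_assoc x, hx]
  simp

/-- The quantum Serre relations in the three-dimensional representation for `B_1`. -/
theorem serre_B1 {p : 𝕂} (hp0 : p ≠ 0) (hp : p - p⁻¹ ≠ 0) (h2 : p + p⁻¹ ≠ 0)
    (h3 : p ^ 2 + 1 + p⁻¹ ^ 2 ≠ 0) (hl : t.letter = .B) (hn : t.n = 1) :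
    serre p 3 (cc • (t.E 0 (-1) - qh • t.E 1 0)) (cc • (t.E (-1) 0 - qh⁻¹ • t.E 0 1)) = 0 ∧
    serre p 3 (cc • (t.E (-1) 0 - qh⁻¹ • t.E 0 1)) (cc • (t.E 0 (-1) - qh • t.E 1 0)) = 0 := by
  have h0 := qh_ne_zero
  have e1 : (t.E 0 (-1) - qh • t.E 1 0) * (t.E 0 (-1) - qh • t.E 1 0) = (-qh) • t.E 1 (-1) := by
    norm_num [mul_sub, sub_mul, E_mul_E, mem_labels, hl, hn, smul_smul]
  have e2 : (t.E (-1) 0 - qh⁻¹ • t.E 0 1) * (t.E (-1) 0 - qh⁻¹ • t.E 0 1) =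
      (-qh⁻¹) • t.E (-1) 1 := by
    norm_num [mul_sub, sub_mul, E_mul_E, mem_labels, hl, hn, smul_smul]
  have f1 : t.E 1 (-1) * (t.E (-1) 0 - qh⁻¹ • t.E 0 1) = t.E 1 0 := by
    norm_num [mul_sub, sub_mul, E_mul_E, mem_labels, hl, hn, smul_smul]
  have f2 : (t.E (-1) 0 - qh⁻¹ • t.E 0 1) * t.E 1 (-1) = (-qh⁻¹) • t.E 0 (-1) := by
    norm_num [mul_sub, sub_mul, E_mul_E, mem_labels, hl, hn, smul_smul]
  have f3 : t.E (-1) 1 * (t.E 0 (-1) - qh • t.E 1 0) = (-qh) • t.E (-1) 0 := by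
    norm_num [mul_sub, sub_mul, E_mul_E, mem_labels, hl, hn, smul_smul]
  have f4 : (t.E 0 (-1) - qh • t.E 1 0) * t.E (-1) 1 = t.E 0 1 := by
    norm_num [mul_sub, sub_mul, E_mul_E, mem_labels, hl, hn, smul_smul]
  constructor <;> apply serre_three_aux hp0 hp h2 h3
  · rw [e1]
    norm_num [mul_sub, sub_mul, E_mul_E, mem_labels, hl, hn, smul_smul]
  · rw [mul_assoc _ (t.E 0 (-1) - qh • t.E 1 0) (t.E 0 (-1) - qh • t.E 1 0), e1, mul_assoc,
      smul_mul_assoc, mul_smul_comm, ← mul_assoc, f1, mul_assoc _ _ (t.E 1 (-1)), f2]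
    norm_num [mul_sub, sub_mul, E_mul_E, mem_labels, hl, hn, smul_smul, h0]
  · rw [e2]
    norm_num [mul_sub, sub_mul, E_mul_E, mem_labels, hl, hn, smul_smul]
  · rw [mul_assoc _ (t.E (-1) 0 - qh⁻¹ • t.E 0 1) (t.E (-1) 0 - qh⁻¹ • t.E 0 1), e2, mul_assoc,
      smul_mul_assoc, mul_smul_comm, ← mul_assoc, f3, mul_assoc _ _ (t.E (-1) 1), f4]
    norm_num [mul_sub, sub_mul, E_mul_E, mem_labels, hl, hn, smul_smul, h0]

theorem serre_vec {z : ℤ} (hz : z = 1 ∨ z = -1) (x : t.I → t.Mat 𝕂)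
    (hx : ∀ i : t.I, t.HasWt (z • t.root i) (x i))
    (hc : ∀ i j : t.I, i ≠ j → t.ip (t.root i) (t.root j) = 0 → x i * x j = x j * x i)
    (hB : t.letter = .B → t.n = 1 → ∀ i j : t.I, i ≠ j →
      (x i = cc • (t.E 0 (-1) - qh • t.E 1 0) ∧ x j = cc • (t.E (-1) 0 - qh⁻¹ • t.E 0 1)) ∨
      (x i = cc • (t.E (-1) 0 - qh⁻¹ • t.E 0 1) ∧ x j = cc • (t.E 0 (-1) - qh • t.E 1 0)))
    (i j : t.I) (hij : i ≠ j) :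
    serre (t.qi i) (1 - t.cartan i j).toNat (x i) (x j) = 0 := by
  have hq0 := t.qi_ne_zero i
  have e1 : t.qi i - (t.qi i)⁻¹ ≠ 0 := pow_sub_inv_ne_zero hq0 (t.qi_pow_ne_one i two_ne_zero)
  have e2 : t.qi i + (t.qi i)⁻¹ ≠ 0 := by
    intro h0
    apply t.qi_pow_ne_one i (m := 4) (by norm_num)
    field_simp at h0
    linear_combination (t.qi i ^ 2 - 1) * h0
  have e3 : t.qi i ^ 2 + 1 + (t.qi i)⁻¹ ^ 2 ≠ 0 := by
    intro h0
    apply t.qi_pow_ne_one i (m := 6) (by norm_num)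
    field_simp at h0
    linear_combination (t.qi i ^ 2 - 1) * h0
  obtain ⟨h1, h2, h3⟩ := t.root_cases i j hij
  have hm := t.cartan_mul i j hij
  by_cases hC : t.ip (t.root i) (t.root j) = 0
  · have : t.cartan i j = 0 := by
      rw [hC] at hm
      exact (mul_eq_zero.1 hm).resolve_left (t.root_ne_zero i)
    rw [this, show (1 - 0 : ℤ).toNat = 1 by rfl, serre_one e1, hc i j hij hC, sub_self]
  by_cases hb : t.letter = .B ∧ t.n = 1 ∧ t.ip (t.root i) (t.root i) = 1 ∧
      t.ip (t.root i) (t.root j) = -1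
  · obtain ⟨b1, b2, b3, b4⟩ := hb
    rw [b3, b4] at hm
    have : t.cartan i j = -2 := by omega
    rw [this, show (1 - -2 : ℤ).toNat = 3 by rfl]
    have hs := serre_B1 (t := t) hq0 e1 e2 e3 b1 b2
    rcases hB b1 b2 i j hij with ⟨r1, r2⟩ | ⟨r1, r2⟩ <;> rw [r1, r2]
    · exact hs.1
    · exact hs.2
  · refine ((hx i).serre (hx j) (t.qi i) _).eq_zero (Or.inl ?_)
    have e : (((1 - t.cartan i j).toNat : ℕ) : ℤ) = 1 - t.cartan i j := by
      have := t.cartan_cases i j hij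
      omega
    rw [e]
    simp only [ip_add_left, ip_add_right, ip_smul_left, ip_smul_right, t.ip_comm (t.root j) (t.root i)]
    generalize t.cartan i j = a at hm ⊢
    generalize t.ip (t.root i) (t.root i) = A at *
    generalize t.ip (t.root j) (t.root j) = B at *
    generalize t.ip (t.root i) (t.root j) = C at *
    have hb' : ¬ (C = -1 ∧ A = 1 ∧ B = 1 ∧ t.letter = .B ∧ t.n = 1) :=
      fun h => hb ⟨h.2.2.2.1, h.2.2.2.2, h.2.1, h.1⟩
    rcases h3 with h | h | ⟨rfl, rfl, rfl⟩ | ⟨rfl, rfl, rfl⟩ | ⟨rfl, rfl, rfl⟩ | ⟨rfl, rfl, rfl⟩ |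
      ⟨rfl, rfl, rfl⟩ | ⟨rfl, rfl, rfl⟩ | ⟨rfl, rfl, rfl⟩
    · exact absurd h hC
    · exact absurd h hb'
    · obtain rfl : a = -1 := by omega
      rcases hz with rfl | rfl <;> norm_num
    · obtain rfl : a = -2 := by omega
      rcases hz with rfl | rfl <;> norm_num
    · obtain rfl : a = -1 := by omega
      rcases hz with rfl | rfl <;> norm_num
    · obtain rfl : a = -2 := by omega
      rcases hz with rfl | rfl <;> norm_num
    · obtain rfl : a = -2 := by omega
      rcases hz with rfl | rfl <;> norm_num
    · obtain rfl : a = -1 := by omega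
      rcases hz with rfl | rfl <;> norm_num
    · obtain rfl : a = -2 := by omega
      rcases hz with rfl | rfl <;> norm_num

variable (t)

/-- The matrices of the vector representation satisfy the defining relations. -/
theorem vec_relations : DJRelations t (B := t.Mat 𝕂) (fun i => t.xMat i) (fun i => t.yMat i)
    (fun i => t.qDiag (t.kExp i)) (fun i => t.qDiag (-t.kExp i)) where
  k_mul_k' i := by
    simp only [qDiag, Matrix.diagonal_mul_diagonal, Pi.neg_apply, ← zpow_add₀ q_ne_zero,
      add_neg_cancel, zpow_zero, Matrix.diagonal_one]
  k'_mul_k i := by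
    simp only [qDiag, Matrix.diagonal_mul_diagonal, Pi.neg_apply, ← zpow_add₀ q_ne_zero,
      neg_add_cancel, zpow_zero, Matrix.diagonal_one]
  k_comm i j := by
    simp only [qDiag, Matrix.diagonal_mul_diagonal, mul_comm]
  k_x i j := by
    rw [(t.xMat_wt j).qDiag_mul i, t.qi_zpow_cartan]
  k_y i j := by
    rw [(t.yMat_wt j).qDiag_mul i, zpow_neg, t.qi_zpow_cartan, ip_neg_right, zpow_neg]
  x_y i j := by
    split_ifs with h
    · subst h
      exact x_y_self i
    · rw [x_y_comm i j h, sub_self]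
  serre_x := by
    refine serre_vec (z := 1) (Or.inl rfl) (fun i => t.xMat i) (fun i => ?_) x_comm ?_
    · rw [one_smul]; exact t.xMat_wt i
    · intro hl hn i j hij
      have hi := i.2
      have hj := j.2
      have hne : (i : ℕ) ≠ (j : ℕ) := fun h => hij (Fin.ext h)
      simp only [xMat_B hl]
      have : ((i : ℕ) = 0 ∧ (j : ℕ) = t.n) ∨ ((i : ℕ) = t.n ∧ (j : ℕ) = 0) := by omega
      have h1 : ¬ (t.n = 0) := by omega
      rcases this with ⟨h, h'⟩ | ⟨h, h'⟩ <;> rw [h, h'] <;>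
        simp only [if_true, if_neg h1, if_pos hn, and_true, true_or, or_true]
  serre_y := by
    refine serre_vec (z := -1) (Or.inr rfl) (fun i => t.yMat i) (fun i => ?_) y_comm ?_
    · rw [neg_one_smul]; exact t.yMat_wt i
    · intro hl hn i j hij
      have hi := i.2
      have hj := j.2
      have hne : (i : ℕ) ≠ (j : ℕ) := fun h => hij (Fin.ext h)
      simp only [yMat_B hl]
      have : ((i : ℕ) = 0 ∧ (j : ℕ) = t.n) ∨ ((i : ℕ) = t.n ∧ (j : ℕ) = 0) := by omega
      have h1 : ¬ (t.n = 0) := by omega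
      rcases this with ⟨h, h'⟩ | ⟨h, h'⟩ <;> rw [h, h'] <;>
        simp only [if_true, if_neg h1, if_pos hn, and_true, true_or, or_true]

end AffineType

/-! ### Evaluation representations -/

section Scaling

variable {t : AffineType} {B : Type*} [Ring B] [Algebra 𝕂 B] {x y k k' : t.I → B}

theorem DJRelations.map (h : DJRelations t x y k k') {C : Type*} [Ring C] [Algebra 𝕂 C]
    (f : B →ₐ[𝕂] C) : DJRelations t (fun i => f (x i)) (fun i => f (y i)) (fun i => f (k i))
      (fun i => f (k' i)) where
  k_mul_k' i := by rw [← map_mul, h.k_mul_k', map_one]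
  k'_mul_k i := by rw [← map_mul, h.k'_mul_k, map_one]
  k_comm i j := by rw [← map_mul, h.k_comm, map_mul]
  k_x i j := by rw [← map_mul, h.k_x, map_smul, map_mul]
  k_y i j := by rw [← map_mul, h.k_y, map_smul, map_mul]
  x_y i j := by
    rw [← map_mul, ← map_mul, ← map_sub, h.x_y, apply_ite f, map_smul, map_sub, map_zero]
  serre_x i j hij := by rw [← map_serre, h.serre_x i j hij, map_zero]
  serre_y i j hij := by rw [← map_serre, h.serre_y i j hij, map_zero]

theorem DJRelations.scale (h : DJRelations t x y k k') {A : Type*} [CommRing A] [Algebra 𝕂 A]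
    [Algebra A B] [IsScalarTower 𝕂 A B] (c : t.I → Aˣ) :
    DJRelations t (fun i => (c i : A) • x i) (fun i => (((c i)⁻¹ : Aˣ) : A) • y i) k k' where
  k_mul_k' := h.k_mul_k'
  k'_mul_k := h.k'_mul_k
  k_comm := h.k_comm
  k_x i j := by rw [mul_smul_comm, h.k_x, smul_mul_assoc, smul_comm]
  k_y i j := by rw [mul_smul_comm, h.k_y, smul_mul_assoc, smul_comm]
  x_y i j := by
    rw [smul_mul_smul_comm, smul_mul_smul_comm, mul_comm (((c j)⁻¹ : Aˣ) : A), ← smul_sub, h.x_y]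
    split_ifs with hij
    · subst hij
      rw [Units.mul_inv, one_smul]
    · rw [smul_zero]
  serre_x i j hij := by rw [serre_smul, h.serre_x i j hij, smul_zero]
  serre_y i j hij := by rw [serre_smul, h.serre_y i j hij, smul_zero]

end Scaling

section Evaluation

variable (t : AffineType) (A : Type) [CommRing A] [Algebra 𝕂 A]

/-- The scaling of `x_0` by the spectral parameter `u`. -/
def evalScale (u : Aˣ) (i : t.I) : Aˣ := if i = 0 then u else 1

/-- Extension of scalars for matrices. -/
noncomputable def extend : t.Mat 𝕂 →ₐ[𝕂] t.Mat A := (Algebra.ofId 𝕂 A).mapMatrix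

theorem eval_relations (u : Aˣ) : DJRelations t (B := t.Mat A)
    (fun i => (evalScale t A u i : A) • extend t A (t.xMat i))
    (fun i => (((evalScale t A u i)⁻¹ : Aˣ) : A) • extend t A (t.yMat i))
    (fun i => extend t A (t.qDiag (t.kExp i)))
    (fun i => extend t A (t.qDiag (-t.kExp i))) :=
  (t.vec_relations.map (extend t A)).scale (evalScale t A u)

/-- The vector (evaluation) representation `T_u` of `U_q(ĝ)` on `A^N`, for an invertible
element `u` of a commutative `𝕂`-algebra `A`. It is `T_u : U_q(ĝ) → End(𝕂^N)` for `A = 𝕂`, and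
the representation depending rationally on the parameter for `A = 𝕂(u)`. -/
noncomputable def evalRep (u : Aˣ) : Uq t →ₐ[𝕂] t.Mat A := Uq.lift (eval_relations t A u)

/-- `M ↦ M ⊗ 1`. -/
noncomputable def tensorLeft : t.Mat A →ₐ[𝕂] Matrix (t.Idx × t.Idx) (t.Idx × t.Idx) A :=
  AlgHom.ofLinearMap
    { toFun := fun M => M ⊗ₖ (1 : t.Mat A)
      map_add' := fun M N => Matrix.add_kronecker M N 1
      map_smul' := fun c M => Matrix.smul_kronecker c M 1 }
    (Matrix.one_kronecker_one) (fun M N => by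
      change (M * N) ⊗ₖ (1 : t.Mat A) = (M ⊗ₖ (1 : t.Mat A)) * (N ⊗ₖ (1 : t.Mat A))
      rw [← Matrix.mul_kronecker_mul, mul_one])

/-- `M ↦ 1 ⊗ M`. -/
noncomputable def tensorRight : t.Mat A →ₐ[𝕂] Matrix (t.Idx × t.Idx) (t.Idx × t.Idx) A :=
  AlgHom.ofLinearMap
    { toFun := fun M => (1 : t.Mat A) ⊗ₖ M
      map_add' := fun M N => Matrix.kronecker_add 1 M N
      map_smul' := fun c M => Matrix.kronecker_smul c 1 M }
    (Matrix.one_kronecker_one) (fun M N => by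
      change (1 : t.Mat A) ⊗ₖ (M * N) = ((1 : t.Mat A) ⊗ₖ M) * ((1 : t.Mat A) ⊗ₖ N)
      rw [← Matrix.mul_kronecker_mul, mul_one])

theorem tensor_commute (M N : t.Mat A) : Commute (tensorLeft t A M) (tensorRight t A N) := by
  change (M ⊗ₖ (1 : t.Mat A)) * ((1 : t.Mat A) ⊗ₖ N) = ((1 : t.Mat A) ⊗ₖ N) * (M ⊗ₖ (1 : t.Mat A))
  rw [← Matrix.mul_kronecker_mul, ← Matrix.mul_kronecker_mul, one_mul, one_mul, mul_one, mul_one]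

/-- The representation `a ↦ (T_u ⊗ T_v)(Δ(a))` on `A^N ⊗ A^N`. -/
noncomputable def tensorRep (u v : Aˣ) :
    Uq t →ₐ[𝕂] Matrix (t.Idx × t.Idx) (t.Idx × t.Idx) A :=
  (Algebra.TensorProduct.lift ((tensorLeft t A).comp (evalRep t A u))
    ((tensorRight t A).comp (evalRep t A v)) fun _ _ => tensor_commute t A _ _).comp (Uq.comul t)

end Evaluation

section Coideal

variable {t : AffineType}

/-- `B` is a right coideal: `Δ(B) ⊆ B ⊗ U_q(ĝ)`. -/
def IsRightCoideal (B : Subalgebra 𝕂 (Uq t)) : Prop :=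
  ∀ b ∈ B, Uq.comul t b ∈ (Algebra.TensorProduct.map B.val (AlgHom.id 𝕂 (Uq t))).range

/-- The natural action on `𝕂^ι` of a set of matrices is irreducible. -/
def ActsIrreducibly {ι : Type} [Fintype ι] (S : Set (Matrix ι ι 𝕂)) : Prop :=
  Nontrivial (ι → 𝕂) ∧ ∀ W : Submodule 𝕂 (ι → 𝕂),
    (∀ M ∈ S, ∀ w ∈ W, Matrix.mulVec M w ∈ W) → W = ⊥ ∨ W = ⊤

/-- The restriction of `T_u ⊗ T_v` to `B` is irreducible for generic `u, v ∈ 𝕂ˣ`, that is, for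
all `(u, v)` outside the zero set of some nonzero polynomial. -/
def GenericallyIrreducible (B : Subalgebra 𝕂 (Uq t)) : Prop :=
  ∃ p : MvPolynomial (Fin 2) 𝕂, p ≠ 0 ∧ ∀ u v : 𝕂ˣ,
    MvPolynomial.eval ![(u : 𝕂), (v : 𝕂)] p ≠ 0 →
      ActsIrreducibly ((tensorRep t 𝕂 u v) '' (B : Set (Uq t)))

end Coideal

/-! ## The R-matrix -/

section RMatrix

variable (t : AffineType)

/-- The integer `2 κ = N - 2 ϑ`, where `ϑ` is `(-1)^n`, `1`, `-1` in the special linear,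
orthogonal and symplectic cases. -/
def twoKappa : ℤ :=
  match t.letter with
  | .A => t.n + 1 - 2 * (-1) ^ t.n
  | .B => 2 * t.n - 1
  | .C => 2 * t.n + 2
  | .D => 2 * t.n - 2

/-- The integer `2 ν_i`, where `ν_i` is `i - (N+1)/2`, `i - sgn(i) (n - κ)`, `i` in the special
linear, orthogonal and symplectic cases. -/
def twoNu (i : ℤ) : ℤ :=
  match t.letter with
  | .A => 2 * i - (t.n + 2)
  | .B => 2 * i - i.sign
  | .C => 2 * i
  | .D => 2 * i - 2 * i.sign

/-- Endomorphisms of `A^N ⊗ A^N`. -/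
abbrev Mat2 (A : Type) : Type := Matrix (t.Idx × t.Idx) (t.Idx × t.Idx) A

/-- The permutation operator `P = ∑ E_{ij} ⊗ E_{ji}`. -/
noncomputable def P : Mat2 t 𝕂 := ∑ i ∈ t.labels, ∑ j ∈ t.labels, t.E i j ⊗ₖ t.E j i

/-- The matrix `ϑ_i ϑ_j q^{ν_i - ν_j} E_{ij} ⊗ E_{-i,-j}`. -/
noncomputable def qTerm (i j : ℤ) : Mat2 t 𝕂 :=
  (((t.sgn i * t.sgn j : ℤ) : 𝕂) * qh ^ (twoNu t i - twoNu t j)) • (t.E i j ⊗ₖ t.E (-i) (-j))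

/-- The operator `Q_q`. -/
noncomputable def Qq : Mat2 t 𝕂 :=
  match t.letter with
  | .A => 0
  | _ => ∑ i ∈ t.labels, ∑ j ∈ t.labels, qTerm t i j

/-- The constant R-matrix `R_q`. -/
noncomputable def Rq : Mat2 t 𝕂 :=
  match t.letter with
  | .A => ∑ i ∈ t.labels, ∑ j ∈ t.labels,
      ((if i = j then q else 1) • (t.E i i ⊗ₖ t.E j j)
        + if i < j then (q - q⁻¹) • (t.E i j ⊗ₖ t.E j i) else 0)
  | _ => ∑ i ∈ t.labels, ∑ j ∈ t.labels,
      (q ^ ((if i = j then 1 else 0) - (if i = -j then 1 else 0) : ℤ) • (t.E i i ⊗ₖ t.E j j)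
        + if i < j then (q - q⁻¹) • (t.E i j ⊗ₖ t.E j i - qTerm t i j) else 0)

variable {F : Type} [Field F] [Algebra 𝕂 F]

/-- The R-matrix with spectral parameter `z`, an element of a field containing `𝕂`:
`R(z) = (1-z)/(q-q⁻¹z) R_q + (q-q⁻¹)z/(q-q⁻¹z) (P - (1-z)/(q^{2κ}-z) Q_q)`. -/
noncomputable def R (z : F) : Mat2 t F :=
  let ι := algebraMap 𝕂 F
  ((1 - z) / (ι q - ι q⁻¹ * z)) • (Rq t).map ι
    + (ι (q - q⁻¹) * z / (ι q - ι q⁻¹ * z)) •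
      ((P t).map ι - ((1 - z) / (ι (q ^ twoKappa t) - z)) • (Qq t).map ι)

/-- `R_{21}(z) = P R(z) P`. -/
noncomputable def R21 (z : F) : Mat2 t F :=
  (P t).map (algebraMap 𝕂 F) * R t z * (P t).map (algebraMap 𝕂 F)

end RMatrix

/-! ## K-matrices -/

section KMatrix

/-- The indeterminate `u` as an invertible element of `𝕂(u)`. -/
noncomputable def varU : (RatFunc 𝕂)ˣ := Units.mk0 RatFunc.X RatFunc.X_ne_zero

/-- A scalar as an invertible element of `𝕂(u)`. -/
noncomputable def scalar (η : 𝕂ˣ) : (RatFunc 𝕂)ˣ :=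
  Units.map (algebraMap 𝕂 (RatFunc 𝕂)).toMonoidHom η

variable {t : AffineType}

/-- The untwisted boundary intertwining equation `K(u) T_{ηu}(b) = T_{η/u}(b) K(u)` for all
`b ∈ B`, as an identity of matrix-valued rational functions of `u`. -/
def BoundaryIntertwining (B : Subalgebra 𝕂 (Uq t)) (K : t.Mat (RatFunc 𝕂)) (η : 𝕂ˣ) : Prop :=
  ∀ b ∈ B, K * evalRep t (RatFunc 𝕂) (scalar η * varU) b =
    evalRep t (RatFunc 𝕂) (scalar η / varU) b * K

/-- The field `𝕂(u, v)`. -/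
abbrev 𝕂₂ : Type := FractionRing (MvPolynomial (Fin 2) 𝕂)

/-- The indeterminates `u` and `v` of `𝕂(u, v)`. -/
noncomputable def var (s : Fin 2) : 𝕂₂ :=
  algebraMap (MvPolynomial (Fin 2) 𝕂) 𝕂₂ (MvPolynomial.X s)

theorem aeval_var_injective (s : Fin 2) :
    Function.Injective (Polynomial.aeval (R := 𝕂) (var s)) := by
  have h : ∀ p : Polynomial 𝕂, Polynomial.aeval (var s) p =
      algebraMap (MvPolynomial (Fin 2) 𝕂) 𝕂₂ (Polynomial.aeval (MvPolynomial.X s) p) := by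
    intro p
    rw [var, Polynomial.aeval_algebraMap_apply]
  have h2 : Function.Injective
      (Polynomial.aeval (R := 𝕂) (MvPolynomial.X s : MvPolynomial (Fin 2) 𝕂)) := by
    exact transcendental_iff_injective.1 (MvPolynomial.transcendental_X 𝕂 s)
  intro p p' hp
  rw [h, h] at hp
  exact h2 (IsFractionRing.injective (MvPolynomial (Fin 2) 𝕂) 𝕂₂ hp)

/-- The substitution `f ↦ f(u)` or `f ↦ f(v)` from rational functions in one variable to rational
functions in `u` and `v`. -/
noncomputable def subst (s : Fin 2) : RatFunc 𝕂 →ₐ[𝕂] 𝕂₂ :=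
  RatFunc.liftAlgHom (Polynomial.aeval (var s))
    (nonZeroDivisors_le_comap_nonZeroDivisors_of_injective _ (aeval_var_injective s))

/-- The untwisted reflection equation
`R₂₁(u/v) K₁(u) R(uv) K₂(v) = K₂(v) R₂₁(uv) K₁(u) R(u/v)`,
as an identity of matrix-valued rational functions of `u` and `v`. -/
def ReflectionEquation (K : t.Mat (RatFunc 𝕂)) : Prop :=
  let u : 𝕂₂ := var 0
  let v : 𝕂₂ := var 1
  let K₁ : Mat2 t 𝕂₂ := K.map (subst 0) ⊗ₖ 1
  let K₂ : Mat2 t 𝕂₂ := 1 ⊗ₖ K.map (subst 1)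
  R21 t (u / v) * K₁ * R t (u * v) * K₂ = K₂ * R21 t (u * v) * K₁ * R t (u / v)

end KMatrix

end QRefl

/-! Up to a scalar, R(u/v) intertwines the opposite coproduct with the coproduct in T_u ⊗ T_v
(`Rhom_intertwines`). Since Δ(B) lies in B ⊗ U_q, the matrix K(u) ⊗ 1 intertwines T_{ηu} ⊗ T_w with
T_{η/u} ⊗ T_w on B for every w, and 1 ⊗ K(v) does the same on the other leg for the opposite
coproduct. Composing these maps, both sides of the reflection equation are intertwiners on B from
T_{ηu} ⊗ T_{ηv} to T_{η/u} ⊗ T_{η/v}, each taken with the opposite coproduct. Where the source is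
irreducible and one side is invertible, Schur's lemma makes them proportional
(`reflection_proportional`). Irreducibility also gives the invertibility of K, because the kernel of
K ⊗ 1 is invariant (`det_ne_zero_of_intertwines`).

It remains to find the scalar. The two sides are products of the same factors up to conjugation by
P, so they have equal determinants and the scalar is a root of unity at each generic point. After
clearing denominators both sides are polynomial matrices in u and v. Proportionality extends from
the generic points to an identity of polynomials, and `exists_smul_of_proportional` shows that the
scalar is one constant of the ground field. At u = v the matrix R(1) is a multiple of P and the two
sides agree (`reflection_diag`), so the constant is 1.

The intertwining property of R is itself proved, on generators. With denominators cleared, R(a/b) is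
a quadratic form `Rhom` in a and b with coefficients built from R_q, P and Q_q. For x_i with i ≠ 0
no spectral parameter occurs, and R_q, P and Q_q intertwine separately. For x_0 the identity is a
homogeneous cubic in a and b, governed by four special directions: a = 0 gives R_q, b = 0 gives
`RqOpInv`, a = b gives P, and a = q^{2κ} b gives Q_q. The resulting relations are checked entry by
entry for each form the matrix of a generator can take. The relations for y_i follow from those for
x_i through the anti-automorphism M ↦ P Mᵀ P, which fixes R, because the transpose of x_i is a
multiple of k_i y_i in the vector representation. -/

namespace QRefl

/-! ### Matrix entries of P, Q_q and R_q. -/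

section Entries

variable (t : AffineType)

/-- The weight `ϑ_i q^{ν_i}` attached to the label `i`. -/
noncomputable def qWeight (i : ℤ) : 𝕂 := (t.sgn i : 𝕂) * qh ^ twoNu t i

/-- The diagonal coefficient `q^{δ_{ij} - δ_{i,-j}}` of `R_q`. -/
noncomputable def diagCoeff (i j : ℤ) : 𝕂 :=
  q ^ ((if i = j then 1 else 0) - (if i = -j then 1 else 0) : ℤ)

variable {t}

theorem sgn_eq_one_or {i : ℤ} (hi : i ∈ t.labels) : t.sgn i = 1 ∨ t.sgn i = -1 := by
  rw [AffineType.mem_labels] at hi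
  unfold AffineType.sgn
  cases hl : t.letter <;> simp only [hl, true_or] at hi ⊢
  rcases lt_or_gt_of_ne hi.1 with h | h
  · right; exact Int.sign_eq_neg_one_of_neg h
  · left; exact Int.sign_eq_one_of_pos h

theorem qWeight_ne_zero {i : ℤ} (hi : i ∈ t.labels) : qWeight t i ≠ 0 := by
  refine mul_ne_zero ?_ (zpow_ne_zero _ qh_ne_zero)
  rcases sgn_eq_one_or hi with h | h <;> rw [h] <;> norm_num

/-- A sign is its own inverse, so the coefficient splits as w_i / w_j with w = `qWeight`. Outside
type A this displays Q_q as a column vector times a row vector, hence of rank one. -/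
theorem qWeight_mul_inv {i j : ℤ} (hj : j ∈ t.labels) :
    ((t.sgn i * t.sgn j : ℤ) : 𝕂) * qh ^ (twoNu t i - twoNu t j) =
      qWeight t i * (qWeight t j)⁻¹ := by
  rw [qWeight, qWeight, zpow_sub₀ qh_ne_zero, mul_inv]
  rcases sgn_eq_one_or hj with h | h <;> rw [h] <;> push_cast <;> field_simp

theorem labels_pos (h : t.letter = .A) {i : ℤ} (hi : i ∈ t.labels) : 1 ≤ i := by
  rw [AffineType.mem_labels, h] at hi
  exact hi.1

theorem neg_mem_labels (h : t.letter ≠ .A) {i : ℤ} (hi : i ∈ t.labels) : -i ∈ t.labels := by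
  rw [AffineType.mem_labels] at hi ⊢
  cases hl : t.letter <;> simp only [hl] at hi ⊢ <;> first | contradiction | omega

theorem E_kronecker_apply (i j k l : ℤ) (x y : t.Idx × t.Idx) :
    (t.E i j ⊗ₖ t.E k l) x y =
      if (x.1 : ℤ) = i ∧ (y.1 : ℤ) = j ∧ (x.2 : ℤ) = k ∧ (y.2 : ℤ) = l then 1 else 0 := by
  obtain ⟨a, b⟩ := x
  obtain ⟨c, d⟩ := y
  rw [Matrix.kronecker_apply]
  simp only [AffineType.E, Matrix.of_apply, mul_ite, mul_one, mul_zero]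
  split_ifs <;> simp_all

theorem sum_labels_ite {M : Type*} [AddCommMonoid M] (f : ℤ → ℤ → M) {i j : ℤ}
    (hi : i ∈ t.labels) (hj : j ∈ t.labels) :
    ∑ k ∈ t.labels, ∑ l ∈ t.labels, (if k = i ∧ l = j then f k l else 0) = f i j := by
  rw [Finset.sum_eq_single i, Finset.sum_eq_single j]
  · simp
  · intro b _ hb; simp [hb]
  · intro h; exact absurd hj h
  · intro b _ hb; simp [hb]
  · intro h; exact absurd hi h

theorem P_apply (x y : t.Idx × t.Idx) :
    P t x y = if (x.1 : ℤ) = y.2 ∧ (x.2 : ℤ) = y.1 then 1 else 0 := by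
  simp only [P, Matrix.sum_apply, E_kronecker_apply]
  rw [← sum_labels_ite (t := t)
    (fun _ _ => if (x.1 : ℤ) = y.2 ∧ (x.2 : ℤ) = y.1 then (1 : 𝕂) else 0) x.1.2 x.2.2]
  refine Finset.sum_congr rfl fun i _ => Finset.sum_congr rfl fun j _ => ?_
  rw [← ite_and]
  congr 1
  apply propext
  constructor <;> intro h <;> omega

/-- The relation `p` lets one computation serve both Q_q, where it is always true, and R_q, where it
is `<`. -/
theorem sum_qTerm_apply (p : ℤ → ℤ → Prop) [DecidableRel p] (x y : t.Idx × t.Idx) :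
    ∑ i ∈ t.labels, ∑ j ∈ t.labels, (if p i j then qTerm t i j x y else 0) =
      if p x.1 y.1 ∧ (x.2 : ℤ) = -x.1 ∧ (y.2 : ℤ) = -y.1 then
        qWeight t x.1 * (qWeight t y.1)⁻¹ else 0 := by
  rw [← sum_labels_ite (t := t)
    (fun i j => if p i j ∧ (x.2 : ℤ) = -i ∧ (y.2 : ℤ) = -j then
        qWeight t i * (qWeight t j)⁻¹ else 0) x.1.2 y.1.2]
  refine Finset.sum_congr rfl fun i _ => Finset.sum_congr rfl fun j hj => ?_
  rw [qTerm, Matrix.smul_apply, E_kronecker_apply, qWeight_mul_inv hj]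
  by_cases h : i = x.1 ∧ j = y.1
  · obtain ⟨rfl, rfl⟩ := h
    by_cases h' : p x.1 y.1 <;> simp [h']
  · have : ¬ ((x.1 : ℤ) = i ∧ (y.1 : ℤ) = j ∧ (x.2 : ℤ) = -i ∧ (y.2 : ℤ) = -j) :=
      fun e => h ⟨e.1.symm, e.2.1.symm⟩
    rw [if_neg this, if_neg h, smul_zero, ite_self]

/-- Type A needs no separate formula: its labels are positive, so none is the negative of another
and the condition never holds. The same remark makes `Rq_apply` uniform. -/
theorem Qq_apply (x y : t.Idx × t.Idx) :
    Qq t x y = if (x.2 : ℤ) = -x.1 ∧ (y.2 : ℤ) = -y.1 then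
        qWeight t x.1 * (qWeight t y.1)⁻¹ else 0 := by
  have key := sum_qTerm_apply (t := t) (fun _ _ => True) x y
  simp only [if_true, true_and] at key
  by_cases h : t.letter = .A
  · have h1 := labels_pos h x.1.2
    have h2 := labels_pos h x.2.2
    have h0 : Qq t = 0 := by simp only [Qq, h]
    rw [if_neg (by omega), h0, Matrix.zero_apply]
  · have h0 : Qq t = ∑ i ∈ t.labels, ∑ j ∈ t.labels, qTerm t i j := by
      cases hl : t.letter <;> first | exact absurd hl h | simp only [Qq, hl]
    rw [← key, h0]
    simp only [Matrix.sum_apply]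

theorem diagCoeff_of_A (h : t.letter = .A) {i j : ℤ} (hi : i ∈ t.labels) (hj : j ∈ t.labels) :
    diagCoeff i j = if i = j then q else 1 := by
  have h1 := labels_pos h hi
  have h2 := labels_pos h hj
  rw [diagCoeff, if_neg (show ¬ i = -j by omega)]
  split_ifs <;> simp

theorem sum_diag_apply (f : ℤ → ℤ → 𝕂) (x y : t.Idx × t.Idx) :
    ∑ i ∈ t.labels, ∑ j ∈ t.labels, (f i j • (t.E i i ⊗ₖ t.E j j)) x y =
      if (x.1 : ℤ) = y.1 ∧ (x.2 : ℤ) = y.2 then f x.1 x.2 else 0 := by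
  rw [← sum_labels_ite (t := t)
    (fun i j => if (x.1 : ℤ) = y.1 ∧ (x.2 : ℤ) = y.2 then f i j else 0) x.1.2 x.2.2]
  refine Finset.sum_congr rfl fun i _ => Finset.sum_congr rfl fun j _ => ?_
  rw [Matrix.smul_apply, E_kronecker_apply, smul_eq_mul, mul_ite, mul_one, mul_zero, ← ite_and]
  congr 1
  apply propext
  constructor <;> intro h <;> omega

theorem sum_perm_apply (x y : t.Idx × t.Idx) :
    ∑ i ∈ t.labels, ∑ j ∈ t.labels, (if i < j then (t.E i j ⊗ₖ t.E j i) x y else 0) =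
      if (x.1 : ℤ) < x.2 ∧ (x.1 : ℤ) = y.2 ∧ (x.2 : ℤ) = y.1 then 1 else 0 := by
  rw [← sum_labels_ite (t := t)
    (fun i j => if i < j ∧ (x.1 : ℤ) = y.2 ∧ (x.2 : ℤ) = y.1 then (1 : 𝕂) else 0) x.1.2 x.2.2]
  refine Finset.sum_congr rfl fun i _ => Finset.sum_congr rfl fun j _ => ?_
  rw [E_kronecker_apply, ← ite_and, ← ite_and]
  congr 1
  apply propext
  constructor <;> intro h <;> omega

theorem Rq_apply (x y : t.Idx × t.Idx) :
    Rq t x y = (if (x.1 : ℤ) = y.1 ∧ (x.2 : ℤ) = y.2 then diagCoeff x.1 x.2 else 0)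
      + (q - q⁻¹) * ((if (x.1 : ℤ) < x.2 ∧ (x.1 : ℤ) = y.2 ∧ (x.2 : ℤ) = y.1 then 1 else 0)
        - if (x.1 : ℤ) < y.1 ∧ (x.2 : ℤ) = -x.1 ∧ (y.2 : ℤ) = -y.1 then
            qWeight t x.1 * (qWeight t y.1)⁻¹ else 0) := by
  rw [← sum_diag_apply, ← sum_perm_apply, ← sum_qTerm_apply (fun i j => i < j) x y]
  by_cases h : t.letter = .A
  · have h0 : ∑ i ∈ t.labels, ∑ j ∈ t.labels, (if i < j then qTerm t i j x y else 0) = 0 := by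
      have h1 := labels_pos h x.1.2
      have h2 := labels_pos h x.2.2
      rw [sum_qTerm_apply (fun i j => i < j) x y, if_neg (by omega)]
    have hR : Rq t = ∑ i ∈ t.labels, ∑ j ∈ t.labels,
      ((if i = j then q else 1) • (t.E i i ⊗ₖ t.E j j)
        + if i < j then (q - q⁻¹) • (t.E i j ⊗ₖ t.E j i) else 0) := by simp only [Rq, h]
    rw [h0, sub_zero, hR]
    simp only [Matrix.sum_apply, Finset.mul_sum, ← Finset.sum_add_distrib]
    refine Finset.sum_congr rfl fun i hi => Finset.sum_congr rfl fun j hj => ?_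
    rw [diagCoeff_of_A h hi hj, Matrix.add_apply]
    congr 1
    by_cases hij : i < j <;> simp [hij]
  · have hR : Rq t = ∑ i ∈ t.labels, ∑ j ∈ t.labels,
      (q ^ ((if i = j then 1 else 0) - (if i = -j then 1 else 0) : ℤ) • (t.E i i ⊗ₖ t.E j j)
        + if i < j then (q - q⁻¹) • (t.E i j ⊗ₖ t.E j i - qTerm t i j) else 0) := by
      cases hl : t.letter <;> first | exact absurd hl h | simp only [Rq, hl]
    rw [hR]
    simp only [Matrix.sum_apply, Finset.mul_sum, ← Finset.sum_add_distrib,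
      ← Finset.sum_sub_distrib]
    refine Finset.sum_congr rfl fun i hi => Finset.sum_congr rfl fun j hj => ?_
    rw [Matrix.add_apply, diagCoeff]
    congr 1
    by_cases hij : i < j
    · simp only [if_pos hij, Matrix.smul_apply, Matrix.sub_apply, smul_eq_mul]
    · simp [hij]

end Entries

/-! ### Products of R_q, `RqOpInv` and elementary tensors, entry by entry. -/

section Products

variable {t : AffineType}

theorem mul_one_kronecker_apply (M : Mat2 t 𝕂) (X : t.Mat 𝕂) (a b c d : t.Idx) :
    (M * ((1 : t.Mat 𝕂) ⊗ₖ X)) (a, b) (c, d) = ∑ m, M (a, b) (c, m) * X m d := by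
  rw [Matrix.mul_apply, Fintype.sum_prod_type, Finset.sum_eq_single c]
  · simp
  · intro e _ he; simp [Matrix.one_apply_ne he]
  · simp

theorem kronecker_one_mul_apply (M : Mat2 t 𝕂) (X : t.Mat 𝕂) (a b c d : t.Idx) :
    ((X ⊗ₖ (1 : t.Mat 𝕂)) * M) (a, b) (c, d) = ∑ m, X a m * M (m, b) (c, d) := by
  rw [Matrix.mul_apply, Fintype.sum_prod_type]
  refine Finset.sum_congr rfl fun m _ => ?_
  rw [Finset.sum_eq_single b]
  · simp
  · intro e _ he; simp [Matrix.one_apply_ne he.symm]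
  · simp

theorem mul_kronecker_diagonal_apply (M : Mat2 t 𝕂) (X : t.Mat 𝕂) (g : t.Idx → 𝕂)
    (a b c d : t.Idx) :
    (M * (X ⊗ₖ Matrix.diagonal g)) (a, b) (c, d) = g d * ∑ m, M (a, b) (m, d) * X m c := by
  rw [Matrix.mul_apply, Fintype.sum_prod_type, Finset.mul_sum]
  refine Finset.sum_congr rfl fun m _ => ?_
  rw [Finset.sum_eq_single d]
  · simp; ring
  · intro e _ he; simp [Matrix.diagonal_apply_ne _ he]
  · simp

theorem diagonal_kronecker_mul_apply (M : Mat2 t 𝕂) (X : t.Mat 𝕂) (g : t.Idx → 𝕂)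
    (a b c d : t.Idx) :
    ((Matrix.diagonal g ⊗ₖ X) * M) (a, b) (c, d) = g a * ∑ m, X b m * M (a, m) (c, d) := by
  rw [Matrix.mul_apply, Fintype.sum_prod_type, Finset.sum_eq_single a]
  · simp [Finset.mul_sum, mul_assoc]
  · intro e _ he; simp [Matrix.diagonal_apply_ne _ he.symm]
  · simp

/-- The hypothesis allows z to be a non-label, as happens for z = -c in type A; then both sides are
zero. -/
theorem sum_idx_ite (F : ℤ → 𝕂) (z : ℤ) (hz : F z ≠ 0 → z ∈ t.labels) :
    ∑ m : t.Idx, (if (m : ℤ) = z then F m else 0) = F z := by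
  by_cases h : z ∈ t.labels
  · rw [Finset.sum_eq_single (⟨z, h⟩ : t.Idx)]
    · simp
    · intro m _ hm
      rw [if_neg fun e => hm (Subtype.ext e)]
    · simp
  · rw [not_imp_comm.1 hz h]
    refine Finset.sum_eq_zero fun m _ => ?_
    exact if_neg fun e => h (by rw [← e]; exact m.2)

/-- The common shape of the entries of `R_q` and of the inverse of `R_{q,21}`. -/
def HasShape (M : Mat2 t 𝕂) (D : ℤ → ℤ → 𝕂) (e : 𝕂) (p : ℤ → ℤ → Prop) [DecidableRel p] : Prop :=
  ∀ x y : t.Idx × t.Idx, M x y =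
    (if (x.1 : ℤ) = y.1 ∧ (x.2 : ℤ) = y.2 then D x.1 x.2 else 0)
      + e * ((if p x.1 x.2 ∧ (x.1 : ℤ) = y.2 ∧ (x.2 : ℤ) = y.1 then 1 else 0)
        - if p x.1 y.1 ∧ (x.2 : ℤ) = -x.1 ∧ (y.2 : ℤ) = -y.1 then
            qWeight t x.1 * (qWeight t y.1)⁻¹ else 0)

theorem Rq_hasShape : HasShape (Rq t) diagCoeff (q - q⁻¹) (· < ·) := Rq_apply

/-- The inverse of `R_{q,21}`. -/
noncomputable def RqOpInv (t : AffineType) : Mat2 t 𝕂 :=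
  Rq t - (q - q⁻¹) • P t + (q - q⁻¹) • Qq t

/-- Subtracting the full P turns the indicator of a < b into minus that of a > b, and adding Q_q
does the same to the other off-diagonal sum. The boundary cases of equality correct the diagonal: q
- (q - q⁻¹) = q⁻¹ when a = b, and q⁻¹ + (q - q⁻¹) = q when b = -a. At the label 0 both corrections
occur and cancel. -/
theorem RqOpInv_hasShape :
    HasShape (RqOpInv t) (fun i j => (diagCoeff i j)⁻¹) (-(q - q⁻¹)) (· > ·) := by
  rintro ⟨a, b⟩ ⟨c, d⟩
  rw [RqOpInv, Matrix.add_apply, Matrix.sub_apply, Matrix.smul_apply, Matrix.smul_apply,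
    Rq_apply, P_apply, Qq_apply]
  dsimp only
  have ha : qWeight t a ≠ 0 := qWeight_ne_zero a.2
  obtain ⟨a, ha'⟩ := a
  obtain ⟨b, hb'⟩ := b
  obtain ⟨c, hc'⟩ := c
  obtain ⟨d, hd'⟩ := d
  dsimp only at ha ⊢
  have hq := q_ne_zero
  simp only [diagCoeff, smul_eq_mul]
  by_cases hac : a = c
  · subst hac
    by_cases hab : a = b
    · subst hab
      by_cases had : a = d
      · subst had
        by_cases h0 : a = -a
        · simp [← h0, ha]
        · simp [h0]
      · have h1 : ¬ (a = -a ∧ d = -a) := by omega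
        simp [had, h1]
    · by_cases hbd : b = d
      · subst hbd
        by_cases h3 : b = -a
        · subst h3
          have h4 : ¬ (a = -a) := by omega
          have h5 : ¬ (-a = a) := by omega
          simp [h4, h5, ha]
        · have h4 : ¬ (a = -b) := by omega
          simp [h3, h4, hab, Ne.symm hab]
      · have h2 : ¬ (b = -a ∧ d = -a) := by omega
        simp [hbd, h2, Ne.symm hab]
  -- A permutation entry has b = c, so its order condition can be rewritten with c. All indicators
  -- then depend on the sign of a - c alone.
  · have e1 : (a < b ∧ a = d ∧ b = c) = (a < c ∧ a = d ∧ b = c) := propext (by omega)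
    have e2 : (a > b ∧ a = d ∧ b = c) = (a > c ∧ a = d ∧ b = c) := propext (by omega)
    have e3 : ¬ (a = c ∧ b = d) := fun h => hac h.1
    simp only [e1, e2, if_neg e3]
    rcases lt_or_gt_of_ne hac with h | h
    · have h' : ¬ a > c := by omega
      simp only [h, h', true_and, false_and, if_false]
      split_ifs <;> ring
    · have h' : ¬ a < c := by omega
      simp only [h, h', true_and, false_and, if_false]
      split_ifs <;> ring

/-- `X` is the matrix with entries `f`, and `f` vanishes off the labels. -/
structure HasEntries (X : t.Mat 𝕂) (f : ℤ → ℤ → 𝕂) : Prop where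
  apply_eq : ∀ a b : t.Idx, X a b = f a b
  mem_left : ∀ a b, f a b ≠ 0 → a ∈ t.labels
  mem_right : ∀ a b, f a b ≠ 0 → b ∈ t.labels

variable {M : Mat2 t 𝕂} {D : ℤ → ℤ → 𝕂} {e : 𝕂} {p : ℤ → ℤ → Prop} [DecidableRel p]
  {X : t.Mat 𝕂} {f : ℤ → ℤ → 𝕂}

/-- For fixed a, b, c only m = b, m = a and m = -c can contribute, one for each of the three
families of entries. This and the next three lemmas are the products with 1 ⊗ X and X ⊗ D on the
right, and with X ⊗ 1 and D ⊗ X on the left, where D is diagonal and its factor is left out of the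
sum. -/
theorem HasShape.sum_snd (hM : HasShape M D e p) (hX : HasEntries X f) (a b c d : t.Idx) :
    ∑ m, M (a, b) (c, m) * X m d =
      (if (a : ℤ) = c then D a b * f b d else 0)
        + e * ((if (b : ℤ) = c ∧ p a b then f a d else 0)
          - if (b : ℤ) = -a ∧ p a c then qWeight t a * (qWeight t c)⁻¹ * f (-c) d else 0) := by
  have h (m : t.Idx) : M (a, b) (c, m) * X m d =
      (if (m : ℤ) = b then (if (a : ℤ) = c then D a b * f m d else 0) else 0)
      + e * ((if (m : ℤ) = a then (if (b : ℤ) = c ∧ p a b then f m d else 0) else 0)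
        - (if (m : ℤ) = -c then (if (b : ℤ) = -a ∧ p a c then
          qWeight t a * (qWeight t c)⁻¹ * f m d else 0) else 0)) := by
    rw [hM, hX.apply_eq, add_mul, mul_assoc, sub_mul]
    dsimp only
    simp only [ite_mul, one_mul, zero_mul, ← ite_and]
    congr 1
    · congr 1; apply propext; constructor <;> intro h <;> omega
    · congr 2 <;> congr 1 <;> apply propext
      · rw [eq_comm (a := (m : ℤ))]; tauto
      · tauto
  simp only [h, Finset.sum_add_distrib, ← Finset.mul_sum, Finset.sum_sub_distrib]
  rw [sum_idx_ite (fun m => if (a : ℤ) = c then D a b * f m d else 0) b (fun _ => b.2),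
    sum_idx_ite (fun m => if (b : ℤ) = c ∧ p a b then f m d else 0) a (fun _ => a.2),
    sum_idx_ite (fun m => if (b : ℤ) = -a ∧ p a c then
          qWeight t a * (qWeight t c)⁻¹ * f m d else 0) (-c)]
  intro h
  rw [ne_eq, ite_eq_right_iff, not_forall] at h
  exact hX.mem_left _ _ (right_ne_zero_of_mul h.choose_spec)

theorem HasShape.sum_fst (hM : HasShape M D e p) (hX : HasEntries X f) (a b c d : t.Idx) :
    ∑ m, M (a, b) (m, d) * X m c =
      (if (b : ℤ) = d then D a b * f a c else 0)
        + e * ((if (a : ℤ) = d ∧ p a b then f b c else 0)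
          - if (b : ℤ) = -a ∧ p a (-d) then
              qWeight t a * (qWeight t (-d))⁻¹ * f (-d) c else 0) := by
  have h (m : t.Idx) : M (a, b) (m, d) * X m c =
      (if (m : ℤ) = a then (if (b : ℤ) = d then D a b * f m c else 0) else 0)
      + e * ((if (m : ℤ) = b then (if (a : ℤ) = d ∧ p a b then f m c else 0) else 0)
        - (if (m : ℤ) = -d then (if (b : ℤ) = -a ∧ p a m then
          qWeight t a * (qWeight t m)⁻¹ * f m c else 0) else 0)) := by
    rw [hM, hX.apply_eq, add_mul, mul_assoc, sub_mul]
    dsimp only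
    simp only [ite_mul, one_mul, zero_mul, ← ite_and]
    congr 1
    · congr 1; apply propext; constructor <;> intro h <;> omega
    · congr 2 <;> congr 1 <;> apply propext
      · rw [eq_comm (a := (m : ℤ))]; tauto
      · rw [show ((d : ℤ) = -m ↔ (m : ℤ) = -d) by omega]
        tauto
  simp only [h, Finset.sum_add_distrib, ← Finset.mul_sum, Finset.sum_sub_distrib]
  rw [sum_idx_ite (fun m => if (b : ℤ) = d then D a b * f m c else 0) a (fun _ => a.2),
    sum_idx_ite (fun m => if (a : ℤ) = d ∧ p a b then f m c else 0) b (fun _ => b.2),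
    sum_idx_ite (fun m => if (b : ℤ) = -a ∧ p a m then
          qWeight t a * (qWeight t m)⁻¹ * f m c else 0) (-d)]
  intro h
  rw [ne_eq, ite_eq_right_iff, not_forall] at h
  exact hX.mem_left _ _ (right_ne_zero_of_mul h.choose_spec)

theorem HasShape.fst_sum (hM : HasShape M D e p) (hX : HasEntries X f) (a b c d : t.Idx) :
    ∑ m, X a m * M (m, b) (c, d) =
      (if (b : ℤ) = d then D c b * f a c else 0)
        + e * ((if (b : ℤ) = c ∧ p d b then f a d else 0)
          - if (d : ℤ) = -c ∧ p (-b) c then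
              qWeight t (-b) * (qWeight t c)⁻¹ * f a (-b) else 0) := by
  have h (m : t.Idx) : X a m * M (m, b) (c, d) =
      (if (m : ℤ) = c then (if (b : ℤ) = d then D m b * f a m else 0) else 0)
      + e * ((if (m : ℤ) = d then (if (b : ℤ) = c ∧ p m b then f a m else 0) else 0)
        - (if (m : ℤ) = -b then (if (d : ℤ) = -c ∧ p m c then
          qWeight t m * (qWeight t c)⁻¹ * f a m else 0) else 0)) := by
    rw [hM, hX.apply_eq, mul_comm, add_mul, mul_assoc, sub_mul]
    dsimp only
    simp only [ite_mul, one_mul, zero_mul, ← ite_and]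
    congr 1
    congr 2 <;> congr 1 <;> apply propext
    · tauto
    · rw [show ((b : ℤ) = -m ↔ (m : ℤ) = -b) by omega]
      tauto
  simp only [h, Finset.sum_add_distrib, ← Finset.mul_sum, Finset.sum_sub_distrib]
  rw [sum_idx_ite (fun m => if (b : ℤ) = d then D m b * f a m else 0) c (fun _ => c.2),
    sum_idx_ite (fun m => if (b : ℤ) = c ∧ p m b then f a m else 0) d (fun _ => d.2),
    sum_idx_ite (fun m => if (d : ℤ) = -c ∧ p m c then
          qWeight t m * (qWeight t c)⁻¹ * f a m else 0) (-b)]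
  intro h
  rw [ne_eq, ite_eq_right_iff, not_forall] at h
  exact hX.mem_right _ _ (right_ne_zero_of_mul h.choose_spec)

theorem HasShape.snd_sum (hM : HasShape M D e p) (hX : HasEntries X f) (a b c d : t.Idx) :
    ∑ m, X b m * M (a, m) (c, d) =
      (if (a : ℤ) = c then D a d * f b d else 0)
        + e * ((if (a : ℤ) = d ∧ p a c then f b c else 0)
          - if (d : ℤ) = -c ∧ p a c then
              qWeight t a * (qWeight t c)⁻¹ * f b (-a) else 0) := by
  have h (m : t.Idx) : X b m * M (a, m) (c, d) =
      (if (m : ℤ) = d then (if (a : ℤ) = c then D a m * f b m else 0) else 0)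
      + e * ((if (m : ℤ) = c then (if (a : ℤ) = d ∧ p a m then f b m else 0) else 0)
        - (if (m : ℤ) = -a then (if (d : ℤ) = -c ∧ p a c then
          qWeight t a * (qWeight t c)⁻¹ * f b m else 0) else 0)) := by
    rw [hM, hX.apply_eq, mul_comm, add_mul, mul_assoc, sub_mul]
    dsimp only
    simp only [ite_mul, one_mul, zero_mul, ← ite_and]
    congr 1
    · congr 1; apply propext; constructor <;> intro h <;> omega
    · congr 2 <;> congr 1 <;> apply propext <;> tauto
  simp only [h, Finset.sum_add_distrib, ← Finset.mul_sum, Finset.sum_sub_distrib]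
  rw [sum_idx_ite (fun m => if (a : ℤ) = c then D a m * f b m else 0) d (fun _ => d.2),
    sum_idx_ite (fun m => if (a : ℤ) = d ∧ p a m then f b m else 0) c (fun _ => c.2),
    sum_idx_ite (fun m => if (d : ℤ) = -c ∧ p a c then
          qWeight t a * (qWeight t c)⁻¹ * f b m else 0) (-a)]
  intro h
  rw [ne_eq, ite_eq_right_iff, not_forall] at h
  exact hX.mem_right _ _ (right_ne_zero_of_mul h.choose_spec)

end Products

/-! ### Intertwining relations for one generator, reduced to scalar identities. -/

section NodeRelations

variable {t : AffineType}

theorem Qq_hasShape_sum_snd {X : t.Mat 𝕂} {f : ℤ → ℤ → 𝕂} (hX : HasEntries X f)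
    (a b c d : t.Idx) : ∑ m, Qq t (a, b) (c, m) * X m d =
      if (b : ℤ) = -a then qWeight t a * ((qWeight t c)⁻¹ * f (-c) d) else 0 := by
  have h (m : t.Idx) : Qq t (a, b) (c, m) * X m d =
      if (m : ℤ) = -c then (if (b : ℤ) = -a then
        qWeight t a * ((qWeight t c)⁻¹ * f m d) else 0) else 0 := by
    rw [Qq_apply, hX.apply_eq, ite_mul, zero_mul, ← ite_and, mul_assoc]
    congr 1; apply propext; tauto
  simp only [h]
  rw [sum_idx_ite (fun m => if (b : ℤ) = -a then
        qWeight t a * ((qWeight t c)⁻¹ * f m d) else 0) (-c)]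
  intro h
  rw [ne_eq, ite_eq_right_iff, not_forall] at h
  exact hX.mem_left _ _ (right_ne_zero_of_mul (right_ne_zero_of_mul h.choose_spec))

theorem Qq_hasShape_sum_fst {X : t.Mat 𝕂} {f : ℤ → ℤ → 𝕂} (hX : HasEntries X f)
    (a b c d : t.Idx) : ∑ m, Qq t (a, b) (m, d) * X m c =
      if (b : ℤ) = -a then qWeight t a * ((qWeight t (-d))⁻¹ * f (-d) c) else 0 := by
  have h (m : t.Idx) : Qq t (a, b) (m, d) * X m c =
      if (m : ℤ) = -d then (if (b : ℤ) = -a then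
        qWeight t a * ((qWeight t m)⁻¹ * f m c) else 0) else 0 := by
    rw [Qq_apply, hX.apply_eq, ite_mul, zero_mul, ← ite_and, mul_assoc]
    congr 1; apply propext
    rw [show ((d : ℤ) = -m ↔ (m : ℤ) = -d) by omega]
    tauto
  simp only [h]
  rw [sum_idx_ite (fun m => if (b : ℤ) = -a then
        qWeight t a * ((qWeight t m)⁻¹ * f m c) else 0) (-d)]
  intro h
  rw [ne_eq, ite_eq_right_iff, not_forall] at h
  exact hX.mem_left _ _ (right_ne_zero_of_mul (right_ne_zero_of_mul h.choose_spec))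

theorem Qq_hasShape_fst_sum {X : t.Mat 𝕂} {f : ℤ → ℤ → 𝕂} (hX : HasEntries X f)
    (a b c d : t.Idx) : ∑ m, X a m * Qq t (m, b) (c, d) =
      if (d : ℤ) = -c then (qWeight t c)⁻¹ * (qWeight t (-b) * f a (-b)) else 0 := by
  have h (m : t.Idx) : X a m * Qq t (m, b) (c, d) =
      if (m : ℤ) = -b then (if (d : ℤ) = -c then
        (qWeight t c)⁻¹ * (qWeight t m * f a m) else 0) else 0 := by
    rw [Qq_apply, hX.apply_eq, mul_ite, mul_zero, ← ite_and]
    congr 1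
    · apply propext
      rw [show ((b : ℤ) = -m ↔ (m : ℤ) = -b) by omega]
    · ring
  simp only [h]
  rw [sum_idx_ite (fun m => if (d : ℤ) = -c then
        (qWeight t c)⁻¹ * (qWeight t m * f a m) else 0) (-b)]
  intro h
  rw [ne_eq, ite_eq_right_iff, not_forall] at h
  exact hX.mem_right _ _ (right_ne_zero_of_mul (right_ne_zero_of_mul h.choose_spec))

theorem Qq_hasShape_snd_sum {X : t.Mat 𝕂} {f : ℤ → ℤ → 𝕂} (hX : HasEntries X f)
    (a b c d : t.Idx) : ∑ m, X b m * Qq t (a, m) (c, d) =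
      if (d : ℤ) = -c then (qWeight t c)⁻¹ * (qWeight t a * f b (-a)) else 0 := by
  have h (m : t.Idx) : X b m * Qq t (a, m) (c, d) =
      if (m : ℤ) = -a then (if (d : ℤ) = -c then
        (qWeight t c)⁻¹ * (qWeight t a * f b m) else 0) else 0 := by
    rw [Qq_apply, hX.apply_eq, mul_ite, mul_zero, ← ite_and]
    congr 1
    ring
  simp only [h]
  rw [sum_idx_ite (fun m => if (d : ℤ) = -c then
        (qWeight t c)⁻¹ * (qWeight t a * f b m) else 0) (-a)]
  intro h
  rw [ne_eq, ite_eq_right_iff, not_forall] at h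
  exact hX.mem_right _ _ (right_ne_zero_of_mul (right_ne_zero_of_mul h.choose_spec))

/-- Entries `f` of a generator that annihilates, up to the factor `s` between the two legs, the
vectors defining `Q_q`. -/
structure KillsQ (t : AffineType) (s : 𝕂) (f : ℤ → ℤ → 𝕂) (g : ℤ → 𝕂) : Prop where
  row : ∀ c ∈ t.labels, ∀ d ∈ t.labels, (qWeight t c)⁻¹ * f (-c) d +
    s * (g d * ((qWeight t (-d))⁻¹ * f (-d) c)) = 0
  col : ∀ a ∈ t.labels, ∀ b ∈ t.labels,
    g a * (qWeight t a * f b (-a)) + s * (qWeight t (-b) * f a (-b)) = 0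

variable {X : t.Mat 𝕂} {f : ℤ → ℤ → 𝕂} {g : ℤ → 𝕂} {s : 𝕂}

/-- As Q_q is a column times a row, it is enough that the row be annihilated, which is `h.row`. The
next lemma is the same for the column. -/
theorem Qq_mul_eq_zero (hX : HasEntries X f) (h : KillsQ t s f g) :
    Qq t * ((1 : t.Mat 𝕂) ⊗ₖ X + s • (X ⊗ₖ Matrix.diagonal fun a : t.Idx => g a)) = 0 := by
  ext ⟨a, b⟩ ⟨c, d⟩
  rw [mul_add, mul_smul_comm, Matrix.add_apply, Matrix.smul_apply, mul_one_kronecker_apply,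
    mul_kronecker_diagonal_apply, Qq_hasShape_sum_snd hX, Qq_hasShape_sum_fst hX,
    Matrix.zero_apply, smul_eq_mul]
  split_ifs
  · linear_combination qWeight t a * h.row c c.2 d d.2
  · ring

theorem mul_Qq_eq_zero (hX : HasEntries X f) (h : KillsQ t s f g) :
    ((Matrix.diagonal fun a : t.Idx => g a) ⊗ₖ X + s • (X ⊗ₖ (1 : t.Mat 𝕂))) * Qq t = 0 := by
  ext ⟨a, b⟩ ⟨c, d⟩
  rw [add_mul, smul_mul_assoc, Matrix.add_apply, Matrix.smul_apply, kronecker_one_mul_apply,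
    diagonal_kronecker_mul_apply, Qq_hasShape_fst_sum hX, Qq_hasShape_snd_sum hX,
    Matrix.zero_apply, smul_eq_mul]
  split_ifs
  · linear_combination (qWeight t c)⁻¹ * h.col a a.2 b b.2
  · ring

theorem P_mul_kronecker (X Y : t.Mat 𝕂) : P t * (X ⊗ₖ Y) = (Y ⊗ₖ X) * P t := by
  ext ⟨a, b⟩ ⟨c, d⟩
  rw [Matrix.mul_apply, Matrix.mul_apply, Fintype.sum_eq_single (b, a), Fintype.sum_eq_single (d,
    c)]
  · simp [P_apply]; ring
  · rintro ⟨m, n⟩ h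
    rw [P_apply, if_neg, mul_zero]
    exact fun e => h (Prod.ext (Subtype.ext e.1) (Subtype.ext e.2))
  · rintro ⟨m, n⟩ h
    rw [P_apply, if_neg, zero_mul]
    exact fun e => h (Prod.ext (Subtype.ext e.2.symm) (Subtype.ext e.1.symm))

/-- The entrywise form of `R_q Δᵒᵖ(x) = Δ(x) R_q` for a generator `x` at a finite node. -/
def FiniteNode (t : AffineType) (f : ℤ → ℤ → 𝕂) (g : ℤ → 𝕂) : Prop :=
  ∀ a ∈ t.labels, ∀ b ∈ t.labels, ∀ c ∈ t.labels, ∀ d ∈ t.labels,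
    (if a = c then f b d * (diagCoeff a b - g a * diagCoeff a d) else 0)
    + (if b = d then f a c * (g b * diagCoeff a b - diagCoeff c b) else 0)
    + (q - q⁻¹) * (
      (if b = c then f a d * ((if a < b then 1 else 0) - if d < b then 1 else 0) else 0)
      + (if a = d then g a * f b c * ((if a < b then 1 else 0) - if a < c then 1 else 0) else 0)
      - (if b = -a then qWeight t a * ((qWeight t c)⁻¹ * f (-c) d) *
          ((if a < c then 1 else 0) - if a < -d then 1 else 0) else 0)
      + (if d = -c then (qWeight t c)⁻¹ * (qWeight t (-b) * f a (-b)) *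
          ((if -b < c then 1 else 0) - if a < c then 1 else 0) else 0)) = 0

/-- The entries of the two sides are grouped by type. In each group the contributions of the two
legs differ only in an indicator, so differences of indicators remain; these vanish unless a label
falls between the two labels that X connects. -/
theorem FiniteNode.Rq_mul (h : FiniteNode t f g) (hX : HasEntries X f) (hQ : KillsQ t 1 f g) :
    Rq t * ((1 : t.Mat 𝕂) ⊗ₖ X + X ⊗ₖ Matrix.diagonal fun a : t.Idx => g a) =
      (X ⊗ₖ (1 : t.Mat 𝕂) + (Matrix.diagonal fun a : t.Idx => g a) ⊗ₖ X) * Rq t := by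
  ext ⟨a, b⟩ ⟨c, d⟩
  rw [mul_add, add_mul, Matrix.add_apply, Matrix.add_apply, mul_one_kronecker_apply,
    mul_kronecker_diagonal_apply, kronecker_one_mul_apply, diagonal_kronecker_mul_apply,
    Rq_hasShape.sum_snd hX, Rq_hasShape.sum_fst hX, Rq_hasShape.fst_sum hX, Rq_hasShape.snd_sum hX]
  have key := h a a.2 b b.2 c c.2 d d.2
  have h1 := hQ.row c c.2 d d.2
  have h2 := hQ.col a a.2 b b.2
  obtain ⟨a, ha⟩ := a
  obtain ⟨b, hb⟩ := b
  obtain ⟨c, hc⟩ := c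
  obtain ⟨d, hd⟩ := d
  dsimp only at *
  have e1 : (if a = c then diagCoeff a b * f b d else 0)
      - g a * (if a = c then diagCoeff a d * f b d else 0) =
      if a = c then f b d * (diagCoeff a b - g a * diagCoeff a d) else 0 := by
    split_ifs <;> ring
  have e2 : g d * (if b = d then diagCoeff a b * f a c else 0)
      - (if b = d then diagCoeff c b * f a c else 0) =
      if b = d then f a c * (g b * diagCoeff a b - diagCoeff c b) else 0 := by
    split_ifs with h
    · rw [h]; ring
    · ring
  have e3 : (if b = c ∧ a < b then f a d else 0) - (if b = c ∧ d < b then f a d else 0) =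
      if b = c then f a d * ((if a < b then 1 else 0) - if d < b then 1 else 0) else 0 := by
    by_cases h : b = c
    · simp only [h, true_and, if_true]; split_ifs <;> ring
    · simp [h]
  have e4 : g d * (if a = d ∧ a < b then f b c else 0) - g a * (if a = d ∧ a < c then f b c else 0)
      = if a = d then g a * f b c * ((if a < b then 1 else 0) - if a < c then 1 else 0) else 0 := by
    by_cases h : a = d
    · subst h
      by_cases a < b <;> by_cases a < c <;> simp [*]
    · simp [h]
  -- The row condition replaces the entry f (-d) c, which comes from X ⊗ D, by minus the entry f
  -- (-c) d from 1 ⊗ X. Likewise `e6` rests on the column condition.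
  have e5 : (if b = -a ∧ a < c then qWeight t a * (qWeight t c)⁻¹ * f (-c) d else 0)
      + g d * (if b = -a ∧ a < -d then qWeight t a * (qWeight t (-d))⁻¹ * f (-d) c else 0)
      = if b = -a then qWeight t a * ((qWeight t c)⁻¹ * f (-c) d) *
          ((if a < c then 1 else 0) - if a < -d then 1 else 0) else 0 := by
    by_cases b = -a
    · by_cases a < -d
      · by_cases a < c <;> simp only [*, true_and, if_true, if_false] <;>
          linear_combination qWeight t a * h1
      · by_cases a < c <;> simp only [*, true_and, if_true, if_false] <;> ring
    · simp [*]
  have e6 : (if d = -c ∧ -b < c then qWeight t (-b) * (qWeight t c)⁻¹ * f a (-b) else 0)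
      + g a * (if d = -c ∧ a < c then qWeight t a * (qWeight t c)⁻¹ * f b (-a) else 0)
      = if d = -c then (qWeight t c)⁻¹ * (qWeight t (-b) * f a (-b)) *
          ((if -b < c then 1 else 0) - if a < c then 1 else 0) else 0 := by
    by_cases d = -c
    · by_cases a < c
      · by_cases -b < c <;> simp only [*, true_and, if_true, if_false] <;>
          linear_combination (qWeight t c)⁻¹ * h2
      · by_cases -b < c <;> simp only [*, true_and, if_true, if_false] <;> ring
    · simp [*]
  linear_combination key + e1 + e2 + (q - q⁻¹) * (e3 + e4 - e5 + e6)

/-- The entrywise form of the intertwining relations of `R_q` and the inverse of `R_{q,21}` for a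
generator at the affine node. -/
structure AffineNode (t : AffineType) (f : ℤ → ℤ → 𝕂) (g : ℤ → 𝕂) : Prop where
  zero : ∀ a ∈ t.labels, ∀ b ∈ t.labels, ∀ c ∈ t.labels, ∀ d ∈ t.labels,
    (if a = c then f b d * (diagCoeff a b - g a * diagCoeff a d) else 0)
    + (q - q⁻¹) * (
      (if b = c then f a d * (if a < b then 1 else 0) else 0)
      - (if a = d then g a * f b c * (if a < c then 1 else 0) else 0)
      - (if b = -a then qWeight t a * ((qWeight t c)⁻¹ * f (-c) d) *
          (if a < c then 1 else 0) else 0)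
      + (if d = -c then (qWeight t c)⁻¹ * (g a * (qWeight t a * f b (-a))) *
          (if a < c then 1 else 0) else 0)) = 0
  infty : ∀ a ∈ t.labels, ∀ b ∈ t.labels, ∀ c ∈ t.labels, ∀ d ∈ t.labels,
    (if b = d then f a c * (g b * (diagCoeff a b)⁻¹ - (diagCoeff c b)⁻¹) else 0)
    - (q - q⁻¹) * (
      (if a = d then g a * f b c * (if b < a then 1 else 0) else 0)
      - (if b = c then f a d * (if b < d then 1 else 0) else 0)
      - (if b = -a then qWeight t a * (g d * ((qWeight t (-d))⁻¹ * f (-d) c)) *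
          (if -d < a then 1 else 0) else 0)
      + (if d = -c then (qWeight t c)⁻¹ * (qWeight t (-b) * f a (-b)) *
          (if c < -b then 1 else 0) else 0)) = 0

/-- This is the relation for x_0 where the first spectral parameter vanishes: only one summand of
the coproduct survives and the cleared R-matrix is a multiple of R_q. -/
theorem AffineNode.Rq_mul (h : AffineNode t f g) (hX : HasEntries X f) :
    Rq t * ((1 : t.Mat 𝕂) ⊗ₖ X) = ((Matrix.diagonal fun a : t.Idx => g a) ⊗ₖ X) * Rq t := by
  ext ⟨a, b⟩ ⟨c, d⟩
  rw [mul_one_kronecker_apply, diagonal_kronecker_mul_apply,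
    Rq_hasShape.sum_snd hX, Rq_hasShape.snd_sum hX]
  have key := h.zero a a.2 b b.2 c c.2 d d.2
  obtain ⟨a, ha⟩ := a
  obtain ⟨b, hb⟩ := b
  obtain ⟨c, hc⟩ := c
  obtain ⟨d, hd⟩ := d
  dsimp only at *
  have e1 : (if a = c then diagCoeff a b * f b d else 0)
      - g a * (if a = c then diagCoeff a d * f b d else 0) =
      if a = c then f b d * (diagCoeff a b - g a * diagCoeff a d) else 0 := by
    split_ifs <;> ring
  have e2 : (if b = c ∧ a < b then f a d else 0) =
      if b = c then f a d * (if a < b then 1 else 0) else 0 := by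
    rw [ite_and]; split_ifs <;> ring
  have e3 : g a * (if a = d ∧ a < c then f b c else 0) =
      if a = d then g a * f b c * (if a < c then 1 else 0) else 0 := by
    rw [ite_and]; split_ifs <;> ring
  have e4 : (if b = -a ∧ a < c then qWeight t a * (qWeight t c)⁻¹ * f (-c) d else 0) =
      if b = -a then qWeight t a * ((qWeight t c)⁻¹ * f (-c) d) *
          (if a < c then 1 else 0) else 0 := by
    rw [ite_and]; split_ifs <;> ring
  have e5 : g a * (if d = -c ∧ a < c then qWeight t a * (qWeight t c)⁻¹ * f b (-a) else 0) =
      if d = -c then (qWeight t c)⁻¹ * (g a * (qWeight t a * f b (-a))) *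
          (if a < c then 1 else 0) else 0 := by
    rw [ite_and]; split_ifs <;> ring
  linear_combination key + e1 + (q - q⁻¹) * (e2 - e3 - e4 + e5)

/-- The companion relation where the second spectral parameter vanishes; there the cleared R-matrix
is a multiple of `RqOpInv`. -/
theorem AffineNode.RqOpInv_mul (h : AffineNode t f g) (hX : HasEntries X f) :
    RqOpInv t * (X ⊗ₖ Matrix.diagonal fun a : t.Idx => g a) =
      (X ⊗ₖ (1 : t.Mat 𝕂)) * RqOpInv t := by
  ext ⟨a, b⟩ ⟨c, d⟩
  rw [mul_kronecker_diagonal_apply, kronecker_one_mul_apply,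
    RqOpInv_hasShape.sum_fst hX, RqOpInv_hasShape.fst_sum hX]
  have key := h.infty a a.2 b b.2 c c.2 d d.2
  obtain ⟨a, ha⟩ := a
  obtain ⟨b, hb⟩ := b
  obtain ⟨c, hc⟩ := c
  obtain ⟨d, hd⟩ := d
  dsimp only at *
  simp only [gt_iff_lt]
  have e1 : g d * (if b = d then (diagCoeff a b)⁻¹ * f a c else 0)
      - (if b = d then (diagCoeff c b)⁻¹ * f a c else 0) =
      if b = d then f a c * (g b * (diagCoeff a b)⁻¹ - (diagCoeff c b)⁻¹) else 0 := by
    split_ifs with h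
    · rw [h]; ring
    · ring
  have e2 : g d * (if a = d ∧ b < a then f b c else 0) =
      if a = d then g a * f b c * (if b < a then 1 else 0) else 0 := by
    rw [ite_and]
    split_ifs with h
    · rw [h]; ring
    all_goals ring
  have e3 : (if b = c ∧ b < d then f a d else 0) =
      if b = c then f a d * (if b < d then 1 else 0) else 0 := by
    rw [ite_and]; split_ifs <;> ring
  have e4 : g d * (if b = -a ∧ -d < a then
        qWeight t a * (qWeight t (-d))⁻¹ * f (-d) c else 0) =
      if b = -a then qWeight t a * (g d * ((qWeight t (-d))⁻¹ * f (-d) c)) *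
          (if -d < a then 1 else 0) else 0 := by
    rw [ite_and]; split_ifs <;> ring
  have e5 : (if d = -c ∧ c < -b then qWeight t (-b) * (qWeight t c)⁻¹ * f a (-b) else 0) =
      if d = -c then (qWeight t c)⁻¹ * (qWeight t (-b) * f a (-b)) *
          (if c < -b then 1 else 0) else 0 := by
    rw [ite_and]; split_ifs <;> ring
  linear_combination key + e1 - (q - q⁻¹) * (e2 - e3 - e4 + e5)

end NodeRelations

/-! ### Scalar identities for the finite nodes, by the form of the generator. -/

section NodeVerification

set_option linter.unusedSimpArgs false

variable {t : AffineType}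

/-- The indicator of a single matrix position. -/
noncomputable def pointMass (a b c d a' b' c' d' : ℤ) : 𝕂 :=
  if a = a' ∧ b = b' ∧ c = c' ∧ d = d' then 1 else 0

/-- Arithmetic with zero, one and signs, for use by the simplifier. -/
theorem ring_simps {R : Type} [CommRing R] : (∀ x : R, 0 * x = 0) ∧ (∀ x : R, x * 0 = 0) ∧
    (∀ x : R, x + 0 = x) ∧ (∀ x : R, 0 + x = x) ∧ (∀ x : R, x - 0 = x) ∧ (∀ x : R, 0 - x = -x) ∧
    (∀ x : R, x - x = 0) ∧ (∀ x : R, 1 * x = x) ∧ (∀ x : R, x * 1 = x) ∧ (∀ x : R, - -x = x) ∧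
    -(0 : R) = 0 ∧ (∀ x y : R, x - -y = x + y) ∧ ∀ x y : R, -x = -y ↔ x = y := by
  simp

/-- Conditions with known truth value, for use by the simplifier. -/
theorem prop_simps : (∀ p : Prop, (p ∧ p) = p) ∧ (∀ p : Prop, (p ∧ True) = p) ∧
    (∀ p : Prop, (True ∧ p) = p) ∧ (∀ p : Prop, (p ∧ False) = False) ∧
    (∀ p : Prop, (False ∧ p) = False) ∧
    (∀ (R : Type) (_ : Decidable True) (x y : R), (if True then x else y) = x) ∧
    (∀ (R : Type) (_ : Decidable False) (x y : R), (if False then x else y) = y) ∧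
    (∀ (R : Type) (p : Prop) (_ : Decidable p) (x : R), (if p then x else x) = x) ∧
    ∀ m : ℤ, (m < m) = False := by
  simp

/-- Powers with exponents zero, one and signs, for use by the simplifier. -/
theorem zpow_simps : (∀ x : 𝕂, x ^ (0 : ℤ) = 1) ∧ (∀ x : 𝕂, x ^ (1 : ℤ) = x) ∧
    ∀ (x : 𝕂) (n : ℤ), x ^ (-n) = (x ^ n)⁻¹ := by
  simp

-- Only the labels ±r and ±s can make a summand nonzero, so each of the six sums is a combination of
-- point masses. The coefficients of the diagonal sum are multiples of q - q⁻¹, for instance q² - 1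
-- = q (q - q⁻¹), and balance those of the other sums.
set_option maxHeartbeats 2000000 in
theorem finiteNode_pair {r s : ℤ} {f : ℤ → ℤ → 𝕂} {g : ℤ → 𝕂}
    (hrs : (r ≤ -2 ∧ s = r + 1) ∨ (r = -2 ∧ s = 1 ∧ (∀ a ∈ t.labels, a ≠ 0) ∧
      qWeight t (-s) = qWeight t s))
    (hf : ∀ a b, f a b = if a = r ∧ b = s then 1 else if a = -s ∧ b = -r then -1 else 0)
    (hg : ∀ a, g a = q ^ ((if a = r then 1 else 0) - (if a = -r then 1 else 0)
      - ((if a = s then 1 else 0) - (if a = -s then 1 else 0)) : ℤ))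
    (hw0 : qWeight t r ≠ 0) (hw0' : qWeight t (-s) ≠ 0)
    (hw : qWeight t s = q * qWeight t r) (hw' : qWeight t (-r) = q * qWeight t (-s)) :
    FiniteNode t f g := by
  intro a ha b hb c hc d hd
  have hq := q_ne_zero
  have hne : r ≠ s ∧ s ≠ r ∧ r ≠ -s ∧ -s ≠ r ∧ r ≠ -r ∧ -r ≠ r ∧ s ≠ -r ∧ -r ≠ s ∧ s ≠ -s ∧
      -s ≠ s := by omega
  have hlt : r < s ∧ ¬ s < r ∧ r < -s ∧ ¬ -s < r ∧ r < -r ∧ ¬ -r < r ∧ s < -r ∧ ¬ -r < s ∧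
      -s < -r ∧ ¬ -r < -s := by omega
  -- Any further label lies on the same side of r and s, and on the same side of -s and -r. For r =
  -- -2, s = 1 this uses that 0 is not a label; the label -1 in between is -s.
  have hcase (x : ℤ) (hx : x ∈ t.labels) : x = r ∨ x = s ∨ x = -r ∨ x = -s ∨
      x ≠ r ∧ r ≠ x ∧ x ≠ s ∧ s ≠ x ∧ x ≠ -r ∧ -r ≠ x ∧ x ≠ -s ∧ -s ≠ x ∧
      -x ≠ r ∧ r ≠ -x ∧ -x ≠ s ∧ s ≠ -x ∧
      (r < x ↔ s < x) ∧ (x < r ↔ x < s) ∧ (-s < x ↔ -r < x) ∧ (x < -s ↔ x < -r) := by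
    rcases hrs with h | ⟨h1, h2, h3, -⟩
    · omega
    · have := h3 x hx
      omega
  -- The order of s and -s is the only one that differs between the two alternatives. The number z
  -- is 1 exactly for r = -2, s = 1, and it tracks the extra terms of that case.
  obtain ⟨z, hz1, hz2, hz3⟩ : ∃ z : 𝕂, (if s < -s then (1 : 𝕂) else 0) = 1 - z ∧
      (if -s < s then (1 : 𝕂) else 0) = z ∧ (z = 0 ∨ z = 1 ∧ qWeight t (-s) = qWeight t s) := by
    rcases hrs with h | ⟨h1, h2, -, h4⟩
    · refine ⟨0, ?_⟩
      simp (disch := omega) [if_pos, if_neg]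
    · refine ⟨1, ?_⟩
      simp (disch := omega) [if_pos, if_neg, h4]
  have hz4 : z * qWeight t (-s) = z * (q * qWeight t r) := by
    rcases hz3 with h | ⟨h, h'⟩
    · simp [h]
    · rw [h', hw]
  clear hrs
  have t1 : (if a = c then f b d * (diagCoeff a b - g a * diagCoeff a d) else 0) = 0 := by
    simp only [hf, hg, diagCoeff]
    by_cases h0 : c = a
    · obtain ⟨h1, h2⟩ | ⟨h1, h2⟩ | h1 :
        b = r ∧ d = s ∨ b = -s ∧ d = -r ∨ ¬(b = r ∧ d = s ∨ b = -s ∧ d = -r) := by omega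
      on_goal 3 => simp (disch := omega) only [if_neg, ring_simps, prop_simps]
      all_goals obtain h3 | h3 | h3 | h3 | h3 := hcase a ha
      all_goals simp only [h0, h1, h2, h3, hne, hlt, ring_simps, prop_simps, zpow_simps]
      all_goals try field_simp
      all_goals try ring1
    · simp (disch := omega) only [if_neg, ring_simps, prop_simps]
  have t2 : (if b = d then f a c * (g b * diagCoeff a b - diagCoeff c b) else 0) =
      (q ^ 2 - 1) * pointMass a b c d r r s r + (q⁻¹ - q) * pointMass a b c d r s s s
        + (q⁻¹ ^ 2 - 1) * pointMass a b c d r (-r) s (-r) +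
          (q - q⁻¹) * pointMass a b c d r (-s) s (-s)
        - ((q ^ 2 - 1) * pointMass a b c d (-s) (-s) (-r) (-s) +
          (q⁻¹ - q) * pointMass a b c d (-s) (-r) (-r) (-r)
        + (q⁻¹ ^ 2 - 1) * pointMass a b c d (-s) s (-r) s +
          (q - q⁻¹) * pointMass a b c d (-s) r (-r) r) := by
    simp only [hf, hg, diagCoeff, pointMass]
    by_cases h0 : d = b
    · obtain ⟨h1, h2⟩ | ⟨h1, h2⟩ | h1 :
        a = r ∧ c = s ∨ a = -s ∧ c = -r ∨ ¬(a = r ∧ c = s ∨ a = -s ∧ c = -r) := by omega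
      on_goal 3 => simp (disch := omega) only [if_neg, ring_simps, prop_simps]
      all_goals obtain h3 | h3 | h3 | h3 | h3 := hcase b hb
      all_goals simp only [h0, h1, h2, h3, hne, hlt, ring_simps, prop_simps, zpow_simps]
      all_goals try field_simp
    · simp (disch := omega) only [if_neg, ring_simps, prop_simps]
  have t3 : (if b = c then f a d * ((if a < b then 1 else 0) - if d < b then 1 else 0) else 0) =
      pointMass a b c d r s s s - pointMass a b c d (-s) (-r) (-r) (-r)
        + z * (pointMass a b c d r (-s) (-s) s - pointMass a b c d (-s) s s (-r)) := by
    simp only [hf, hg, diagCoeff, pointMass]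
    by_cases h0 : c = b
    · obtain ⟨h1, h2⟩ | ⟨h1, h2⟩ | h1 :
        a = r ∧ d = s ∨ a = -s ∧ d = -r ∨ ¬(a = r ∧ d = s ∨ a = -s ∧ d = -r) := by omega
      on_goal 3 => simp (disch := omega) only [if_neg, ring_simps, prop_simps]
      all_goals obtain h3 | h3 | h3 | h3 | h3 := hcase b hb
      all_goals simp only [h0, h1, h2, h3, hne, hlt, ring_simps, prop_simps, zpow_simps, hz1, hz2]
      all_goals try field_simp
      all_goals try ring1
    · simp (disch := omega) only [if_neg, ring_simps, prop_simps]
  have t4 : (if a = d then g a * f b c * ((if a < b then 1 else 0) - if a < c then 1 else 0)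
      else 0) =
      q * pointMass a b c d (-s) (-s) (-r) (-s) - q * pointMass a b c d r r s r
        + z * (q⁻¹ * pointMass a b c d s (-s) (-r) s - q * pointMass a b c d (-s) r s (-s)) := by
    simp only [hf, hg, diagCoeff, pointMass]
    by_cases h0 : d = a
    · obtain ⟨h1, h2⟩ | ⟨h1, h2⟩ | h1 :
        b = r ∧ c = s ∨ b = -s ∧ c = -r ∨ ¬(b = r ∧ c = s ∨ b = -s ∧ c = -r) := by omega
      on_goal 3 => simp (disch := omega) only [if_neg, ring_simps, prop_simps]
      all_goals obtain h3 | h3 | h3 | h3 | h3 := hcase a ha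
      all_goals simp only [h0, h1, h2, h3, hne, hlt, ring_simps, prop_simps, zpow_simps, hz1, hz2]
      all_goals try field_simp
      all_goals try ring1
    · simp (disch := omega) only [if_neg, ring_simps, prop_simps]
  have t5 : (if b = -a then qWeight t a * ((qWeight t c)⁻¹ * f (-c) d) *
          ((if a < c then 1 else 0) - if a < -d then 1 else 0) else 0) =
      q⁻¹ * pointMass a b c d (-s) s (-r) s - q⁻¹ * pointMass a b c d r (-r) s (-r)
        + z * (q⁻¹ * pointMass a b c d s (-s) (-r) s - pointMass a b c d (-s) s s (-r)) := by
    simp only [hf, hg, diagCoeff, pointMass]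
    by_cases h0 : b = -a
    · obtain ⟨h1, h2⟩ | ⟨h1, h2⟩ | h1 :
        c = -r ∧ d = s ∨ c = s ∧ d = -r ∨ ¬(c = -r ∧ d = s ∨ c = s ∧ d = -r) := by omega
      on_goal 3 => simp (disch := omega) only [if_neg, ring_simps, prop_simps]
      all_goals obtain h3 | h3 | h3 | h3 | h3 := hcase a ha
      all_goals simp only [h0, h1, h2, h3, hne, hlt, ring_simps, prop_simps, zpow_simps, hz1, hz2,
        hw, hw']
      all_goals try field_simp
      all_goals first | done | ring1 | linear_combination hz4 | linear_combination -hz4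
    · simp (disch := omega) only [if_neg, ring_simps, prop_simps]
  have t6 : (if d = -c then (qWeight t c)⁻¹ * (qWeight t (-b) * f a (-b)) *
          ((if -b < c then 1 else 0) - if a < c then 1 else 0)
      else 0) =
      pointMass a b c d (-s) r (-r) r - pointMass a b c d r (-s) s (-s)
        + z * (q * pointMass a b c d (-s) r s (-s) - pointMass a b c d r (-s) (-s) s) := by
    simp only [hf, hg, diagCoeff, pointMass]
    by_cases h0 : d = -c
    · obtain ⟨h1, h2⟩ | ⟨h1, h2⟩ | h1 :
        a = r ∧ b = -s ∨ a = -s ∧ b = r ∨ ¬(a = r ∧ b = -s ∨ a = -s ∧ b = r) := by omega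
      on_goal 3 => simp (disch := omega) only [if_neg, ring_simps, prop_simps]
      all_goals obtain h3 | h3 | h3 | h3 | h3 := hcase c hc
      all_goals simp only [h0, h1, h2, h3, hne, hlt, ring_simps, prop_simps, zpow_simps, hz1, hz2,
        hw, hw']
      all_goals try field_simp
      all_goals first | done | ring1 | linear_combination hz4
    · simp (disch := omega) only [if_neg, ring_simps, prop_simps]
  -- The multiples of z cancel between the permutation sums `t3`, `t4` and the Q-sums `t5`, `t6`;
  -- what is left of these four cancels the diagonal sum `t2`.
  rw [t1, t2, t3, t4, t5, t6]
  field_simp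
  ring

-- Positivity of the labels removes every summand with a negated label, and no label lies between r
-- and r + 1. Two point masses survive and cancel.
set_option maxHeartbeats 1000000 in
theorem finiteNode_elementary {r s : ℤ} {f : ℤ → ℤ → 𝕂} {g : ℤ → 𝕂} (hrs : s = r + 1)
    (hlab : ∀ a ∈ t.labels, 1 ≤ a)
    (hf : ∀ a b, f a b = if a = r ∧ b = s then 1 else 0)
    (hg : ∀ a, g a = q ^ ((if a = r then 1 else 0) - (if a = s then 1 else 0) : ℤ)) :
    FiniteNode t f g := by
  intro a ha b hb c hc d hd
  have hq := q_ne_zero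
  have hne : r ≠ s ∧ s ≠ r := by omega
  have hlt : r < s ∧ ¬ s < r := by omega
  have hcase (x : ℤ) : x = r ∨ x = s ∨
      x ≠ r ∧ r ≠ x ∧ x ≠ s ∧ s ≠ x ∧ (r < x ↔ s < x) ∧ (x < r ↔ x < s) := by omega
  have hab : a ≠ -b ∧ a ≠ -d ∧ c ≠ -b ∧ b ≠ -a ∧ d ≠ -c ∧ b ≠ -c ∧ d ≠ -a := by
    have := hlab a ha
    have := hlab b hb
    have := hlab c hc
    have := hlab d hd
    omega
  have t1 : (if a = c then f b d * (diagCoeff a b - g a * diagCoeff a d) else 0) = 0 := by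
    simp only [hab, if_false, hf, hg, diagCoeff]
    by_cases h0 : c = a
    · obtain ⟨h1, h2⟩ | h1 :
        b = r ∧ d = s ∨ ¬(b = r ∧ d = s) := by omega
      on_goal 2 => simp (disch := omega) only [if_neg, ring_simps, prop_simps]
      all_goals obtain h3 | h3 | h3 := hcase a
      all_goals simp only [h0, h1, h2, h3, hne, hlt, ring_simps, prop_simps, zpow_simps]
      all_goals try field_simp
      all_goals try ring1
    · simp (disch := omega) only [if_neg, ring_simps, prop_simps]
  have t2 : (if b = d then f a c * (g b * diagCoeff a b - diagCoeff c b) else 0) =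
      (q ^ 2 - 1) * pointMass a b c d r r s r + (q⁻¹ - q) * pointMass a b c d r s s s := by
    simp only [hab, if_false, hf, hg, diagCoeff, pointMass]
    by_cases h0 : d = b
    · obtain ⟨h1, h2⟩ | h1 :
        a = r ∧ c = s ∨ ¬(a = r ∧ c = s) := by omega
      on_goal 2 => simp (disch := omega) only [if_neg, ring_simps, prop_simps]
      all_goals obtain h3 | h3 | h3 := hcase b
      all_goals simp only [h0, h1, h2, h3, hne, hlt, ring_simps, prop_simps, zpow_simps]
      all_goals try field_simp
    · simp (disch := omega) only [if_neg, ring_simps, prop_simps]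
  have t3 : (if b = c then f a d * ((if a < b then 1 else 0) - if d < b then 1 else 0) else 0) =
      pointMass a b c d r s s s := by
    simp only [hab, if_false, hf, hg, diagCoeff, pointMass]
    by_cases h0 : c = b
    · obtain ⟨h1, h2⟩ | h1 :
        a = r ∧ d = s ∨ ¬(a = r ∧ d = s) := by omega
      on_goal 2 => simp (disch := omega) only [if_neg, ring_simps, prop_simps]
      all_goals obtain h3 | h3 | h3 := hcase b
      all_goals simp only [h0, h1, h2, h3, hne, hlt, ring_simps, prop_simps, zpow_simps]
    · simp (disch := omega) only [if_neg, ring_simps, prop_simps]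
  have t4 : (if a = d then g a * f b c * ((if a < b then 1 else 0) - if a < c then 1 else 0)
      else 0) =
      -q * pointMass a b c d r r s r := by
    simp only [hab, if_false, hf, hg, diagCoeff, pointMass]
    by_cases h0 : d = a
    · obtain ⟨h1, h2⟩ | h1 :
        b = r ∧ c = s ∨ ¬(b = r ∧ c = s) := by omega
      on_goal 2 => simp (disch := omega) only [if_neg, ring_simps, prop_simps]
      all_goals obtain h3 | h3 | h3 := hcase a
      all_goals simp only [h0, h1, h2, h3, hne, hlt, ring_simps, prop_simps, zpow_simps]
      all_goals try field_simp
    · simp (disch := omega) only [if_neg, ring_simps, prop_simps]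
  rw [t1, t2, t3, t4, if_neg hab.2.2.2.1, if_neg hab.2.2.2.2.1]
  field_simp
  ring

-- The diagonal coefficient q³ - q⁻¹ = (q - q⁻¹)(q² + 1) is balanced jointly by a permutation entry,
-- which accounts for q², and a Q-entry, which accounts for 1. The minus sign in `hw` is the
-- symplectic one.
set_option maxHeartbeats 1000000 in
theorem finiteNode_long {f : ℤ → ℤ → 𝕂} {g : ℤ → 𝕂} (hlab : ∀ a ∈ t.labels, a ≠ 0)
    (hf : ∀ a b, f a b = if a = -1 ∧ b = 1 then 1 else 0)
    (hg : ∀ a, g a = q ^ ((if a = -1 then 2 else 0) - (if a = 1 then 2 else 0) : ℤ))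
    (hw0 : qWeight t (-1) ≠ 0) (hw : qWeight t 1 = -q ^ 2 * qWeight t (-1)) :
    FiniteNode t f g := by
  intro a ha b hb c hc d hd
  have hq := q_ne_zero
  have hcase (x : ℤ) (hx : x ∈ t.labels) : x = -1 ∨ x = 1 ∨
      x ≠ -1 ∧ -1 ≠ x ∧ x ≠ 1 ∧ 1 ≠ x ∧ -x ≠ -1 ∧ -1 ≠ -x ∧ -x ≠ 1 ∧ 1 ≠ -x ∧
      (-1 < x ↔ 1 < x) ∧ (x < -1 ↔ x < 1) := by
    have := hlab x hx
    omega
  have t1 : (if a = c then f b d * (diagCoeff a b - g a * diagCoeff a d) else 0) = 0 := by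
    simp only [hf, hg, diagCoeff]
    by_cases h0 : c = a
    · obtain ⟨h1, h2⟩ | h1 :
        b = -1 ∧ d = 1 ∨ ¬(b = -1 ∧ d = 1) := by omega
      on_goal 2 => simp (disch := omega) only [if_neg, ring_simps, prop_simps]
      all_goals obtain h3 | h3 | h3 := hcase a ha
      all_goals simp only [h0, h1, h2, h3, Int.reduceNeg, Int.reduceEq, Int.reduceLT, ring_simps,
        prop_simps, zpow_simps, zpow_ofNat, hw, zpow_sub₀ hq, Int.reduceSub, Int.reduceAdd]
      all_goals try field_simp
      all_goals try ring1
    · simp (disch := omega) only [if_neg, ring_simps, prop_simps]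
  have t2 : (if b = d then f a c * (g b * diagCoeff a b - diagCoeff c b) else 0) =
      (q ^ 3 - q⁻¹) * pointMass a b c d (-1) (-1) 1 (-1) +
        (q⁻¹ ^ 3 - q) * pointMass a b c d (-1) 1 1 1 := by
    simp only [hf, hg, diagCoeff, pointMass]
    by_cases h0 : d = b
    · obtain ⟨h1, h2⟩ | h1 :
        a = -1 ∧ c = 1 ∨ ¬(a = -1 ∧ c = 1) := by omega
      on_goal 2 => simp (disch := omega) only [if_neg, ring_simps, prop_simps]
      all_goals obtain h3 | h3 | h3 := hcase b hb
      all_goals simp only [h0, h1, h2, h3, Int.reduceNeg, Int.reduceEq, Int.reduceLT, ring_simps,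
        prop_simps, zpow_simps, zpow_ofNat, hw, zpow_sub₀ hq, Int.reduceSub, Int.reduceAdd]
      all_goals try field_simp
      all_goals try ring1
    · simp (disch := omega) only [if_neg, ring_simps, prop_simps]
  have t3 : (if b = c then f a d * ((if a < b then 1 else 0) - if d < b then 1 else 0) else 0) =
      pointMass a b c d (-1) 1 1 1 := by
    simp only [hf, hg, diagCoeff, pointMass]
    by_cases h0 : c = b
    · obtain ⟨h1, h2⟩ | h1 :
        a = -1 ∧ d = 1 ∨ ¬(a = -1 ∧ d = 1) := by omega
      on_goal 2 => simp (disch := omega) only [if_neg, ring_simps, prop_simps]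
      all_goals obtain h3 | h3 | h3 := hcase b hb
      all_goals simp only [h0, h1, h2, h3, Int.reduceNeg, Int.reduceEq, Int.reduceLT, ring_simps,
        prop_simps, zpow_simps, zpow_ofNat, hw, zpow_sub₀ hq, Int.reduceSub, Int.reduceAdd]
    · simp (disch := omega) only [if_neg, ring_simps, prop_simps]
  have t4 : (if a = d then g a * f b c * ((if a < b then 1 else 0) - if a < c then 1 else 0)
      else 0) =
      -q ^ 2 * pointMass a b c d (-1) (-1) 1 (-1) := by
    simp only [hf, hg, diagCoeff, pointMass]
    by_cases h0 : d = a
    · obtain ⟨h1, h2⟩ | h1 :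
        b = -1 ∧ c = 1 ∨ ¬(b = -1 ∧ c = 1) := by omega
      on_goal 2 => simp (disch := omega) only [if_neg, ring_simps, prop_simps]
      all_goals obtain h3 | h3 | h3 := hcase a ha
      all_goals simp only [h0, h1, h2, h3, Int.reduceNeg, Int.reduceEq, Int.reduceLT, ring_simps,
        prop_simps, zpow_simps, zpow_ofNat, hw, zpow_sub₀ hq, Int.reduceSub, Int.reduceAdd]
      all_goals try field_simp
    · simp (disch := omega) only [if_neg, ring_simps, prop_simps]
  have t5 : (if b = -a then qWeight t a * ((qWeight t c)⁻¹ * f (-c) d) *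
          ((if a < c then 1 else 0) - if a < -d then 1 else 0) else 0) =
      -q⁻¹ ^ 2 * pointMass a b c d (-1) 1 1 1 := by
    simp only [hf, hg, diagCoeff, pointMass]
    by_cases h0 : b = -a
    · obtain ⟨h1, h2⟩ | h1 :
        c = 1 ∧ d = 1 ∨ ¬(c = 1 ∧ d = 1) := by omega
      on_goal 2 => simp (disch := omega) only [if_neg, ring_simps, prop_simps]
      all_goals obtain h3 | h3 | h3 := hcase a ha
      all_goals simp only [h0, h1, h2, h3, Int.reduceNeg, Int.reduceEq, Int.reduceLT, ring_simps,
        prop_simps, zpow_simps, zpow_ofNat, hw, zpow_sub₀ hq, Int.reduceSub, Int.reduceAdd]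
      all_goals try field_simp
    · simp (disch := omega) only [if_neg, ring_simps, prop_simps]
  have t6 : (if d = -c then (qWeight t c)⁻¹ * (qWeight t (-b) * f a (-b)) *
          ((if -b < c then 1 else 0) - if a < c then 1 else 0)
      else 0) =
      -pointMass a b c d (-1) (-1) 1 (-1) := by
    simp only [hf, hg, diagCoeff, pointMass]
    by_cases h0 : d = -c
    · obtain ⟨h1, h2⟩ | h1 :
        a = -1 ∧ b = -1 ∨ ¬(a = -1 ∧ b = -1) := by omega
      on_goal 2 => simp (disch := omega) only [if_neg, ring_simps, prop_simps]
      all_goals obtain h3 | h3 | h3 := hcase c hc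
      all_goals simp only [h0, h1, h2, h3, Int.reduceNeg, Int.reduceEq, Int.reduceLT, ring_simps,
        prop_simps, zpow_simps, zpow_ofNat, hw, zpow_sub₀ hq, Int.reduceSub, Int.reduceAdd]
      all_goals try field_simp
    · simp (disch := omega) only [if_neg, ring_simps, prop_simps]
  rw [t1, t2, t3, t4, t5, t6]
  field_simp
  ring

-- The ratio of the two entries of X is minus the ratio of `qWeight` at 0 and 1. This makes the
-- permutation terms at the label 0 cancel against the Q-terms, since the diagonal sum has nothing
-- there to absorb them.
set_option maxHeartbeats 2000000 in
theorem finiteNode_short {f : ℤ → ℤ → 𝕂} {g : ℤ → 𝕂}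
    (hf : ∀ a b, f a b = if a = -1 ∧ b = 0 then 1 else if a = 0 ∧ b = 1 then -qh⁻¹ else 0)
    (hg : ∀ a, g a = q ^ ((if a = -1 then 1 else 0) - (if a = 1 then 1 else 0) : ℤ))
    (hw0 : qWeight t 0 = 1) (hw : qWeight t 1 = qh) (hw' : qWeight t (-1) = qh⁻¹) :
    FiniteNode t f g := by
  intro a ha b hb c hc d hd
  have hq := qh_ne_zero
  have hcase (x : ℤ) : x = -1 ∨ x = 0 ∨ x = 1 ∨
      x ≠ -1 ∧ -1 ≠ x ∧ x ≠ 1 ∧ 1 ≠ x ∧ x ≠ 0 ∧ 0 ≠ x ∧ -x ≠ x ∧ x ≠ -x ∧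
      -x ≠ -1 ∧ -1 ≠ -x ∧ -x ≠ 1 ∧ 1 ≠ -x ∧ -x ≠ 0 ∧ 0 ≠ -x ∧
      (-1 < x ↔ 0 < x) ∧ (1 < x ↔ 0 < x) ∧ (x < -1 ↔ x < 0) ∧ (x < 1 ↔ x < 0) := by omega
  have t1 : (if a = c then f b d * (diagCoeff a b - g a * diagCoeff a d) else 0) = 0 := by
    simp only [hf, hg, diagCoeff]
    by_cases h0 : c = a
    · obtain ⟨h1, h2⟩ | ⟨h1, h2⟩ | h1 :
        b = -1 ∧ d = 0 ∨ b = 0 ∧ d = 1 ∨ ¬(b = -1 ∧ d = 0 ∨ b = 0 ∧ d = 1) := by omega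
      on_goal 3 => simp (disch := omega) only [if_neg, ring_simps, prop_simps]
      all_goals obtain h3 | h3 | h3 | h3 := hcase a
      all_goals simp only [h0, h1, h2, h3, Int.reduceNeg, Int.reduceEq, Int.reduceLT, ring_simps,
        prop_simps, zpow_simps, hw, hw0, hw', Int.reduceSub, Int.reduceAdd, ← qh_sq]
      all_goals try field_simp
      all_goals try ring1
    · simp (disch := omega) only [if_neg, ring_simps, prop_simps]
  have t2 : (if b = d then f a c * (g b * diagCoeff a b - diagCoeff c b) else 0) =
      (q ^ 2 - 1) * pointMass a b c d (-1) (-1) 0 (-1) +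
        (q⁻¹ ^ 2 - 1) * pointMass a b c d (-1) 1 0 1
        - qh⁻¹ * ((q - q⁻¹) * pointMass a b c d 0 (-1) 1 (-1) +
          (q⁻¹ - q) * pointMass a b c d 0 1 1 1) := by
    simp only [hf, hg, diagCoeff, pointMass]
    by_cases h0 : d = b
    · obtain ⟨h1, h2⟩ | ⟨h1, h2⟩ | h1 :
        a = -1 ∧ c = 0 ∨ a = 0 ∧ c = 1 ∨ ¬(a = -1 ∧ c = 0 ∨ a = 0 ∧ c = 1) := by omega
      on_goal 3 => simp (disch := omega) only [if_neg, ring_simps, prop_simps]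
      all_goals obtain h3 | h3 | h3 | h3 := hcase b
      all_goals simp only [h0, h1, h2, h3, Int.reduceNeg, Int.reduceEq, Int.reduceLT, ring_simps,
        prop_simps, zpow_simps, hw, hw0, hw', Int.reduceSub, Int.reduceAdd, ← qh_sq]
      all_goals try field_simp
    · simp (disch := omega) only [if_neg, ring_simps, prop_simps]
  have t3 : (if b = c then f a d * ((if a < b then 1 else 0) - if d < b then 1 else 0) else 0) =
      pointMass a b c d (-1) 0 0 0 - qh⁻¹ * pointMass a b c d 0 1 1 1 := by
    simp only [hf, hg, diagCoeff, pointMass]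
    by_cases h0 : c = b
    · obtain ⟨h1, h2⟩ | ⟨h1, h2⟩ | h1 :
        a = -1 ∧ d = 0 ∨ a = 0 ∧ d = 1 ∨ ¬(a = -1 ∧ d = 0 ∨ a = 0 ∧ d = 1) := by omega
      on_goal 3 => simp (disch := omega) only [if_neg, ring_simps, prop_simps]
      all_goals obtain h3 | h3 | h3 | h3 := hcase b
      all_goals simp only [h0, h1, h2, h3, Int.reduceNeg, Int.reduceEq, Int.reduceLT, ring_simps,
        prop_simps, zpow_simps, hw, hw0, hw', Int.reduceSub, Int.reduceAdd, ← qh_sq]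
    · simp (disch := omega) only [if_neg, ring_simps, prop_simps]
  have t4 : (if a = d then g a * f b c * ((if a < b then 1 else 0) - if a < c then 1 else 0)
      else 0) =
      -q * pointMass a b c d (-1) (-1) 0 (-1) + qh⁻¹ * pointMass a b c d 0 0 1 0 := by
    simp only [hf, hg, diagCoeff, pointMass]
    by_cases h0 : d = a
    · obtain ⟨h1, h2⟩ | ⟨h1, h2⟩ | h1 :
        b = -1 ∧ c = 0 ∨ b = 0 ∧ c = 1 ∨ ¬(b = -1 ∧ c = 0 ∨ b = 0 ∧ c = 1) := by omega
      on_goal 3 => simp (disch := omega) only [if_neg, ring_simps, prop_simps]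
      all_goals obtain h3 | h3 | h3 | h3 := hcase a
      all_goals simp only [h0, h1, h2, h3, Int.reduceNeg, Int.reduceEq, Int.reduceLT, ring_simps,
        prop_simps, zpow_simps, hw, hw0, hw', Int.reduceSub, Int.reduceAdd, ← qh_sq]
      all_goals try field_simp
    · simp (disch := omega) only [if_neg, ring_simps, prop_simps]
  have t5 : (if b = -a then qWeight t a * ((qWeight t c)⁻¹ * f (-c) d) *
          ((if a < c then 1 else 0) - if a < -d then 1 else 0) else 0) =
      qh⁻¹ * pointMass a b c d 0 0 1 0 - q⁻¹ * pointMass a b c d (-1) 1 0 1 := by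
    simp only [hf, hg, diagCoeff, pointMass]
    by_cases h0 : b = -a
    · obtain ⟨h1, h2⟩ | ⟨h1, h2⟩ | h1 :
        c = 1 ∧ d = 0 ∨ c = 0 ∧ d = 1 ∨ ¬(c = 1 ∧ d = 0 ∨ c = 0 ∧ d = 1) := by omega
      on_goal 3 => simp (disch := omega) only [if_neg, ring_simps, prop_simps]
      all_goals obtain h3 | h3 | h3 | h3 := hcase a
      all_goals simp only [h0, h1, h2, h3, Int.reduceNeg, Int.reduceEq, Int.reduceLT, ring_simps,
        prop_simps, zpow_simps, hw, hw0, hw', Int.reduceSub, Int.reduceAdd, ← qh_sq]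
      all_goals try field_simp
    · simp (disch := omega) only [if_neg, ring_simps, prop_simps]
  have t6 : (if d = -c then (qWeight t c)⁻¹ * (qWeight t (-b) * f a (-b)) *
          ((if -b < c then 1 else 0) - if a < c then 1 else 0)
      else 0) =
      -pointMass a b c d (-1) 0 0 0 + qh⁻¹ * pointMass a b c d 0 (-1) 1 (-1) := by
    simp only [hf, hg, diagCoeff, pointMass]
    by_cases h0 : d = -c
    · obtain ⟨h1, h2⟩ | ⟨h1, h2⟩ | h1 :
        a = -1 ∧ b = 0 ∨ a = 0 ∧ b = -1 ∨ ¬(a = -1 ∧ b = 0 ∨ a = 0 ∧ b = -1) := by omega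
      on_goal 3 => simp (disch := omega) only [if_neg, ring_simps, prop_simps]
      all_goals obtain h3 | h3 | h3 | h3 := hcase c
      all_goals simp only [h0, h1, h2, h3, Int.reduceNeg, Int.reduceEq, Int.reduceLT, ring_simps,
        prop_simps, zpow_simps, hw, hw0, hw', Int.reduceSub, Int.reduceAdd, ← qh_sq]
      all_goals try field_simp
    · simp (disch := omega) only [if_neg, ring_simps, prop_simps]
  rw [t1, t2, t3, t4, t5, t6]
  simp only [← qh_sq]
  field_simp
  ring

end NodeVerification

/-! ### Scalar identities for the affine node. -/

section AffineVerification

set_option linter.unusedSimpArgs false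

variable {t : AffineType}

-- Since r is the greatest and s the least label, none of the strict inequalities in the
-- off-diagonal sums can hold, and each sum vanishes separately.
set_option maxHeartbeats 1000000 in
theorem affineNode_elementary {r s : ℤ} {f : ℤ → ℤ → 𝕂} {g : ℤ → 𝕂} (hrs : s < r)
    (hlab : ∀ a ∈ t.labels, 1 ≤ a ∧ s ≤ a ∧ a ≤ r)
    (hf : ∀ a b, f a b = if a = r ∧ b = s then 1 else 0)
    (hg : ∀ a, g a = q ^ ((if a = r then 1 else 0) - (if a = s then 1 else 0) : ℤ)) :
    AffineNode t f g := by
  have hq := q_ne_zero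
  have hne : r ≠ s ∧ s ≠ r := by omega
  have hlt : s < r ∧ ¬ r < s := by omega
  have hcase (x : ℤ) (hx : x ∈ t.labels) : x = r ∨ x = s ∨
      x ≠ r ∧ r ≠ x ∧ x ≠ s ∧ s ≠ x ∧ ¬ r < x ∧ ¬ x < s := by
    have := hlab x hx
    omega
  have hpos (a : ℤ) (ha : a ∈ t.labels) (b : ℤ) (hb : b ∈ t.labels) (c : ℤ) (hc : c ∈ t.labels)
      (d : ℤ) (hd : d ∈ t.labels) :
      a ≠ -b ∧ a ≠ -d ∧ c ≠ -b ∧ b ≠ -a ∧ d ≠ -c ∧ b ≠ -c ∧ d ≠ -a := by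
    have := hlab a ha
    have := hlab b hb
    have := hlab c hc
    have := hlab d hd
    omega
  constructor
  · intro a ha b hb c hc d hd
    have hab := hpos a ha b hb c hc d hd
    have t1 : (if a = c then f b d * (diagCoeff a b - g a * diagCoeff a d) else 0) = 0 := by
      simp only [hab, if_false, hf, hg, diagCoeff]
      by_cases h0 : c = a
      · obtain ⟨h1, h2⟩ | h1 :
          b = r ∧ d = s ∨ ¬(b = r ∧ d = s) := by omega
        on_goal 2 => simp (disch := omega) only [if_neg, ring_simps, prop_simps]
        all_goals obtain h3 | h3 | h3 := hcase a ha
        all_goals simp only [h0, h1, h2, h3, hne, hlt, ring_simps, prop_simps, zpow_simps]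
        all_goals try field_simp
        all_goals try ring1
      · simp (disch := omega) only [if_neg, ring_simps, prop_simps]
    have u3 : (if b = c then f a d * (if a < b then 1 else 0) else 0) = 0 := by
      simp only [hab, if_false, hf, hg, diagCoeff]
      by_cases h0 : c = b
      · obtain ⟨h1, h2⟩ | h1 :
          a = r ∧ d = s ∨ ¬(a = r ∧ d = s) := by omega
        on_goal 2 => simp (disch := omega) only [if_neg, ring_simps, prop_simps]
        all_goals obtain h3 | h3 | h3 := hcase b hb
        all_goals simp only [h0, h1, h2, h3, hne, hlt, ring_simps, prop_simps, zpow_simps]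
      · simp (disch := omega) only [if_neg, ring_simps, prop_simps]
    have u4 : (if a = d then g a * f b c * (if a < c then 1 else 0) else 0) = 0 := by
      simp only [hab, if_false, hf, hg, diagCoeff]
      by_cases h0 : d = a
      · obtain ⟨h1, h2⟩ | h1 :
          b = r ∧ c = s ∨ ¬(b = r ∧ c = s) := by omega
        on_goal 2 => simp (disch := omega) only [if_neg, ring_simps, prop_simps]
        all_goals obtain h3 | h3 | h3 := hcase a ha
        all_goals simp only [h0, h1, h2, h3, hne, hlt, ring_simps, prop_simps, zpow_simps]
      · simp (disch := omega) only [if_neg, ring_simps, prop_simps]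
    rw [t1, u3, u4, if_neg hab.2.2.2.1, if_neg hab.2.2.2.2.1]
    ring
  · intro a ha b hb c hc d hd
    have hab := hpos a ha b hb c hc d hd
    have v2 : (if b = d then f a c * (g b * (diagCoeff a b)⁻¹ - (diagCoeff c b)⁻¹) else 0) = 0 := by
      simp only [hab, if_false, hf, hg, diagCoeff]
      by_cases h0 : d = b
      · obtain ⟨h1, h2⟩ | h1 :
          a = r ∧ c = s ∨ ¬(a = r ∧ c = s) := by omega
        on_goal 2 => simp (disch := omega) only [if_neg, ring_simps, prop_simps]
        all_goals obtain h3 | h3 | h3 := hcase b hb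
        all_goals simp only [h0, h1, h2, h3, hne, hlt, ring_simps, prop_simps, zpow_simps]
        all_goals try field_simp
        all_goals try ring1
      · simp (disch := omega) only [if_neg, ring_simps, prop_simps]
    have v3 : (if a = d then g a * f b c * (if b < a then 1 else 0) else 0) = 0 := by
      simp only [hab, if_false, hf, hg, diagCoeff]
      by_cases h0 : d = a
      · obtain ⟨h1, h2⟩ | h1 :
          b = r ∧ c = s ∨ ¬(b = r ∧ c = s) := by omega
        on_goal 2 => simp (disch := omega) only [if_neg, ring_simps, prop_simps]
        all_goals obtain h3 | h3 | h3 := hcase a ha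
        all_goals simp only [h0, h1, h2, h3, hne, hlt, ring_simps, prop_simps, zpow_simps]
      · simp (disch := omega) only [if_neg, ring_simps, prop_simps]
    have v4 : (if b = c then f a d * (if b < d then 1 else 0) else 0) = 0 := by
      simp only [hab, if_false, hf, hg, diagCoeff]
      by_cases h0 : c = b
      · obtain ⟨h1, h2⟩ | h1 :
          a = r ∧ d = s ∨ ¬(a = r ∧ d = s) := by omega
        on_goal 2 => simp (disch := omega) only [if_neg, ring_simps, prop_simps]
        all_goals obtain h3 | h3 | h3 := hcase b hb
        all_goals simp only [h0, h1, h2, h3, hne, hlt, ring_simps, prop_simps, zpow_simps]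
      · simp (disch := omega) only [if_neg, ring_simps, prop_simps]
    rw [v2, v3, v4, if_neg hab.2.2.2.1, if_neg hab.2.2.2.2.1]
    ring

-- Again X joins the extreme labels, now r and -r, so all sums vanish, including those that come
-- from Q_q.
set_option maxHeartbeats 1000000 in
theorem affineNode_long {r : ℤ} {f : ℤ → ℤ → 𝕂} {g : ℤ → 𝕂} (hr : 1 ≤ r)
    (hlab : ∀ a ∈ t.labels, a ≠ 0 ∧ -r ≤ a ∧ a ≤ r)
    (hf : ∀ a b, f a b = if a = r ∧ b = -r then 1 else 0)
    (hg : ∀ a, g a = q ^ ((if a = r then 2 else 0) - (if a = -r then 2 else 0) : ℤ)) :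
    AffineNode t f g := by
  have hq := q_ne_zero
  have hne : r ≠ -r ∧ -r ≠ r := by omega
  have hlt : -r < r ∧ ¬ r < -r := by omega
  have hcase (x : ℤ) (hx : x ∈ t.labels) : x = r ∨ x = -r ∨
      x ≠ r ∧ r ≠ x ∧ x ≠ -r ∧ -r ≠ x ∧ -x ≠ r ∧ r ≠ -x ∧ -x ≠ x ∧ x ≠ -x ∧
      ¬ r < x ∧ ¬ x < -r := by
    have := hlab x hx
    omega
  constructor
  · intro a ha b hb c hc d hd
    have t1 : (if a = c then f b d * (diagCoeff a b - g a * diagCoeff a d) else 0) = 0 := by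
      simp only [hf, hg, diagCoeff]
      by_cases h0 : c = a
      · obtain ⟨h1, h2⟩ | h1 :
          b = r ∧ d = -r ∨ ¬(b = r ∧ d = -r) := by omega
        on_goal 2 => simp (disch := omega) only [if_neg, ring_simps, prop_simps]
        all_goals obtain h3 | h3 | h3 := hcase a ha
        all_goals simp only [h0, h1, h2, h3, hne, hlt, ring_simps, prop_simps, zpow_simps,
          zpow_ofNat, zpow_sub₀ hq]
        all_goals try field_simp
        all_goals try ring1
      · simp (disch := omega) only [if_neg, ring_simps, prop_simps]
    have u3 : (if b = c then f a d * (if a < b then 1 else 0) else 0) = 0 := by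
      simp only [hf, hg, diagCoeff]
      by_cases h0 : c = b
      · obtain ⟨h1, h2⟩ | h1 :
          a = r ∧ d = -r ∨ ¬(a = r ∧ d = -r) := by omega
        on_goal 2 => simp (disch := omega) only [if_neg, ring_simps, prop_simps]
        all_goals obtain h3 | h3 | h3 := hcase b hb
        all_goals simp only [h0, h1, h2, h3, hne, hlt, ring_simps, prop_simps, zpow_simps,
          zpow_ofNat, zpow_sub₀ hq]
      · simp (disch := omega) only [if_neg, ring_simps, prop_simps]
    have u4 : (if a = d then g a * f b c * (if a < c then 1 else 0) else 0) = 0 := by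
      simp only [hf, hg, diagCoeff]
      by_cases h0 : d = a
      · obtain ⟨h1, h2⟩ | h1 :
          b = r ∧ c = -r ∨ ¬(b = r ∧ c = -r) := by omega
        on_goal 2 => simp (disch := omega) only [if_neg, ring_simps, prop_simps]
        all_goals obtain h3 | h3 | h3 := hcase a ha
        all_goals simp only [h0, h1, h2, h3, hne, hlt, ring_simps, prop_simps, zpow_simps,
          zpow_ofNat, zpow_sub₀ hq]
      · simp (disch := omega) only [if_neg, ring_simps, prop_simps]
    have u5 : (if b = -a then qWeight t a * ((qWeight t c)⁻¹ * f (-c) d) *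
            (if a < c then 1 else 0) else 0) = 0 := by
      simp only [hf, hg, diagCoeff]
      by_cases h0 : b = -a
      · obtain ⟨h1, h2⟩ | h1 :
          c = -r ∧ d = -r ∨ ¬(c = -r ∧ d = -r) := by omega
        on_goal 2 => simp (disch := omega) only [if_neg, ring_simps, prop_simps]
        all_goals obtain h3 | h3 | h3 := hcase a ha
        all_goals simp only [h0, h1, h2, h3, hne, hlt, ring_simps, prop_simps, zpow_simps,
          zpow_ofNat, zpow_sub₀ hq]
      · simp (disch := omega) only [if_neg, ring_simps, prop_simps]
    have u6 : (if d = -c then (qWeight t c)⁻¹ * (g a * (qWeight t a * f b (-a))) *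
            (if a < c then 1 else 0) else 0) = 0 := by
      simp only [hf, hg, diagCoeff]
      by_cases h0 : d = -c
      · obtain ⟨h1, h2⟩ | h1 :
          a = r ∧ b = r ∨ ¬(a = r ∧ b = r) := by omega
        on_goal 2 => simp (disch := omega) only [if_neg, ring_simps, prop_simps]
        all_goals obtain h3 | h3 | h3 := hcase c hc
        all_goals simp only [h0, h1, h2, h3, hne, hlt, ring_simps, prop_simps, zpow_simps,
          zpow_ofNat, zpow_sub₀ hq]
      · simp (disch := omega) only [if_neg, ring_simps, prop_simps]
    rw [t1, u3, u4, u5, u6]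
    ring
  · intro a ha b hb c hc d hd
    have v2 : (if b = d then f a c * (g b * (diagCoeff a b)⁻¹ - (diagCoeff c b)⁻¹) else 0) = 0 := by
      simp only [hf, hg, diagCoeff]
      by_cases h0 : d = b
      · obtain ⟨h1, h2⟩ | h1 :
          a = r ∧ c = -r ∨ ¬(a = r ∧ c = -r) := by omega
        on_goal 2 => simp (disch := omega) only [if_neg, ring_simps, prop_simps]
        all_goals obtain h3 | h3 | h3 := hcase b hb
        all_goals simp only [h0, h1, h2, h3, hne, hlt, ring_simps, prop_simps, zpow_simps,
          zpow_ofNat, zpow_sub₀ hq]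
        all_goals try field_simp
        all_goals try ring1
      · simp (disch := omega) only [if_neg, ring_simps, prop_simps]
    have v3 : (if a = d then g a * f b c * (if b < a then 1 else 0) else 0) = 0 := by
      simp only [hf, hg, diagCoeff]
      by_cases h0 : d = a
      · obtain ⟨h1, h2⟩ | h1 :
          b = r ∧ c = -r ∨ ¬(b = r ∧ c = -r) := by omega
        on_goal 2 => simp (disch := omega) only [if_neg, ring_simps, prop_simps]
        all_goals obtain h3 | h3 | h3 := hcase a ha
        all_goals simp only [h0, h1, h2, h3, hne, hlt, ring_simps, prop_simps, zpow_simps,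
          zpow_ofNat, zpow_sub₀ hq]
      · simp (disch := omega) only [if_neg, ring_simps, prop_simps]
    have v4 : (if b = c then f a d * (if b < d then 1 else 0) else 0) = 0 := by
      simp only [hf, hg, diagCoeff]
      by_cases h0 : c = b
      · obtain ⟨h1, h2⟩ | h1 :
          a = r ∧ d = -r ∨ ¬(a = r ∧ d = -r) := by omega
        on_goal 2 => simp (disch := omega) only [if_neg, ring_simps, prop_simps]
        all_goals obtain h3 | h3 | h3 := hcase b hb
        all_goals simp only [h0, h1, h2, h3, hne, hlt, ring_simps, prop_simps, zpow_simps,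
          zpow_ofNat, zpow_sub₀ hq]
      · simp (disch := omega) only [if_neg, ring_simps, prop_simps]
    have v5 : (if b = -a then qWeight t a * (g d * ((qWeight t (-d))⁻¹ * f (-d) c)) *
            (if -d < a then 1 else 0) else 0) = 0 := by
      simp only [hf, hg, diagCoeff]
      by_cases h0 : b = -a
      · obtain ⟨h1, h2⟩ | h1 :
          c = -r ∧ d = -r ∨ ¬(c = -r ∧ d = -r) := by omega
        on_goal 2 => simp (disch := omega) only [if_neg, ring_simps, prop_simps]
        all_goals obtain h3 | h3 | h3 := hcase a ha
        all_goals simp only [h0, h1, h2, h3, hne, hlt, ring_simps, prop_simps, zpow_simps,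
          zpow_ofNat, zpow_sub₀ hq]
      · simp (disch := omega) only [if_neg, ring_simps, prop_simps]
    have v6 : (if d = -c then (qWeight t c)⁻¹ * (qWeight t (-b) * f a (-b)) *
            (if c < -b then 1 else 0) else 0) = 0 := by
      simp only [hf, hg, diagCoeff]
      by_cases h0 : d = -c
      · obtain ⟨h1, h2⟩ | h1 :
          a = r ∧ b = r ∨ ¬(a = r ∧ b = r) := by omega
        on_goal 2 => simp (disch := omega) only [if_neg, ring_simps, prop_simps]
        all_goals obtain h3 | h3 | h3 := hcase c hc
        all_goals simp only [h0, h1, h2, h3, hne, hlt, ring_simps, prop_simps, zpow_simps,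
          zpow_ofNat, zpow_sub₀ hq]
      · simp (disch := omega) only [if_neg, ring_simps, prop_simps]
    rw [v2, v3, v4, v5, v6]
    ring

-- Only -s and s are extreme labels, so some inequalities do hold. Every off-diagonal sum is then
-- supported at one position, and permutation sums cancel Q-sums in pairs: `u3` with `u6`, `u4` with
-- `u5`, `v3` with `v6`, `v4` with `v5`.
set_option maxHeartbeats 2000000 in
theorem affineNode_pair {r s : ℤ} {f : ℤ → ℤ → 𝕂} {g : ℤ → 𝕂} (hr : 1 ≤ r) (hs : s = -(r + 1))
    (hlab : ∀ a ∈ t.labels, s ≤ a ∧ a ≤ -s)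
    (hf : ∀ a b, f a b = if a = r ∧ b = s then 1 else if a = -s ∧ b = -r then -1 else 0)
    (hg : ∀ a, g a = q ^ ((if a = r then 1 else 0) - (if a = -r then 1 else 0)
      - ((if a = s then 1 else 0) - (if a = -s then 1 else 0)) : ℤ))
    (hw0 : qWeight t r ≠ 0) (hw0' : qWeight t s ≠ 0)
    (hw : qWeight t (-s) = q * qWeight t r) (hw' : qWeight t (-r) = q * qWeight t s) :
    AffineNode t f g := by
  have hq := q_ne_zero
  have hne : r ≠ s ∧ s ≠ r ∧ r ≠ -s ∧ -s ≠ r ∧ r ≠ -r ∧ -r ≠ r ∧ s ≠ -r ∧ -r ≠ s ∧ s ≠ -s ∧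
      -s ≠ s := by omega
  have hlt : s < r ∧ ¬ r < s ∧ r < -s ∧ ¬ -s < r ∧ -r < r ∧ ¬ r < -r ∧ s < -r ∧ ¬ -r < s ∧
      -r < -s ∧ ¬ -s < -r ∧ s < -s ∧ ¬ -s < s := by omega
  have hcase (x : ℤ) (hx : x ∈ t.labels) : x = r ∨ x = s ∨ x = -r ∨ x = -s ∨
      x ≠ r ∧ r ≠ x ∧ x ≠ s ∧ s ≠ x ∧ x ≠ -r ∧ -r ≠ x ∧ x ≠ -s ∧ -s ≠ x ∧
      -x ≠ r ∧ r ≠ -x ∧ -x ≠ s ∧ s ≠ -x ∧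
      ¬ r < x ∧ ¬ x < s ∧ ¬ -s < x ∧ ¬ x < -r := by
    have := hlab x hx
    omega
  clear hs hr hlab
  constructor
  · intro a ha b hb c hc d hd
    have t1 : (if a = c then f b d * (diagCoeff a b - g a * diagCoeff a d) else 0) = 0 := by
      simp only [hf, hg, diagCoeff]
      by_cases h0 : c = a
      · obtain ⟨h1, h2⟩ | ⟨h1, h2⟩ | h1 :
          b = r ∧ d = s ∨ b = -s ∧ d = -r ∨ ¬(b = r ∧ d = s ∨ b = -s ∧ d = -r) := by omega
        on_goal 3 => simp (disch := omega) only [if_neg, ring_simps, prop_simps]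
        all_goals obtain h3 | h3 | h3 | h3 | h3 := hcase a ha
        all_goals simp only [h0, h1, h2, h3, hne, hlt, ring_simps, prop_simps, zpow_simps, hw, hw']
        all_goals try field_simp
        all_goals try ring1
      · simp (disch := omega) only [if_neg, ring_simps, prop_simps]
    have u3 : (if b = c then f a d * (if a < b then 1 else 0) else 0) =
        pointMass a b c d r (-s) (-s) s := by
      simp only [hf, hg, diagCoeff, pointMass]
      by_cases h0 : c = b
      · obtain ⟨h1, h2⟩ | ⟨h1, h2⟩ | h1 :
          a = r ∧ d = s ∨ a = -s ∧ d = -r ∨ ¬(a = r ∧ d = s ∨ a = -s ∧ d = -r) := by omega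
        on_goal 3 => simp (disch := omega) only [if_neg, ring_simps, prop_simps]
        all_goals obtain h3 | h3 | h3 | h3 | h3 := hcase b hb
        all_goals simp only [h0, h1, h2, h3, hne, hlt, ring_simps, prop_simps, zpow_simps, hw, hw']
      · simp (disch := omega) only [if_neg, ring_simps, prop_simps]
    have u4 : (if a = d then g a * f b c * (if a < c then 1 else 0) else 0) =
        -q⁻¹ * pointMass a b c d s (-s) (-r) s := by
      simp only [hf, hg, diagCoeff, pointMass]
      by_cases h0 : d = a
      · obtain ⟨h1, h2⟩ | ⟨h1, h2⟩ | h1 :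
          b = r ∧ c = s ∨ b = -s ∧ c = -r ∨ ¬(b = r ∧ c = s ∨ b = -s ∧ c = -r) := by omega
        on_goal 3 => simp (disch := omega) only [if_neg, ring_simps, prop_simps]
        all_goals obtain h3 | h3 | h3 | h3 | h3 := hcase a ha
        all_goals simp only [h0, h1, h2, h3, hne, hlt, ring_simps, prop_simps, zpow_simps, hw, hw']
        all_goals try field_simp
      · simp (disch := omega) only [if_neg, ring_simps, prop_simps]
    have u5 : (if b = -a then qWeight t a * ((qWeight t c)⁻¹ * f (-c) d) *
            (if a < c then 1 else 0) else 0) =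
        q⁻¹ * pointMass a b c d s (-s) (-r) s := by
      simp only [hf, hg, diagCoeff, pointMass]
      by_cases h0 : b = -a
      · obtain ⟨h1, h2⟩ | ⟨h1, h2⟩ | h1 :
          c = -r ∧ d = s ∨ c = s ∧ d = -r ∨ ¬(c = -r ∧ d = s ∨ c = s ∧ d = -r) := by omega
        on_goal 3 => simp (disch := omega) only [if_neg, ring_simps, prop_simps]
        all_goals obtain h3 | h3 | h3 | h3 | h3 := hcase a ha
        all_goals simp only [h0, h1, h2, h3, hne, hlt, ring_simps, prop_simps, zpow_simps, hw, hw']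
        all_goals try field_simp
      · simp (disch := omega) only [if_neg, ring_simps, prop_simps]
    have u6 : (if d = -c then (qWeight t c)⁻¹ * (g a * (qWeight t a * f b (-a))) *
            (if a < c then 1 else 0) else 0) =
        -1 * pointMass a b c d r (-s) (-s) s := by
      simp only [hf, hg, diagCoeff, pointMass]
      by_cases h0 : d = -c
      · obtain ⟨h1, h2⟩ | ⟨h1, h2⟩ | h1 :
          a = -s ∧ b = r ∨ a = r ∧ b = -s ∨ ¬(a = -s ∧ b = r ∨ a = r ∧ b = -s) := by omega
        on_goal 3 => simp (disch := omega) only [if_neg, ring_simps, prop_simps]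
        all_goals obtain h3 | h3 | h3 | h3 | h3 := hcase c hc
        all_goals simp only [h0, h1, h2, h3, hne, hlt, ring_simps, prop_simps, zpow_simps, hw, hw']
        all_goals try field_simp
      · simp (disch := omega) only [if_neg, ring_simps, prop_simps]
    rw [t1, u3, u4, u5, u6]
    ring
  · intro a ha b hb c hc d hd
    have v2 : (if b = d then f a c * (g b * (diagCoeff a b)⁻¹ - (diagCoeff c b)⁻¹) else 0) = 0 := by
      simp only [hf, hg, diagCoeff]
      by_cases h0 : d = b
      · obtain ⟨h1, h2⟩ | ⟨h1, h2⟩ | h1 :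
          a = r ∧ c = s ∨ a = -s ∧ c = -r ∨ ¬(a = r ∧ c = s ∨ a = -s ∧ c = -r) := by omega
        on_goal 3 => simp (disch := omega) only [if_neg, ring_simps, prop_simps]
        all_goals obtain h3 | h3 | h3 | h3 | h3 := hcase b hb
        all_goals simp only [h0, h1, h2, h3, hne, hlt, ring_simps, prop_simps, zpow_simps, hw, hw']
        all_goals try field_simp
        all_goals try ring1
      · simp (disch := omega) only [if_neg, ring_simps, prop_simps]
    have v3 : (if a = d then g a * f b c * (if b < a then 1 else 0) else 0) =
        q * pointMass a b c d (-s) r s (-s) := by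
      simp only [hf, hg, diagCoeff, pointMass]
      by_cases h0 : d = a
      · obtain ⟨h1, h2⟩ | ⟨h1, h2⟩ | h1 :
          b = r ∧ c = s ∨ b = -s ∧ c = -r ∨ ¬(b = r ∧ c = s ∨ b = -s ∧ c = -r) := by omega
        on_goal 3 => simp (disch := omega) only [if_neg, ring_simps, prop_simps]
        all_goals obtain h3 | h3 | h3 | h3 | h3 := hcase a ha
        all_goals simp only [h0, h1, h2, h3, hne, hlt, ring_simps, prop_simps, zpow_simps, hw, hw']
      · simp (disch := omega) only [if_neg, ring_simps, prop_simps]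
    have v4 : (if b = c then f a d * (if b < d then 1 else 0) else 0) =
        -1 * pointMass a b c d (-s) s s (-r) := by
      simp only [hf, hg, diagCoeff, pointMass]
      by_cases h0 : c = b
      · obtain ⟨h1, h2⟩ | ⟨h1, h2⟩ | h1 :
          a = r ∧ d = s ∨ a = -s ∧ d = -r ∨ ¬(a = r ∧ d = s ∨ a = -s ∧ d = -r) := by omega
        on_goal 3 => simp (disch := omega) only [if_neg, ring_simps, prop_simps]
        all_goals obtain h3 | h3 | h3 | h3 | h3 := hcase b hb
        all_goals simp only [h0, h1, h2, h3, hne, hlt, ring_simps, prop_simps, zpow_simps, hw, hw']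
      · simp (disch := omega) only [if_neg, ring_simps, prop_simps]
    have v5 : (if b = -a then qWeight t a * (g d * ((qWeight t (-d))⁻¹ * f (-d) c)) *
            (if -d < a then 1 else 0) else 0) =
        pointMass a b c d (-s) s s (-r) := by
      simp only [hf, hg, diagCoeff, pointMass]
      by_cases h0 : b = -a
      · obtain ⟨h1, h2⟩ | ⟨h1, h2⟩ | h1 :
          c = s ∧ d = -r ∨ c = -r ∧ d = s ∨ ¬(c = s ∧ d = -r ∨ c = -r ∧ d = s) := by omega
        on_goal 3 => simp (disch := omega) only [if_neg, ring_simps, prop_simps]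
        all_goals obtain h3 | h3 | h3 | h3 | h3 := hcase a ha
        all_goals simp only [h0, h1, h2, h3, hne, hlt, ring_simps, prop_simps, zpow_simps, hw, hw']
        all_goals try field_simp
      · simp (disch := omega) only [if_neg, ring_simps, prop_simps]
    have v6 : (if d = -c then (qWeight t c)⁻¹ * (qWeight t (-b) * f a (-b)) *
            (if c < -b then 1 else 0) else 0) =
        -q * pointMass a b c d (-s) r s (-s) := by
      simp only [hf, hg, diagCoeff, pointMass]
      by_cases h0 : d = -c
      · obtain ⟨h1, h2⟩ | ⟨h1, h2⟩ | h1 :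
          a = r ∧ b = -s ∨ a = -s ∧ b = r ∨ ¬(a = r ∧ b = -s ∨ a = -s ∧ b = r) := by omega
        on_goal 3 => simp (disch := omega) only [if_neg, ring_simps, prop_simps]
        all_goals obtain h3 | h3 | h3 | h3 | h3 := hcase c hc
        all_goals simp only [h0, h1, h2, h3, hne, hlt, ring_simps, prop_simps, zpow_simps, hw, hw']
        all_goals try field_simp
      · simp (disch := omega) only [if_neg, ring_simps, prop_simps]
    rw [v2, v3, v4, v5, v6]
    ring

-- This serves B_1, whose labels are -1, 0, 1. The same pairwise cancellation takes place, now
-- thanks to the ratio -q^{1/2} of the two entries.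
set_option maxHeartbeats 2000000 in
theorem affineNode_short {f : ℤ → ℤ → 𝕂} {g : ℤ → 𝕂} (hlab : ∀ a ∈ t.labels, -1 ≤ a ∧ a ≤ 1)
    (hf : ∀ a b, f a b = if a = 0 ∧ b = -1 then 1 else if a = 1 ∧ b = 0 then -qh else 0)
    (hg : ∀ a, g a = q ^ ((if a = 1 then 1 else 0) - (if a = -1 then 1 else 0) : ℤ))
    (hw0 : qWeight t 0 = 1) (hw : qWeight t 1 = qh) (hw' : qWeight t (-1) = qh⁻¹) :
    AffineNode t f g := by
  have hq := qh_ne_zero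
  have hcase (x : ℤ) (hx : x ∈ t.labels) : x = -1 ∨ x = 0 ∨ x = 1 := by
    have := hlab x hx
    omega
  constructor
  · intro a ha b hb c hc d hd
    have t1 : (if a = c then f b d * (diagCoeff a b - g a * diagCoeff a d) else 0) = 0 := by
      simp only [hf, hg, diagCoeff]
      by_cases h0 : c = a
      · obtain ⟨h1, h2⟩ | ⟨h1, h2⟩ | h1 :
          b = 0 ∧ d = -1 ∨ b = 1 ∧ d = 0 ∨ ¬(b = 0 ∧ d = -1 ∨ b = 1 ∧ d = 0) := by omega
        on_goal 3 => simp (disch := omega) only [if_neg, ring_simps, prop_simps]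
        all_goals obtain h3 | h3 | h3 := hcase a ha
        all_goals simp only [h0, h1, h2, h3, Int.reduceNeg, Int.reduceEq, Int.reduceLT, ring_simps,
          prop_simps, zpow_simps, hw, hw0, hw', Int.reduceSub, Int.reduceAdd, ← qh_sq]
        all_goals try field_simp
        all_goals try ring1
      · simp (disch := omega) only [if_neg, ring_simps, prop_simps]
    have u3 : (if b = c then f a d * (if a < b then 1 else 0) else 0) =
        pointMass a b c d 0 1 1 (-1) := by
      simp only [hf, hg, diagCoeff, pointMass]
      by_cases h0 : c = b
      · obtain ⟨h1, h2⟩ | ⟨h1, h2⟩ | h1 :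
          a = 0 ∧ d = -1 ∨ a = 1 ∧ d = 0 ∨ ¬(a = 0 ∧ d = -1 ∨ a = 1 ∧ d = 0) := by omega
        on_goal 3 => simp (disch := omega) only [if_neg, ring_simps, prop_simps]
        all_goals obtain h3 | h3 | h3 := hcase b hb
        all_goals simp only [h0, h1, h2, h3, Int.reduceNeg, Int.reduceEq, Int.reduceLT, ring_simps,
          prop_simps, zpow_simps, hw, hw0, hw', Int.reduceSub, Int.reduceAdd, ← qh_sq]
      · simp (disch := omega) only [if_neg, ring_simps, prop_simps]
    have u4 : (if a = d then g a * f b c * (if a < c then 1 else 0) else 0) =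
        -qh⁻¹ * pointMass a b c d (-1) 1 0 (-1) := by
      simp only [hf, hg, diagCoeff, pointMass]
      by_cases h0 : d = a
      · obtain ⟨h1, h2⟩ | ⟨h1, h2⟩ | h1 :
          b = 0 ∧ c = -1 ∨ b = 1 ∧ c = 0 ∨ ¬(b = 0 ∧ c = -1 ∨ b = 1 ∧ c = 0) := by omega
        on_goal 3 => simp (disch := omega) only [if_neg, ring_simps, prop_simps]
        all_goals obtain h3 | h3 | h3 := hcase a ha
        all_goals simp only [h0, h1, h2, h3, Int.reduceNeg, Int.reduceEq, Int.reduceLT, ring_simps,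
          prop_simps, zpow_simps, hw, hw0, hw', Int.reduceSub, Int.reduceAdd, ← qh_sq]
        all_goals try field_simp
      · simp (disch := omega) only [if_neg, ring_simps, prop_simps]
    have u5 : (if b = -a then qWeight t a * ((qWeight t c)⁻¹ * f (-c) d) *
            (if a < c then 1 else 0) else 0) =
        qh⁻¹ * pointMass a b c d (-1) 1 0 (-1) := by
      simp only [hf, hg, diagCoeff, pointMass]
      by_cases h0 : b = -a
      · obtain ⟨h1, h2⟩ | ⟨h1, h2⟩ | h1 :
          c = 0 ∧ d = -1 ∨ c = -1 ∧ d = 0 ∨ ¬(c = 0 ∧ d = -1 ∨ c = -1 ∧ d = 0) := by omega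
        on_goal 3 => simp (disch := omega) only [if_neg, ring_simps, prop_simps]
        all_goals obtain h3 | h3 | h3 := hcase a ha
        all_goals simp only [h0, h1, h2, h3, Int.reduceNeg, Int.reduceEq, Int.reduceLT, ring_simps,
          prop_simps, zpow_simps, hw, hw0, hw', Int.reduceSub, Int.reduceAdd, ← qh_sq]
        all_goals try field_simp
      · simp (disch := omega) only [if_neg, ring_simps, prop_simps]
    have u6 : (if d = -c then (qWeight t c)⁻¹ * (g a * (qWeight t a * f b (-a))) *
            (if a < c then 1 else 0) else 0) =
        -1 * pointMass a b c d 0 1 1 (-1) := by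
      simp only [hf, hg, diagCoeff, pointMass]
      by_cases h0 : d = -c
      · obtain ⟨h1, h2⟩ | ⟨h1, h2⟩ | h1 :
          a = 1 ∧ b = 0 ∨ a = 0 ∧ b = 1 ∨ ¬(a = 1 ∧ b = 0 ∨ a = 0 ∧ b = 1) := by omega
        on_goal 3 => simp (disch := omega) only [if_neg, ring_simps, prop_simps]
        all_goals obtain h3 | h3 | h3 := hcase c hc
        all_goals simp only [h0, h1, h2, h3, Int.reduceNeg, Int.reduceEq, Int.reduceLT, ring_simps,
          prop_simps, zpow_simps, hw, hw0, hw', Int.reduceSub, Int.reduceAdd, ← qh_sq]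
        all_goals try field_simp
      · simp (disch := omega) only [if_neg, ring_simps, prop_simps]
    rw [t1, u3, u4, u5, u6]
    ring
  · intro a ha b hb c hc d hd
    have v2 : (if b = d then f a c * (g b * (diagCoeff a b)⁻¹ - (diagCoeff c b)⁻¹) else 0) = 0 := by
      simp only [hf, hg, diagCoeff]
      by_cases h0 : d = b
      · obtain ⟨h1, h2⟩ | ⟨h1, h2⟩ | h1 :
          a = 0 ∧ c = -1 ∨ a = 1 ∧ c = 0 ∨ ¬(a = 0 ∧ c = -1 ∨ a = 1 ∧ c = 0) := by omega
        on_goal 3 => simp (disch := omega) only [if_neg, ring_simps, prop_simps]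
        all_goals obtain h3 | h3 | h3 := hcase b hb
        all_goals simp only [h0, h1, h2, h3, Int.reduceNeg, Int.reduceEq, Int.reduceLT, ring_simps,
          prop_simps, zpow_simps, hw, hw0, hw', Int.reduceSub, Int.reduceAdd, ← qh_sq]
        all_goals try field_simp
        all_goals try ring1
      · simp (disch := omega) only [if_neg, ring_simps, prop_simps]
    have v3 : (if a = d then g a * f b c * (if b < a then 1 else 0) else 0) =
        qh ^ 2 * pointMass a b c d 1 0 (-1) 1 := by
      simp only [hf, hg, diagCoeff, pointMass]
      by_cases h0 : d = a
      · obtain ⟨h1, h2⟩ | ⟨h1, h2⟩ | h1 :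
          b = 0 ∧ c = -1 ∨ b = 1 ∧ c = 0 ∨ ¬(b = 0 ∧ c = -1 ∨ b = 1 ∧ c = 0) := by omega
        on_goal 3 => simp (disch := omega) only [if_neg, ring_simps, prop_simps]
        all_goals obtain h3 | h3 | h3 := hcase a ha
        all_goals simp only [h0, h1, h2, h3, Int.reduceNeg, Int.reduceEq, Int.reduceLT, ring_simps,
          prop_simps, zpow_simps, hw, hw0, hw', Int.reduceSub, Int.reduceAdd, ← qh_sq]
      · simp (disch := omega) only [if_neg, ring_simps, prop_simps]
    have v4 : (if b = c then f a d * (if b < d then 1 else 0) else 0) =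
        -qh * pointMass a b c d 1 (-1) (-1) 0 := by
      simp only [hf, hg, diagCoeff, pointMass]
      by_cases h0 : c = b
      · obtain ⟨h1, h2⟩ | ⟨h1, h2⟩ | h1 :
          a = 0 ∧ d = -1 ∨ a = 1 ∧ d = 0 ∨ ¬(a = 0 ∧ d = -1 ∨ a = 1 ∧ d = 0) := by omega
        on_goal 3 => simp (disch := omega) only [if_neg, ring_simps, prop_simps]
        all_goals obtain h3 | h3 | h3 := hcase b hb
        all_goals simp only [h0, h1, h2, h3, Int.reduceNeg, Int.reduceEq, Int.reduceLT, ring_simps,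
          prop_simps, zpow_simps, hw, hw0, hw', Int.reduceSub, Int.reduceAdd, ← qh_sq]
      · simp (disch := omega) only [if_neg, ring_simps, prop_simps]
    have v5 : (if b = -a then qWeight t a * (g d * ((qWeight t (-d))⁻¹ * f (-d) c)) *
            (if -d < a then 1 else 0) else 0) =
        qh * pointMass a b c d 1 (-1) (-1) 0 := by
      simp only [hf, hg, diagCoeff, pointMass]
      by_cases h0 : b = -a
      · obtain ⟨h1, h2⟩ | ⟨h1, h2⟩ | h1 :
          c = -1 ∧ d = 0 ∨ c = 0 ∧ d = -1 ∨ ¬(c = -1 ∧ d = 0 ∨ c = 0 ∧ d = -1) := by omega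
        on_goal 3 => simp (disch := omega) only [if_neg, ring_simps, prop_simps]
        all_goals obtain h3 | h3 | h3 := hcase a ha
        all_goals simp only [h0, h1, h2, h3, Int.reduceNeg, Int.reduceEq, Int.reduceLT, ring_simps,
          prop_simps, zpow_simps, hw, hw0, hw', Int.reduceSub, Int.reduceAdd, ← qh_sq]
        all_goals try field_simp
      · simp (disch := omega) only [if_neg, ring_simps, prop_simps]
    have v6 : (if d = -c then (qWeight t c)⁻¹ * (qWeight t (-b) * f a (-b)) *
            (if c < -b then 1 else 0) else 0) =
        -qh ^ 2 * pointMass a b c d 1 0 (-1) 1 := by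
      simp only [hf, hg, diagCoeff, pointMass]
      by_cases h0 : d = -c
      · obtain ⟨h1, h2⟩ | ⟨h1, h2⟩ | h1 :
          a = 0 ∧ b = 1 ∨ a = 1 ∧ b = 0 ∨ ¬(a = 0 ∧ b = 1 ∨ a = 1 ∧ b = 0) := by omega
        on_goal 3 => simp (disch := omega) only [if_neg, ring_simps, prop_simps]
        all_goals obtain h3 | h3 | h3 := hcase c hc
        all_goals simp only [h0, h1, h2, h3, Int.reduceNeg, Int.reduceEq, Int.reduceLT, ring_simps,
          prop_simps, zpow_simps, hw, hw0, hw', Int.reduceSub, Int.reduceAdd, ← qh_sq]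
        all_goals try field_simp
      · simp (disch := omega) only [if_neg, ring_simps, prop_simps]
    rw [v2, v3, v4, v5, v6]
    ring

end AffineVerification

/-! ### Relations of all generators x_i with R_q and Q_q. -/

section Nodes

variable {t : AffineType}

/-- In type A an entry with one negated label lies outside the matrix, so every term is zero for any
factor `s`. -/
theorem killsQ_of_A (h : t.letter = .A) {s : 𝕂} {f : ℤ → ℤ → 𝕂} {g : ℤ → 𝕂}
    (hf : ∀ a b, f a b ≠ 0 → a ∈ t.labels ∧ b ∈ t.labels) : KillsQ t s f g := by
  have key (a b : ℤ) (ha : a ∈ t.labels) : f (-a) b = 0 ∧ f b (-a) = 0 := by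
    have h1 := labels_pos h ha
    constructor <;> by_contra h0 <;> have h2 := hf _ _ h0
    · have := labels_pos h h2.1
      omega
    · have := labels_pos h h2.2
      omega
  constructor
  · intro c hc d hd
    rw [(key c d hc).1, (key d c hd).1]
    ring
  · intro a ha b hb
    rw [(key a b ha).2, (key b a hb).2]
    ring

/-- Each of the two conditions is nontrivial at two positions only, and there it becomes `hw` or
`hw'`. The factor `p` is 1 at a finite node and q^{2κ} at the affine one. -/
theorem killsQ_pair {r s : ℤ} {p : 𝕂} {f : ℤ → ℤ → 𝕂} {g : ℤ → 𝕂}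
    (hne : r ≠ s ∧ r ≠ -s ∧ r ≠ -r ∧ s ≠ -s)
    (hf : ∀ a b, f a b = if a = r ∧ b = s then 1 else if a = -s ∧ b = -r then -1 else 0)
    (hg : g r = q ∧ g (-s) = q ∧ g s = q⁻¹ ∧ g (-r) = q⁻¹)
    (hw0 : qWeight t r ≠ 0 ∧ qWeight t s ≠ 0 ∧ qWeight t (-r) ≠ 0 ∧ qWeight t (-s) ≠ 0)
    (hw : p * qWeight t (-r) = q * qWeight t (-s)) (hw' : p * qWeight t s = q * qWeight t r) :
    KillsQ t p f g := by
  obtain ⟨g1, g2, g3, g4⟩ := hg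
  obtain ⟨w1, w2, w3, w4⟩ := hw0
  have hq := q_ne_zero
  constructor
  · intro c _ d _
    rw [hf, hf]
    obtain ⟨rfl, rfl⟩ | ⟨rfl, rfl⟩ | h : c = -r ∧ d = s ∨ c = s ∧ d = -r ∨
        ¬ (c = -r ∧ d = s) ∧ ¬ (c = s ∧ d = -r) := by omega
    · simp (disch := omega) only [neg_neg, and_self, if_true, if_neg, g3]
      field_simp
      linear_combination -hw
    · simp (disch := omega) only [neg_neg, and_self, if_true, if_neg, g4]
      field_simp
      linear_combination hw'
    · simp (disch := omega) only [if_neg, mul_zero, add_zero]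
  · intro a _ b _
    rw [hf, hf]
    obtain ⟨rfl, rfl⟩ | ⟨rfl, rfl⟩ | h : a = -s ∧ b = r ∨ a = r ∧ b = -s ∨
        ¬ (a = -s ∧ b = r) ∧ ¬ (a = r ∧ b = -s) := by omega
    · simp (disch := omega) only [neg_neg, and_self, if_true, if_neg, g2]
      linear_combination -hw
    · simp (disch := omega) only [neg_neg, and_self, if_true, if_neg, g1]
      linear_combination hw'
    · simp (disch := omega) only [if_neg, mul_zero, add_zero]

theorem killsQ_long {r : ℤ} {p : 𝕂} {f : ℤ → ℤ → 𝕂} {g : ℤ → 𝕂} (hr : r ≠ 0)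
    (hf : ∀ a b, f a b = if a = r ∧ b = -r then 1 else 0)
    (hg : g r = q ^ 2 ∧ g (-r) = (q ^ 2)⁻¹)
    (hw0 : qWeight t r ≠ 0 ∧ qWeight t (-r) ≠ 0)
    (hw : q ^ 2 * qWeight t r + p * qWeight t (-r) = 0) : KillsQ t p f g := by
  obtain ⟨g1, g2⟩ := hg
  obtain ⟨w1, w2⟩ := hw0
  have hq := q_ne_zero
  constructor
  · intro c _ d _
    rw [hf, hf]
    obtain ⟨rfl, rfl⟩ | h : c = -r ∧ d = -r ∨ ¬ (c = -r ∧ d = -r) := by omega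
    · simp only [neg_neg, and_self, if_true, g2]
      field_simp
      linear_combination hw
    · simp (disch := omega) only [if_neg, mul_zero, add_zero]
  · intro a _ b _
    rw [hf, hf]
    obtain ⟨rfl, rfl⟩ | h : a = r ∧ b = r ∨ ¬ (a = r ∧ b = r) := by omega
    · simp only [and_self, if_true, g1]
      linear_combination hw
    · simp (disch := omega) only [if_neg, mul_zero, add_zero]

theorem killsQ_short {f : ℤ → ℤ → 𝕂} {g : ℤ → 𝕂}
    (hf : ∀ a b, f a b = if a = -1 ∧ b = 0 then 1 else if a = 0 ∧ b = 1 then -qh⁻¹ else 0)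
    (hg : g (-1) = q ∧ g 0 = 1 ∧ g 1 = q⁻¹)
    (hw0 : qWeight t 0 = 1) (hw : qWeight t 1 = qh) (hw' : qWeight t (-1) = qh⁻¹) :
    KillsQ t 1 f g := by
  obtain ⟨g1, g2, g3⟩ := hg
  have hq := qh_ne_zero
  constructor
  · intro c _ d _
    rw [hf, hf]
    obtain ⟨rfl, rfl⟩ | ⟨rfl, rfl⟩ | h : c = 1 ∧ d = 0 ∨ c = 0 ∧ d = 1 ∨
        ¬ (c = 1 ∧ d = 0) ∧ ¬ (c = 0 ∧ d = 1) := by omega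
    · simp [g2, hw, hw0]
    · simp [g3, hw0, hw', ← qh_sq]; field_simp; ring
    · simp (disch := omega) only [if_neg, mul_zero, add_zero]
  · intro a _ b _
    rw [hf, hf]
    obtain ⟨rfl, rfl⟩ | ⟨rfl, rfl⟩ | h : a = 0 ∧ b = -1 ∨ a = -1 ∧ b = 0 ∨
        ¬ (a = 0 ∧ b = -1) ∧ ¬ (a = -1 ∧ b = 0) := by omega
    · simp [g2, hw, hw0, hq]
    · simp [g1, hw0, hw', ← qh_sq]; field_simp; ring
    · simp (disch := omega) only [if_neg, mul_zero, add_zero]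

/-- The affine node of B_1. The factor between the legs is q because 2κ = 1 there. -/
theorem killsQ_short_neg {f : ℤ → ℤ → 𝕂} {g : ℤ → 𝕂}
    (hf : ∀ a b, f a b = if a = 0 ∧ b = -1 then 1 else if a = 1 ∧ b = 0 then -qh else 0)
    (hg : g (-1) = q⁻¹ ∧ g 0 = 1 ∧ g 1 = q)
    (hw0 : qWeight t 0 = 1) (hw : qWeight t 1 = qh) (hw' : qWeight t (-1) = qh⁻¹) :
    KillsQ t q f g := by
  obtain ⟨g1, g2, g3⟩ := hg
  have hq := qh_ne_zero
  constructor
  · intro c _ d _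
    rw [hf, hf]
    obtain ⟨rfl, rfl⟩ | ⟨rfl, rfl⟩ | h : c = 0 ∧ d = -1 ∨ c = -1 ∧ d = 0 ∨
        ¬ (c = 0 ∧ d = -1) ∧ ¬ (c = -1 ∧ d = 0) := by omega
    · simp [g1, hw, hw0, q_ne_zero, hq]
    · simp [g2, hw0, hw', ← qh_sq]; field_simp; ring
    · simp (disch := omega) only [if_neg, mul_zero, add_zero]
  · intro a _ b _
    rw [hf, hf]
    obtain ⟨rfl, rfl⟩ | ⟨rfl, rfl⟩ | h : a = 1 ∧ b = 0 ∨ a = 0 ∧ b = 1 ∨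
        ¬ (a = 1 ∧ b = 0) ∧ ¬ (a = 0 ∧ b = 1) := by omega
    · simp [g3, hw, hw0]
    · simp [g2, hw0, hw', ← qh_sq]; field_simp; ring
    · simp (disch := omega) only [if_neg, mul_zero, add_zero]

variable (t) in
/-- The relations with `R_q` and `Q_q` satisfied by a generator `x_i` with `i ≠ 0`. -/
structure FiniteRelations (X D : t.Mat 𝕂) : Prop where
  Rq_mul : Rq t * ((1 : t.Mat 𝕂) ⊗ₖ X + X ⊗ₖ D) = (X ⊗ₖ (1 : t.Mat 𝕂) + D ⊗ₖ X) * Rq t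
  Qq_mul : Qq t * ((1 : t.Mat 𝕂) ⊗ₖ X + X ⊗ₖ D) = 0
  mul_Qq : (X ⊗ₖ (1 : t.Mat 𝕂) + D ⊗ₖ X) * Qq t = 0

variable (t) in
/-- The relations with `R_q` and `Q_q` satisfied by the generator `x_0`. -/
structure AffineRelations (p : 𝕂) (X D : t.Mat 𝕂) : Prop where
  Rq_mul : Rq t * ((1 : t.Mat 𝕂) ⊗ₖ X) = (D ⊗ₖ X) * Rq t
  RqOpInv_mul : RqOpInv t * (X ⊗ₖ D) = (X ⊗ₖ (1 : t.Mat 𝕂)) * RqOpInv t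
  Qq_mul : Qq t * ((1 : t.Mat 𝕂) ⊗ₖ X + p • (X ⊗ₖ D)) = 0
  mul_Qq : (D ⊗ₖ X + p • (X ⊗ₖ (1 : t.Mat 𝕂))) * Qq t = 0

/-- All the relations are linear in X, so the normalising constant `cc` of the short root generators
may be dropped. -/
theorem FiniteRelations.smul {X D : t.Mat 𝕂} (h : FiniteRelations t X D) (c : 𝕂) :
    FiniteRelations t (c • X) D := by
  constructor <;>
    simp only [Matrix.kronecker_smul, Matrix.smul_kronecker, ← smul_add, mul_smul_comm,
      smul_mul_assoc, h.Rq_mul, h.Qq_mul, h.mul_Qq, smul_zero]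

theorem AffineRelations.smul {p : 𝕂} {X D : t.Mat 𝕂} (h : AffineRelations t p X D) (c : 𝕂) :
    AffineRelations t p (c • X) D where
  Rq_mul := by
    rw [Matrix.kronecker_smul, Matrix.kronecker_smul, mul_smul_comm, smul_mul_assoc, h.Rq_mul]
  RqOpInv_mul := by
    rw [Matrix.smul_kronecker, Matrix.smul_kronecker, mul_smul_comm, smul_mul_assoc, h.RqOpInv_mul]
  Qq_mul := by
    rw [Matrix.kronecker_smul, Matrix.smul_kronecker, smul_smul, mul_comm _ c, ← smul_smul,
      ← smul_add, mul_smul_comm, h.Qq_mul, smul_zero]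
  mul_Qq := by
    rw [Matrix.kronecker_smul, Matrix.smul_kronecker, smul_smul, mul_comm _ c, ← smul_smul,
      ← smul_add, smul_mul_assoc, h.mul_Qq, smul_zero]

variable {X : t.Mat 𝕂} {f : ℤ → ℤ → 𝕂} {e : ℤ → ℤ} {m : t.Idx → ℤ}

theorem FiniteNode.relations (h : FiniteNode t f fun a => q ^ e a)
    (hQ : KillsQ t 1 f fun a => q ^ e a) (hX : HasEntries X f) (hm : ∀ a : t.Idx, m a = e a) :
    FiniteRelations t X (t.qDiag m) := by
  have hD : t.qDiag m = Matrix.diagonal fun a : t.Idx => q ^ e a := by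
    simp only [AffineType.qDiag, hm]
  have h1 := Qq_mul_eq_zero hX hQ
  have h2 := mul_Qq_eq_zero hX hQ
  rw [one_smul] at h1 h2
  rw [hD]
  exact ⟨h.Rq_mul hX hQ, h1, by rw [add_comm]; exact h2⟩

theorem AffineNode.relations {p : 𝕂} (h : AffineNode t f fun a => q ^ e a)
    (hQ : KillsQ t p f fun a => q ^ e a) (hX : HasEntries X f)
    (hm : ∀ a : t.Idx, m a = e a) : AffineRelations t p X (t.qDiag m) := by
  have hD : t.qDiag m = Matrix.diagonal fun a : t.Idx => q ^ e a := by
    simp only [AffineType.qDiag, hm]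
  have h1 := Qq_mul_eq_zero hX hQ
  have h2 := mul_Qq_eq_zero hX hQ
  rw [hD]
  exact ⟨h.Rq_mul hX, h.RqOpInv_mul hX, h1, h2⟩

theorem hasEntries_E {r s : ℤ} (hr : r ∈ t.labels) (hs : s ∈ t.labels) :
    HasEntries (t.E r s) fun a b => if a = r ∧ b = s then 1 else 0 where
  apply_eq a b := rfl
  mem_left a b h := by
    simp only [ne_eq, ite_eq_right_iff, not_forall] at h
    rwa [h.choose.1]
  mem_right a b h := by
    simp only [ne_eq, ite_eq_right_iff, not_forall] at h
    rwa [h.choose.2]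

theorem hasEntries_pair {r s r' s' : ℤ} (c : 𝕂) (hr : r ∈ t.labels) (hs : s ∈ t.labels)
    (hr' : r' ∈ t.labels) (hs' : s' ∈ t.labels) (hne : r ≠ r') :
    HasEntries (t.E r s - c • t.E r' s')
      fun a b => if a = r ∧ b = s then 1 else if a = r' ∧ b = s' then -c else 0 where
  apply_eq a b := by
    simp only [Matrix.sub_apply, Matrix.smul_apply, AffineType.E, Matrix.of_apply, smul_eq_mul]
    split_ifs with h1 h2 <;> first | omega | simp
  mem_left a b h := by
    split_ifs at h with h1 h2
    · rwa [h1.1]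
    · rwa [h2.1]
    · exact absurd rfl h
  mem_right a b h := by
    split_ifs at h with h1 h2
    · rwa [h1.2]
    · rwa [h2.2]
    · exact absurd rfl h

/-- Within labels of one sign both ϑ_i and the shift between i and ν_i are constant, so a unit step
multiplies the weight by q. Steps across 0 are computed separately. -/
theorem qWeight_succ {a b : ℤ} (hs : b.sign = a.sign) (hb : b = a + 1) :
    qWeight t b = q * qWeight t a := by
  have h1 : t.sgn b = t.sgn a := by
    unfold AffineType.sgn
    rw [hs]
  have h2 : twoNu t b = twoNu t a + 2 := by
    unfold twoNu
    rw [hs]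
    cases hl : t.letter <;> simp only [] <;> omega
  rw [qWeight, qWeight, h1, h2, zpow_add₀ qh_ne_zero, ← qh_sq]
  norm_cast
  ring

theorem q_zpow (m : ℤ) : q ^ m = qh ^ (2 * m) := by
  rw [← qh_sq, zpow_mul]; norm_cast


set_option maxHeartbeats 1000000 in
/-- The generators `x_i` acting by `E_{r,r+1} - E_{-r-1,-r}`. -/
theorem finiteRelations_pair (h : t.letter ≠ .A) {i : ℕ} {r s : ℤ} (hr : r ∈ t.labels)
    (hs : s ∈ t.labels)
    (hrs : (r ≤ -2 ∧ s = r + 1) ∨ (r = -2 ∧ s = 1 ∧ t.letter = .D))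
    (hm : ∀ a : t.Idx, t.kExp i a = (if (a : ℤ) = r then 1 else 0) - (if (a : ℤ) = -r then 1 else 0)
      - ((if (a : ℤ) = s then 1 else 0) - (if (a : ℤ) = -s then 1 else 0))) :
    FiniteRelations t (t.E r s - t.E (-s) (-r)) (t.qDiag (t.kExp i)) := by
  have hr' := neg_mem_labels h hr
  have hs' := neg_mem_labels h hs
  have hw : qWeight t s = q * qWeight t r ∧ qWeight t (-r) = q * qWeight t (-s) := by
    rcases hrs with ⟨h1, h2⟩ | ⟨rfl, rfl, hD⟩
    · by_cases hs0 : s = 0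
      · omega
      · constructor <;> refine qWeight_succ ?_ (by omega)
        · rw [Int.sign_eq_neg_one_of_neg (show s < 0 by omega),
            Int.sign_eq_neg_one_of_neg (show r < 0 by omega)]
        · rw [Int.sign_eq_one_of_pos (show 0 < -s by omega),
            Int.sign_eq_one_of_pos (show 0 < -r by omega)]
    -- In type D one has ν_{-2} = -1 and ν_{-1} = ν_1 = 0, so the step from -2 to 1 also raises ν by
    -- one.
    · rw [← zpow_one q, q_zpow]
      constructor <;>
        simp [qWeight, AffineType.sgn, twoNu, hD, zpow_neg, zpow_ofNat, qh_ne_zero]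
  have hX := hasEntries_pair (t := t) 1 hr hs hs' hr' (by omega)
  rw [one_smul] at hX
  refine FiniteNode.relations (finiteNode_pair ?_ (fun _ _ => rfl) (fun _ => rfl)
    (qWeight_ne_zero hr) (qWeight_ne_zero hs') hw.1 hw.2)
    (killsQ_pair (by omega) (fun _ _ => rfl) ?_ ⟨qWeight_ne_zero hr, qWeight_ne_zero hs,
      qWeight_ne_zero hr', qWeight_ne_zero hs'⟩ ?_ ?_) hX hm
  · rcases hrs with h1 | ⟨h1, h2, hD⟩
    · exact Or.inl h1
    · refine Or.inr ⟨h1, h2, fun a ha => ?_, ?_⟩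
      · rw [AffineType.mem_labels, hD] at ha
        exact ha.1
      · simp [h2, qWeight, AffineType.sgn, twoNu, hD]
  · refine ⟨?_, ?_, ?_, ?_⟩ <;> simp (disch := omega) [if_neg]
  · rw [one_mul, hw.2]
  · rw [one_mul, hw.1]

/-- The relations for `x_i` with `i ≠ 0`. -/
theorem xMat_finiteRelations {i : ℕ} (h0 : i ≠ 0) (hn : i ≤ t.n) :
    FiniteRelations t (t.xMat i) (t.qDiag (t.kExp i)) := by
  have hmin := t.le_n
  cases hl : t.letter <;> simp only [hl, Letter.minRank] at hmin
  · rw [AffineType.xMat_A hl, if_neg h0]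
    have hX := hasEntries_E (t := t) (r := i) (s := i + 1)
      (by rw [AffineType.mem_labels, hl]; constructor <;> omega)
      (by rw [AffineType.mem_labels, hl]; constructor <;> omega)
    refine FiniteNode.relations (finiteNode_elementary rfl (fun a => labels_pos hl)
      (fun _ _ => rfl) (fun _ => rfl)) (killsQ_of_A hl fun a b hab =>
        ⟨hX.mem_left a b hab, hX.mem_right a b hab⟩) hX fun a => ?_
    simp only [AffineType.kExp, hl, if_neg h0, Pi.sub_apply, AffineType.Ed]
  · have hA : t.letter ≠ .A := by simp [hl]
    rw [AffineType.xMat_B hl, if_neg h0]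
    split_ifs with h1
    · have hX := hasEntries_pair (t := t) qh⁻¹ (r := -1) (s := 0) (r' := 0) (s' := 1)
        (by rw [AffineType.mem_labels, hl]; constructor <;> omega)
        (by rw [AffineType.mem_labels, hl]; constructor <;> omega)
        (by rw [AffineType.mem_labels, hl]; constructor <;> omega)
        (by rw [AffineType.mem_labels, hl]; constructor <;> omega) (by omega)
      have hw0 : qWeight t 0 = 1 := by simp [qWeight, AffineType.sgn, twoNu, hl]
      have hw1 : qWeight t 1 = qh := by simp [qWeight, AffineType.sgn, twoNu, hl]
      have hw2 : qWeight t (-1) = qh⁻¹ := by simp [qWeight, AffineType.sgn, twoNu, hl]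
      refine (FiniteNode.relations (finiteNode_short (fun _ _ => rfl) (fun _ => rfl) hw0 hw1 hw2)
        (killsQ_short (fun _ _ => rfl) (by simp) hw0 hw1 hw2) hX fun a => ?_).smul cc
      simp only [AffineType.kExp, hl, if_neg h0, if_pos h1, Pi.neg_apply, Pi.sub_apply,
        AffineType.Ed, AffineType.Fd]
      omega
    · have := finiteRelations_pair hA (i := i) (r := i - t.n - 1) (s := i - t.n)
        (by rw [AffineType.mem_labels, hl]; constructor <;> omega)
        (by rw [AffineType.mem_labels, hl]; constructor <;> omega) (by omega) (fun a => by
          simp only [AffineType.kExp, hl, if_neg h0, if_neg h1, Pi.sub_apply, AffineType.Ed,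
            AffineType.Fd]
          omega)
      rwa [AffineType.E_congr (show -((i : ℤ) - t.n) = t.n - i by ring)
        (show -((i : ℤ) - t.n - 1) = t.n + 1 - i by ring)] at this
  · have hA : t.letter ≠ .A := by simp [hl]
    rw [AffineType.xMat_C hl (by omega), if_neg h0]
    split_ifs with h1
    · have hX := hasEntries_E (t := t) (r := -1) (s := 1)
        (by rw [AffineType.mem_labels, hl]; refine ⟨?_, ?_, ?_⟩ <;> omega)
        (by rw [AffineType.mem_labels, hl]; refine ⟨?_, ?_, ?_⟩ <;> omega)
      have hw1 : qWeight t 1 = q := by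
        simp [qWeight, AffineType.sgn, twoNu, hl, ← qh_sq]
      have hw2 : qWeight t (-1) = -q⁻¹ := by
        simp [qWeight, AffineType.sgn, twoNu, hl, ← qh_sq, zpow_neg]
      have hq := q_ne_zero
      refine FiniteNode.relations (finiteNode_long ?_ (fun _ _ => rfl) (fun _ => rfl)
        (by rw [hw2]; simp [hq]) (by rw [hw1, hw2]; field_simp))
        (killsQ_long (r := -1) (by omega) (fun _ _ => rfl) ?_ ?_ ?_) hX fun a => ?_
      · intro a ha
        rw [AffineType.mem_labels, hl] at ha
        exact ha.1
      · simp [zpow_ofNat, zpow_neg]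
      · simp [hw1, hw2, hq]
      · simp only [neg_neg, hw1, hw2]; field_simp; ring
      · simp only [AffineType.kExp, hl, if_neg h0, if_pos h1, Pi.smul_apply, Pi.sub_apply,
          AffineType.Ed, AffineType.Fd, smul_eq_mul]
        omega
    · have := finiteRelations_pair hA (i := i) (r := i - t.n - 1) (s := i - t.n)
        (by rw [AffineType.mem_labels, hl]; refine ⟨?_, ?_, ?_⟩ <;> omega)
        (by rw [AffineType.mem_labels, hl]; refine ⟨?_, ?_, ?_⟩ <;> omega) (by omega) (fun a => by
          simp only [AffineType.kExp, hl, if_neg h0, if_neg h1, Pi.sub_apply, AffineType.Ed,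
            AffineType.Fd]
          omega)
      rwa [AffineType.E_congr (show -((i : ℤ) - t.n) = t.n - i by ring)
        (show -((i : ℤ) - t.n - 1) = t.n + 1 - i by ring)] at this
  · have hA : t.letter ≠ .A := by simp [hl]
    rw [AffineType.xMat_D hl, if_neg h0]
    split_ifs with h1
    · have := finiteRelations_pair hA (i := i) (r := -2) (s := 1)
        (by rw [AffineType.mem_labels, hl]; refine ⟨?_, ?_, ?_⟩ <;> omega)
        (by rw [AffineType.mem_labels, hl]; refine ⟨?_, ?_, ?_⟩ <;> omega)
        (Or.inr ⟨rfl, rfl, hl⟩) (fun a => by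
          simp only [AffineType.kExp, hl, if_neg h0, if_pos h1, Pi.sub_apply, Pi.neg_apply,
            AffineType.Ed, AffineType.Fd]
          omega)
      rwa [neg_neg] at this
    · have := finiteRelations_pair hA (i := i) (r := i - t.n - 1) (s := i - t.n)
        (by rw [AffineType.mem_labels, hl]; refine ⟨?_, ?_, ?_⟩ <;> omega)
        (by rw [AffineType.mem_labels, hl]; refine ⟨?_, ?_, ?_⟩ <;> omega) (by omega) (fun a => by
          simp only [AffineType.kExp, hl, if_neg h0, if_neg h1, Pi.sub_apply, AffineType.Ed,
            AffineType.Fd]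
          omega)
      rwa [AffineType.E_congr (show -((i : ℤ) - t.n) = t.n - i by ring)
        (show -((i : ℤ) - t.n - 1) = t.n + 1 - i by ring)] at this

set_option maxHeartbeats 1000000 in
/-- The generator `x_0` acting by `E_{n-1,-n} - E_{n,1-n}`. -/
theorem affineRelations_pair (h : t.letter = .B ∧ t.n ≠ 1 ∨ t.letter = .D) :
    AffineRelations t (q ^ twoKappa t) (t.E (t.n - 1) (-t.n) - t.E t.n (1 - t.n))
      (t.qDiag (t.kExp 0)) := by
  have hA : t.letter ≠ .A := by rcases h with h | h <;> simp [h]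
  have hn : 2 ≤ t.n := by
    have := t.le_n
    rcases h with h | h <;> simp only [h, Letter.minRank] at this <;> omega
  have hr : (t.n - 1 : ℤ) ∈ t.labels := by
    rw [AffineType.mem_labels]
    rcases h with h | h <;> simp only [h] <;> omega
  have hs : (t.n : ℤ) ∈ t.labels := by
    rw [AffineType.mem_labels]
    rcases h with h | h <;> simp only [h] <;> omega
  have hr' := neg_mem_labels hA hr
  have hs' := neg_mem_labels hA hs
  have hlab : ∀ a ∈ t.labels, (-t.n : ℤ) ≤ a ∧ a ≤ t.n := by
    intro a ha
    rw [AffineType.mem_labels] at ha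
    rcases h with h | h <;> simp only [h] at ha <;> omega
  have e1 : Int.sign t.n = 1 := Int.sign_eq_one_of_pos (by omega)
  have e2 : Int.sign (t.n - 1) = 1 := Int.sign_eq_one_of_pos (by omega)
  have e3 : Int.sign (-(t.n - 1)) = -1 := Int.sign_eq_neg_one_of_neg (by omega)
  have e4 : Int.sign (-t.n) = -1 := Int.sign_eq_neg_one_of_neg (by omega)
  have hw : qWeight t t.n = q * qWeight t (t.n - 1) :=
    qWeight_succ (by rw [e1, e2]) (by ring)
  have hw' : qWeight t (-(t.n - 1)) = q * qWeight t (-t.n) :=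
    qWeight_succ (by rw [e3, e4]) (by ring)
  -- Here the value of 2κ is decisive: annihilating the vectors of Q_q requires 2κ + ν_{-n} = 1 +
  -- ν_{n-1}.
  have hp : q ^ twoKappa t * qWeight t (-t.n) = q * qWeight t (t.n - 1) := by
    rw [q_zpow, ← zpow_one q, q_zpow]
    rcases h with ⟨h, -⟩ | h <;>
      simp only [qWeight, AffineType.sgn, twoNu, twoKappa, h, Int.cast_one, one_mul, e2, e4,
        ← zpow_add₀ qh_ne_zero] <;> congr 1 <;> ring
  have hX := hasEntries_pair (t := t) 1 hr hs' hs hr' (by omega)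
  rw [one_smul] at hX
  rw [show (1 - t.n : ℤ) = -(t.n - 1) by ring]
  refine AffineNode.relations (affineNode_pair (r := t.n - 1) (s := -t.n) (by omega) (by ring)
    (by rwa [neg_neg]) (by rw [neg_neg]; exact fun _ _ => rfl) (fun _ => rfl)
    (qWeight_ne_zero hr) (qWeight_ne_zero hs') (by rwa [neg_neg]) hw')
    (killsQ_pair (r := t.n - 1) (s := -t.n) (by omega) (by rw [neg_neg]; exact fun _ _ => rfl) ?_
      ⟨qWeight_ne_zero hr, qWeight_ne_zero hs', qWeight_ne_zero hr', by
        rw [neg_neg]; exact qWeight_ne_zero hs⟩ ?_ hp) hX fun a => ?_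
  · refine ⟨?_, ?_, ?_, ?_⟩ <;> simp (disch := omega) [if_neg]
  · rw [hw', neg_neg, hw]
    linear_combination q * hp
  · rcases h with ⟨h, -⟩ | h <;>
      simp only [AffineType.kExp, h, if_true, Pi.add_apply, Pi.sub_apply, AffineType.Ed,
        AffineType.Fd] <;> omega

/-- The relations for `x_0`. -/
theorem xMat_affineRelations (t : AffineType) :
    AffineRelations t (q ^ twoKappa t) (t.xMat 0) (t.qDiag (t.kExp 0)) := by
  have hmin := t.le_n
  cases hl : t.letter <;> simp only [hl, Letter.minRank] at hmin
  · rw [AffineType.xMat_A hl, if_pos rfl]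
    have hX := hasEntries_E (t := t) (r := t.n + 1) (s := 1)
      (by rw [AffineType.mem_labels, hl]; constructor <;> omega)
      (by rw [AffineType.mem_labels, hl]; constructor <;> omega)
    refine AffineNode.relations (affineNode_elementary (r := t.n + 1) (s := 1) (by omega) ?_
      (fun _ _ => rfl) (fun _ => rfl)) (killsQ_of_A hl fun a b hab =>
        ⟨hX.mem_left a b hab, hX.mem_right a b hab⟩) hX fun a => ?_
    · intro a ha
      rw [AffineType.mem_labels, hl] at ha
      dsimp only at ha
      omega
    · simp only [AffineType.kExp, hl, if_true, Pi.sub_apply, AffineType.Ed]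
  · rw [AffineType.xMat_B hl, if_pos rfl]
    split_ifs with h1
    · have hX := hasEntries_pair (t := t) qh (r := 0) (s := -1) (r' := 1) (s' := 0)
        (by rw [AffineType.mem_labels, hl]; constructor <;> omega)
        (by rw [AffineType.mem_labels, hl]; constructor <;> omega)
        (by rw [AffineType.mem_labels, hl]; constructor <;> omega)
        (by rw [AffineType.mem_labels, hl]; constructor <;> omega) (by omega)
      have hw0 : qWeight t 0 = 1 := by simp [qWeight, AffineType.sgn, twoNu, hl]
      have hw1 : qWeight t 1 = qh := by simp [qWeight, AffineType.sgn, twoNu, hl]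
      have hw2 : qWeight t (-1) = qh⁻¹ := by simp [qWeight, AffineType.sgn, twoNu, hl]
      have hp : q ^ twoKappa t = q := by simp [twoKappa, hl, h1]
      refine (AffineNode.relations (affineNode_short ?_ (fun _ _ => rfl) (fun _ => rfl) hw0 hw1
        hw2) (by rw [hp]; exact killsQ_short_neg (fun _ _ => rfl) (by simp) hw0 hw1 hw2) hX
        fun a => ?_).smul cc
      · intro a ha
        rw [AffineType.mem_labels, hl, h1] at ha
        exact ha
      · simp only [AffineType.kExp, hl, if_true, h1, Pi.add_apply, Pi.sub_apply, AffineType.Ed,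
          AffineType.Fd]
        omega
    · exact affineRelations_pair (Or.inl ⟨hl, h1⟩)
  · rw [AffineType.xMat_C hl (by omega), if_pos rfl]
    have hr : (t.n : ℤ) ∈ t.labels := by
      rw [AffineType.mem_labels, hl]; refine ⟨?_, ?_, ?_⟩ <;> omega
    have hr' := neg_mem_labels (by simp [hl]) hr
    have hX := hasEntries_E hr hr'
    refine AffineNode.relations (affineNode_long (r := t.n) (by omega) ?_ (fun _ _ => rfl)
      (fun _ => rfl)) (killsQ_long (r := t.n) (by omega) (fun _ _ => rfl) ?_
        ⟨qWeight_ne_zero hr, qWeight_ne_zero hr'⟩ ?_) hX fun a => ?_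
    · intro a ha
      rw [AffineType.mem_labels, hl] at ha
      exact ha
    · constructor <;> simp (disch := omega) [if_neg, zpow_ofNat, zpow_neg]
    · have e1 : Int.sign t.n = 1 := Int.sign_eq_one_of_pos (by omega)
      have e4 : Int.sign (-t.n) = -1 := Int.sign_eq_neg_one_of_neg (by omega)
      -- As ν_n = n and the sign at -n is -1, the claim is q^{n+2} = q^{2κ-n}, that is 2κ = 2n + 2.
      rw [q_zpow, ← zpow_ofNat, q_zpow]
      simp only [qWeight, AffineType.sgn, twoNu, twoKappa, hl, e1, e4, Int.cast_one, one_mul,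
        Int.cast_neg, neg_mul, mul_neg, ← zpow_add₀ qh_ne_zero]
      rw [← sub_eq_add_neg, sub_eq_zero]
      congr 1
      ring
    · simp only [AffineType.kExp, hl, if_true, Pi.smul_apply, Pi.sub_apply, AffineType.Ed,
        AffineType.Fd, smul_eq_mul]
      omega
  · rw [AffineType.xMat_D hl, if_pos rfl]
    exact affineRelations_pair (Or.inr hl)

end Nodes

/-! ### Transposition and weight symmetry of the R-matrix. -/

section Symmetries

variable {t : AffineType}

theorem P_mul_apply (M : Mat2 t 𝕂) (a b : t.Idx) (y : t.Idx × t.Idx) :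
    (P t * M) (a, b) y = M (b, a) y := by
  rw [Matrix.mul_apply, Fintype.sum_eq_single (b, a)]
  · simp [P_apply]
  · rintro ⟨m, n⟩ h
    rw [P_apply, if_neg, zero_mul]
    exact fun e => h (Prod.ext (Subtype.ext e.2.symm) (Subtype.ext e.1.symm))

theorem mul_P_apply (M : Mat2 t 𝕂) (c d : t.Idx) (x : t.Idx × t.Idx) :
    (M * P t) x (c, d) = M x (d, c) := by
  rw [Matrix.mul_apply, Fintype.sum_eq_single (d, c)]
  · simp [P_apply]
  · rintro ⟨m, n⟩ h
    rw [P_apply, if_neg, mul_zero]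
    exact fun e => h (Prod.ext (Subtype.ext e.1) (Subtype.ext e.2))

theorem P_mul_P : P t * P t = 1 := by
  ext ⟨a, b⟩ ⟨c, d⟩
  rw [P_mul_apply, P_apply, Matrix.one_apply]
  dsimp only
  congr 1
  rw [Prod.mk.injEq, Subtype.ext_iff, Subtype.ext_iff]
  apply propext
  tauto

/-- The anti-automorphism `M ↦ P Mᵀ P` of the endomorphisms of `𝕂^N ⊗ 𝕂^N`. -/
noncomputable def flipTranspose (M : Mat2 t 𝕂) : Mat2 t 𝕂 := P t * M.transpose * P t

theorem flipTranspose_apply (M : Mat2 t 𝕂) (a b c d : t.Idx) :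
    flipTranspose M (a, b) (c, d) = M (d, c) (b, a) := by
  rw [flipTranspose, mul_P_apply, P_mul_apply, Matrix.transpose_apply]

theorem flipTranspose_mul (M N : Mat2 t 𝕂) :
    flipTranspose (M * N) = flipTranspose N * flipTranspose M := by
  simp only [flipTranspose, Matrix.transpose_mul]
  calc P t * (N.transpose * M.transpose) * P t
      = P t * N.transpose * 1 * M.transpose * P t := by simp only [mul_assoc, one_mul]
    _ = _ := by rw [← P_mul_P]; simp only [mul_assoc]

theorem flipTranspose_add (M N : Mat2 t 𝕂) :
    flipTranspose (M + N) = flipTranspose M + flipTranspose N := by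
  simp only [flipTranspose, Matrix.transpose_add, mul_add, add_mul]

theorem flipTranspose_sub (M N : Mat2 t 𝕂) :
    flipTranspose (M - N) = flipTranspose M - flipTranspose N := by
  simp only [flipTranspose, Matrix.transpose_sub, mul_sub, sub_mul]

theorem flipTranspose_smul (c : 𝕂) (M : Mat2 t 𝕂) :
    flipTranspose (c • M) = c • flipTranspose M := by
  simp only [flipTranspose, Matrix.transpose_smul, mul_smul_comm, smul_mul_assoc]

theorem flipTranspose_kronecker (X Y : t.Mat 𝕂) :
    flipTranspose (X ⊗ₖ Y) = Y.transpose ⊗ₖ X.transpose := by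
  ext ⟨a, b⟩ ⟨c, d⟩
  rw [flipTranspose_apply]
  simp [mul_comm]

/-- Outside type A the function ν is odd, so the powers of q cancel and the product is the sign ϑ_a
ϑ_{-a}, which is the same for all labels. The symmetry of Q_q under `flipTranspose` depends on it.
-/
theorem qWeight_mul_neg (h : t.letter ≠ .A) {a c : ℤ} (ha : a ∈ t.labels) (hc : c ∈ t.labels) :
    qWeight t a * qWeight t (-a) = qWeight t c * qWeight t (-c) := by
  have key (a : ℤ) (ha : a ∈ t.labels) : qWeight t a * qWeight t (-a) =
      ((t.sgn 1 * t.sgn (-1) : ℤ) : 𝕂) := by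
    have h1 : twoNu t (-a) = -twoNu t a := by
      unfold twoNu
      cases hl : t.letter <;> simp only [Int.sign_neg] <;> first | exact absurd hl h | ring
    have h2 : t.sgn a * t.sgn (-a) = t.sgn 1 * t.sgn (-1) := by
      unfold AffineType.sgn
      rw [AffineType.mem_labels] at ha
      cases hl : t.letter <;> simp only [hl] at ha ⊢
      rcases lt_or_gt_of_ne ha.1 with h | h
      · rw [Int.sign_eq_neg_one_of_neg h, Int.sign_eq_one_of_pos (by omega)]; rfl
      · rw [Int.sign_eq_neg_one_of_neg (show -a < 0 by omega), Int.sign_eq_one_of_pos h]; rfl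
    rw [qWeight, qWeight, h1, ← h2, zpow_neg]
    have := zpow_ne_zero (twoNu t a) qh_ne_zero
    push_cast
    field_simp
  rw [key a ha, key c hc]

theorem qWeight_ratio_neg (a b c d : t.Idx) (hb : (b : ℤ) = -a) (hd : (d : ℤ) = -c) :
    qWeight t d * (qWeight t b)⁻¹ = qWeight t a * (qWeight t c)⁻¹ := by
  have h : t.letter ≠ .A := by
    intro h
    have h1 := labels_pos h a.2
    have h2 := labels_pos h b.2
    omega
  have h1 := qWeight_mul_neg h a.2 c.2
  have h2 := qWeight_ne_zero b.2
  have h3 := qWeight_ne_zero c.2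
  rw [← hb, ← hd] at h1
  field_simp
  linear_combination -h1

theorem flipTranspose_P : flipTranspose (P t) = P t := by
  ext ⟨a, b⟩ ⟨c, d⟩
  rw [flipTranspose_apply, P_apply, P_apply]
  dsimp only
  congr 1
  apply propext
  constructor <;> intro h <;> omega

theorem flipTranspose_Qq : flipTranspose (Qq t) = Qq t := by
  ext ⟨a, b⟩ ⟨c, d⟩
  rw [flipTranspose_apply, Qq_apply, Qq_apply]
  dsimp only
  by_cases h : (b : ℤ) = -a ∧ (d : ℤ) = -c
  · rw [if_pos h, if_pos (by omega), qWeight_ratio_neg a b c d h.1 h.2]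
  · rw [if_neg h, if_neg (by omega)]

theorem diagCoeff_comm (a b : ℤ) : diagCoeff a b = diagCoeff b a := by
  simp only [diagCoeff, eq_comm (a := a) (b := b), show (a = -b ↔ b = -a) by omega]

/-- The flip preserves the order conditions: for b = -a and d = -c, the inequality d < b says a < c.
The coefficients match by `diagCoeff_comm` and `qWeight_ratio_neg`. -/
theorem flipTranspose_Rq : flipTranspose (Rq t) = Rq t := by
  ext ⟨a, b⟩ ⟨c, d⟩
  rw [flipTranspose_apply, Rq_apply, Rq_apply]
  dsimp only
  congr 1
  · by_cases h : (a : ℤ) = c ∧ (b : ℤ) = d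
    · rw [if_pos h, if_pos (by omega), diagCoeff_comm, h.1, h.2]
    · rw [if_neg h, if_neg (by omega)]
  congr 2
  · congr 1
    apply propext
    constructor <;> intro h <;> omega
  · by_cases h : (a : ℤ) < c ∧ (b : ℤ) = -a ∧ (d : ℤ) = -c
    · rw [if_pos h, if_pos (by omega), qWeight_ratio_neg a b c d h.2.1 h.2.2]
    · rw [if_neg h, if_neg (by omega)]

theorem wt_neg (h : t.letter ≠ .A) (a : ℤ) : t.wt (-a) = -t.wt a := by
  unfold AffineType.wt
  cases hl : t.letter <;> simp only [] <;> first | exact absurd hl h | skip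
  all_goals
    rcases lt_trichotomy a 0 with h1 | rfl | h1
    · simp (disch := omega) only [if_pos, if_neg, ← sub_eq_add_neg, sub_neg_eq_add]
    · simp
    · simp (disch := omega) only [if_pos, if_neg, ← sub_eq_add_neg, neg_neg]

/-- `M` preserves the weight of `𝕂^N ⊗ 𝕂^N`. -/
def PreservesWt (M : Mat2 t 𝕂) : Prop :=
  ∀ x y : t.Idx × t.Idx, M x y ≠ 0 → t.wt x.1 + t.wt x.2 = t.wt y.1 + t.wt y.2

theorem wt_add_wt_neg (a b : t.Idx) (h : (b : ℤ) = -a) : t.wt a + t.wt b = 0 := by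
  have hA : t.letter ≠ .A := by
    intro hA
    have h1 := labels_pos hA a.2
    have h2 := labels_pos hA b.2
    omega
  rw [h, wt_neg hA, add_neg_cancel]

theorem P_preservesWt : PreservesWt (P t) := by
  rintro ⟨a, b⟩ ⟨c, d⟩ h
  rw [P_apply, ne_eq, ite_eq_right_iff, not_forall] at h
  obtain ⟨⟨h1, h2⟩, -⟩ := h
  dsimp only at *
  rw [h1, h2, add_comm]

theorem Qq_preservesWt : PreservesWt (Qq t) := by
  rintro ⟨a, b⟩ ⟨c, d⟩ h
  rw [Qq_apply, ne_eq, ite_eq_right_iff, not_forall] at h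
  obtain ⟨⟨h1, h2⟩, -⟩ := h
  rw [wt_add_wt_neg a b h1, wt_add_wt_neg c d h2]

/-- Diagonal and permutation entries preserve or exchange the two labels, and the remaining entries
connect pairs (a, -a), all of total weight zero. -/
theorem Rq_preservesWt : PreservesWt (Rq t) := by
  rintro ⟨a, b⟩ ⟨c, d⟩ h
  rw [Rq_apply] at h
  dsimp only at *
  by_cases h1 : (a : ℤ) = c ∧ (b : ℤ) = d
  · rw [h1.1, h1.2]
  by_cases h2 : (a : ℤ) = d ∧ (b : ℤ) = c
  · rw [h2.1, h2.2, add_comm]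
  by_cases h3 : (b : ℤ) = -a ∧ (d : ℤ) = -c
  · rw [wt_add_wt_neg a b h3.1, wt_add_wt_neg c d h3.2]
  · rw [if_neg h1, if_neg fun e => h2 e.2, if_neg fun e => h3 e.2] at h
    exact absurd (by ring) h

theorem PreservesWt.commute {M : Mat2 t 𝕂} (hM : PreservesWt M) (i : t.I) (s : ℤ) :
    (t.qDiag (s • t.kExp i) ⊗ₖ t.qDiag (s • t.kExp i)) * M =
      M * (t.qDiag (s • t.kExp i) ⊗ₖ t.qDiag (s • t.kExp i)) := by
  ext x y
  rw [AffineType.qDiag, Matrix.diagonal_kronecker_diagonal, Matrix.diagonal_mul,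
    Matrix.mul_diagonal]
  by_cases h : M x y = 0
  · simp [h]
  · have h1 := hM x y h
    rw [← zpow_add₀ q_ne_zero, ← zpow_add₀ q_ne_zero, mul_comm]
    congr 2
    simp only [Pi.smul_apply, smul_eq_mul, ← mul_add, AffineType.kExp_eq, ← AffineType.ip_add_right,
      h1]

/-- The matrix E_{sr} has only the row s, on which the diagonal factor is q^{-k}. Keeping q^k
explicit allows the two elementary parts of a generator to be compared. -/
theorem E_transpose (m : t.Idx → ℤ) {r s : ℤ} (k : ℤ) (h : ∀ a : t.Idx, (a : ℤ) = s → m a = -k) :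
    (t.E r s).transpose = q ^ k • (t.qDiag m * t.E s r) := by
  ext a b
  simp only [AffineType.qDiag, Matrix.transpose_apply, Matrix.smul_apply, Matrix.diagonal_mul,
    AffineType.E, Matrix.of_apply, smul_eq_mul]
  by_cases e : (a : ℤ) = s ∧ (b : ℤ) = r
  · rw [if_pos e, if_pos e.symm, h a e.1, mul_one, ← zpow_add₀ q_ne_zero, add_neg_cancel, zpow_zero]
  · rw [if_neg e, if_neg fun e' => e e'.symm, mul_zero, mul_zero]

/-- The action of `x_i` is transpose to that of `k_i y_i` up to a scalar. -/
theorem xMat_transpose {i : ℕ} (hi : i < t.n + 1) : ∃ c : 𝕂, c ≠ 0 ∧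
    (t.xMat i).transpose = c • (t.qDiag (t.kExp i) * t.yMat i) := by
  have hmin := t.le_n
  have key (k : ℤ) {r s r' s' : ℤ} (h : ∀ a : t.Idx, (a : ℤ) = s → t.kExp i a = -k)
      (h' : ∀ a : t.Idx, (a : ℤ) = s' → t.kExp i a = -k) :
      (t.E r s - t.E r' s').transpose =
        q ^ k • (t.qDiag (t.kExp i) * (t.E s r - t.E s' r')) := by
    rw [Matrix.transpose_sub, E_transpose _ k h, E_transpose _ k h', ← smul_sub, mul_sub]
  cases hl : t.letter <;> simp only [hl, Letter.minRank] at hmin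
  · refine ⟨q ^ (1 : ℤ), zpow_ne_zero _ q_ne_zero, ?_⟩
    rw [AffineType.xMat_A hl, AffineType.yMat_A hl]
    split_ifs with h0 <;> refine E_transpose _ _ fun a ha => ?_ <;>
      simp only [AffineType.kExp, hl, h0, if_true, if_false, Pi.sub_apply, AffineType.Ed] <;> omega
  · rw [AffineType.xMat_B hl, AffineType.yMat_B hl]
    split_ifs with h0 h1 h1
    -- For B_1 the matrix k_0 acts by q⁻¹ on row -1 and by 1 on row 0. After multiplication by q
    -- this turns the coefficient -q^{-1/2} in y_0 into the -q^{1/2} of x_0.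
    · refine ⟨q, q_ne_zero, ?_⟩
      rw [Matrix.transpose_smul, Matrix.transpose_sub, Matrix.transpose_smul,
        E_transpose (t.kExp i) 1 fun a ha => ?_, E_transpose (t.kExp i) 0 fun a ha => ?_,
          mul_smul_comm,
        smul_comm q cc, mul_sub, mul_smul_comm, smul_sub q, smul_smul q, zpow_one, zpow_zero,
        one_smul, show q * qh⁻¹ = qh by rw [← qh_sq]; field_simp [qh_ne_zero]]
      all_goals
        simp only [AffineType.kExp, hl, h0, h1, if_true, Pi.add_apply, Pi.sub_apply,
          AffineType.Ed, AffineType.Fd]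
        omega
    · refine ⟨q ^ (1 : ℤ), zpow_ne_zero _ q_ne_zero, key 1 (fun a ha => ?_) fun a ha => ?_⟩ <;>
        simp only [AffineType.kExp, hl, h0, if_true, Pi.add_apply, Pi.sub_apply,
          AffineType.Ed, AffineType.Fd] <;> omega
    · refine ⟨1, one_ne_zero, ?_⟩
      rw [Matrix.transpose_smul, Matrix.transpose_sub, Matrix.transpose_smul,
        E_transpose (t.kExp i) 0 fun a ha => ?_, E_transpose (t.kExp i) 1 fun a ha => ?_,
          mul_smul_comm,
        mul_sub, mul_smul_comm, smul_smul, zpow_one, zpow_zero, one_smul, one_smul,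
        show qh⁻¹ * q = qh by rw [← qh_sq]; field_simp [qh_ne_zero]]
      all_goals
        simp only [AffineType.kExp, hl, if_neg h0, if_pos h1, Pi.neg_apply, Pi.sub_apply,
          AffineType.Ed, AffineType.Fd]
        omega
    · refine ⟨q ^ (1 : ℤ), zpow_ne_zero _ q_ne_zero, key 1 (fun a ha => ?_) fun a ha => ?_⟩ <;>
        simp only [AffineType.kExp, hl, h0, h1, if_false, Pi.sub_apply, AffineType.Ed,
          AffineType.Fd] <;> omega
  · rw [AffineType.xMat_C hl hi, AffineType.yMat_C hl hi]
    split_ifs with h0 h1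
    · refine ⟨q ^ (2 : ℤ), zpow_ne_zero _ q_ne_zero, E_transpose _ _ fun a ha => ?_⟩
      simp only [AffineType.kExp, hl, h0, if_true, Pi.smul_apply, Pi.sub_apply,
        AffineType.Ed, AffineType.Fd, smul_eq_mul]
      omega
    · refine ⟨q ^ (2 : ℤ), zpow_ne_zero _ q_ne_zero, E_transpose _ _ fun a ha => ?_⟩
      simp only [AffineType.kExp, hl, h0, if_pos h1, if_false, Pi.smul_apply, Pi.sub_apply,
        AffineType.Ed, AffineType.Fd, smul_eq_mul]
      omega
    · refine ⟨q ^ (1 : ℤ), zpow_ne_zero _ q_ne_zero, key 1 (fun a ha => ?_) fun a ha => ?_⟩ <;>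
        simp only [AffineType.kExp, hl, h0, h1, if_false, Pi.sub_apply, AffineType.Ed,
          AffineType.Fd] <;> omega
  · rw [AffineType.xMat_D hl, AffineType.yMat_D hl]
    refine ⟨q ^ (1 : ℤ), zpow_ne_zero _ q_ne_zero, ?_⟩
    split_ifs with h0 h1 <;> refine key 1 (fun a ha => ?_) fun a ha => ?_
    · simp only [AffineType.kExp, hl, h0, if_true, Pi.add_apply, Pi.sub_apply, AffineType.Ed,
        AffineType.Fd]
      omega
    · simp only [AffineType.kExp, hl, h0, if_true, Pi.add_apply, Pi.sub_apply, AffineType.Ed,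
        AffineType.Fd]
      omega
    all_goals
      simp only [AffineType.kExp, hl, if_neg h0, h1, if_true, if_false, Pi.neg_apply, Pi.sub_apply,
        AffineType.Ed, AffineType.Fd]
      omega

end Symmetries

/-! ### The cleared R-matrix intertwines the generators. -/

section Intertwining

variable (t : AffineType)

/-- The R-matrix `R(a/b)` with denominators cleared, a homogeneous polynomial of degree `2` in
`a` and `b`. -/
noncomputable def Rhom (S : Type) [CommRing S] [Algebra 𝕂 S] (a b : S) : Mat2 t S :=
  ((b - a) * (algebraMap 𝕂 S (q ^ twoKappa t) * b - a)) • (Rq t).map (algebraMap 𝕂 S)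
    + (algebraMap 𝕂 S (q - q⁻¹) * a) •
      ((algebraMap 𝕂 S (q ^ twoKappa t) * b - a) • (P t).map (algebraMap 𝕂 S)
        - (b - a) • (Qq t).map (algebraMap 𝕂 S))

variable {t}

theorem Rhom_self (a b : 𝕂) : Rhom t 𝕂 a b =
    ((b - a) * (q ^ twoKappa t * b - a)) • Rq t
    + ((q - q⁻¹) * a) • ((q ^ twoKappa t * b - a) • P t - (b - a) • Qq t) := by
  have h (M : Mat2 t 𝕂) : M.map (algebraMap 𝕂 𝕂) = M := by ext; rfl
  simp only [Rhom, h]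
  rfl

theorem flipTranspose_Rhom (a b : 𝕂) : flipTranspose (Rhom t 𝕂 a b) = Rhom t 𝕂 a b := by
  simp only [Rhom_self, flipTranspose_add, flipTranspose_sub, flipTranspose_smul, flipTranspose_Rq,
    flipTranspose_P, flipTranspose_Qq]

/-- Consequence of the relations of the affine node in an arbitrary algebra. -/
theorem affine_intertwining {M : Type*} [Ring M] [Algebra 𝕂 M] {A B A' B' R T Q : M} {h p : 𝕂}
    (h1 : R * A = B' * R) (h2 : (R - h • T + h • Q) * B = A' * (R - h • T + h • Q))
    (h3 : Q * (A + p • B) = 0) (h4 : (B' + p • A') * Q = 0) (h5 : T * A = A' * T)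
    (h6 : T * B = B' * T) (u v : 𝕂) :
    (((v - u) * (p * v - u)) • R + (h * u) • ((p * v - u) • T - (v - u) • Q)) * (v • A + u • B) =
      (u • A' + v • B') *
        (((v - u) * (p * v - u)) • R + (h * u) • ((p * v - u) • T - (v - u) • Q)) := by
  -- The claim is a homogeneous cubic in u and v. The hypotheses are what it says at u = 0 (`h1`), v
  -- = 0 (`h2`), u = v (implied by `h5`, `h6`) and u = p v (`h3`, `h4`). Here they are solved for
  -- the products with R and Q, which also covers values of p for which the four directions are not
  -- distinct.
  have h2' : R * B = A' * R - h • (A' * T) + h • (A' * Q) + h • (B' * T) - h • (Q * B) := by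
    simp only [add_mul, sub_mul, mul_add, mul_sub, smul_mul_assoc, mul_smul_comm, h6] at h2
    rw [← h2]; abel
  have h3' : Q * A = -(p • (Q * B)) := by
    rw [mul_add, mul_smul_comm] at h3
    exact eq_neg_of_add_eq_zero_left h3
  have h4' : B' * Q = -(p • (A' * Q)) := by
    rw [add_mul, smul_mul_assoc] at h4
    exact eq_neg_of_add_eq_zero_left h4
  simp only [add_mul, sub_mul, mul_add, mul_sub, smul_mul_assoc, mul_smul_comm, h1, h2', h3', h4',
    h5, h6]
  module

/-- No spectral parameter enters the coproduct of x_i for i ≠ 0, so every linear combination of R, T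
and Q intertwines, whatever its coefficients. -/
theorem finite_intertwining {M : Type*} [Ring M] [Algebra 𝕂 M] {A A' R T Q : M}
    (h1 : R * A = A' * R) (h2 : Q * A = 0) (h3 : A' * Q = 0) (h4 : T * A = A' * T) (x y z w : 𝕂) :
    (x • R + y • (z • T - w • Q)) * A = A' * (x • R + y • (z • T - w • Q)) := by
  simp only [add_mul, sub_mul, mul_add, mul_sub, smul_mul_assoc, mul_smul_comm, h1, h2, h3, h4]

theorem Rhom_mul_x_zero (u v : 𝕂) :
    Rhom t 𝕂 u v * (v • ((1 : t.Mat 𝕂) ⊗ₖ t.xMat 0) + u • (t.xMat 0 ⊗ₖ t.qDiag (t.kExp 0))) =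
      (u • (t.xMat 0 ⊗ₖ (1 : t.Mat 𝕂)) + v • (t.qDiag (t.kExp 0) ⊗ₖ t.xMat 0)) * Rhom t 𝕂 u v := by
  obtain ⟨h1, h2, h3, h4⟩ := xMat_affineRelations t
  rw [Rhom_self]
  exact affine_intertwining h1 h2 h3 h4 (P_mul_kronecker _ _) (P_mul_kronecker _ _) u v

theorem Rhom_mul_x {i : ℕ} (h0 : i ≠ 0) (hn : i ≤ t.n) (u v : 𝕂) :
    Rhom t 𝕂 u v * ((1 : t.Mat 𝕂) ⊗ₖ t.xMat i + t.xMat i ⊗ₖ t.qDiag (t.kExp i)) =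
      (t.xMat i ⊗ₖ (1 : t.Mat 𝕂) + t.qDiag (t.kExp i) ⊗ₖ t.xMat i) * Rhom t 𝕂 u v := by
  obtain ⟨h1, h2, h3⟩ := xMat_finiteRelations h0 hn
  rw [Rhom_self]
  refine finite_intertwining h1 h2 h3 ?_ _ _ _ _
  rw [mul_add, add_mul, P_mul_kronecker, P_mul_kronecker]

/-- The relation satisfied by the matrix `x` of `x_i` with scalings `a` and `b` in the two
legs. -/
theorem Rhom_mul_x_scaled (i : t.I) (u v : 𝕂) :
    Rhom t 𝕂 u v * ((if i = 0 then v else 1) • ((1 : t.Mat 𝕂) ⊗ₖ t.xMat i)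
        + (if i = 0 then u else 1) • (t.xMat i ⊗ₖ t.qDiag (t.kExp i))) =
      ((if i = 0 then u else 1) • (t.xMat i ⊗ₖ (1 : t.Mat 𝕂))
        + (if i = 0 then v else 1) • (t.qDiag (t.kExp i) ⊗ₖ t.xMat i)) * Rhom t 𝕂 u v := by
  by_cases h : i = 0
  · subst h
    simpa using Rhom_mul_x_zero u v
  · have h0 : (i : ℕ) ≠ 0 := fun e => h (Fin.ext e)
    simpa only [if_neg h, one_smul] using Rhom_mul_x h0 (Nat.lt_succ_iff.1 i.2) u v

theorem Rhom_comm_diag (i : t.I) (s : ℤ) (u v : 𝕂) :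
    Rhom t 𝕂 u v * (t.qDiag (s • t.kExp i) ⊗ₖ t.qDiag (s • t.kExp i)) =
      (t.qDiag (s • t.kExp i) ⊗ₖ t.qDiag (s • t.kExp i)) * Rhom t 𝕂 u v := by
  rw [Rhom_self]
  simp only [add_mul, sub_mul, mul_add, mul_sub, smul_mul_assoc, mul_smul_comm,
    P_preservesWt.commute i s, Qq_preservesWt.commute i s, Rq_preservesWt.commute i s]

theorem qDiag_mul_neg (m : t.Idx → ℤ) : t.qDiag m * t.qDiag (-m) = 1 := by
  simp only [AffineType.qDiag, Matrix.diagonal_mul_diagonal, Pi.neg_apply, ← zpow_add₀ q_ne_zero,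
    add_neg_cancel, zpow_zero, Matrix.diagonal_one]

/-- Applying `flipTranspose` to the relation for x_i gives one for k_i y_i, since the R-matrix is
fixed and x_i transposes to a multiple of k_i y_i. The factor k_i ⊗ k_i commutes with the R-matrix
and is invertible, so it can be removed. -/
theorem Rhom_mul_y_scaled (i : t.I) (u v : 𝕂) (hu : u ≠ 0) (hv : v ≠ 0) :
    Rhom t 𝕂 u v * ((if i = 0 then v⁻¹ else 1) • (t.qDiag (-t.kExp i) ⊗ₖ t.yMat i)
        + (if i = 0 then u⁻¹ else 1) • (t.yMat i ⊗ₖ (1 : t.Mat 𝕂))) =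
      ((if i = 0 then u⁻¹ else 1) • (t.yMat i ⊗ₖ t.qDiag (-t.kExp i))
        + (if i = 0 then v⁻¹ else 1) • ((1 : t.Mat 𝕂) ⊗ₖ t.yMat i)) * Rhom t 𝕂 u v := by
  obtain ⟨c, hc, hX⟩ := xMat_transpose i.2
  have hD : (t.qDiag (t.kExp i)).transpose = t.qDiag (t.kExp i) := Matrix.diagonal_transpose _
  have key := congrArg flipTranspose (Rhom_mul_x_scaled i u v)
  have hk := Rhom_comm_diag i 1 u v
  have hk' := qDiag_mul_neg (t.kExp i)
  rw [one_smul] at hk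
  simp only [flipTranspose_mul, flipTranspose_add, flipTranspose_smul, flipTranspose_kronecker,
    flipTranspose_Rhom, hX, hD, Matrix.transpose_one, Matrix.smul_kronecker, Matrix.kronecker_smul]
    at key
  set D := t.qDiag (t.kExp i)
  set D' := t.qDiag (-t.kExp i)
  set Y := t.yMat i
  have hDD : (D' ⊗ₖ D') * (D ⊗ₖ D) = 1 := by
    rw [← Matrix.mul_kronecker_mul, mul_eq_one_comm.1 hk', Matrix.one_kronecker_one]
  have e1 (x y : 𝕂) : (D ⊗ₖ D) * (x • (D' ⊗ₖ Y) + y • (Y ⊗ₖ (1 : t.Mat 𝕂))) =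
      x • ((1 : t.Mat 𝕂) ⊗ₖ (D * Y)) + y • ((D * Y) ⊗ₖ D) := by
    simp only [mul_add, mul_smul_comm, ← Matrix.mul_kronecker_mul, hk', mul_one]
  have e2 (x y : 𝕂) : (D ⊗ₖ D) * (x • (Y ⊗ₖ D') + y • ((1 : t.Mat 𝕂) ⊗ₖ Y)) =
      x • ((D * Y) ⊗ₖ (1 : t.Mat 𝕂)) + y • (D ⊗ₖ (D * Y)) := by
    simp only [mul_add, mul_smul_comm, ← Matrix.mul_kronecker_mul, hk', mul_one]
  have e3 : Rhom t 𝕂 u v * ((if i = 0 then v⁻¹ else 1) • ((1 : t.Mat 𝕂) ⊗ₖ (D * Y))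
        + (if i = 0 then u⁻¹ else 1) • ((D * Y) ⊗ₖ D)) =
      ((if i = 0 then u⁻¹ else 1) • ((D * Y) ⊗ₖ (1 : t.Mat 𝕂))
        + (if i = 0 then v⁻¹ else 1) • (D ⊗ₖ (D * Y))) * Rhom t 𝕂 u v := by
    simp only [smul_comm _ c, ← smul_add, smul_mul_assoc, mul_smul_comm] at key
    -- The flip moves the scaling v to the first leg and u to the second. At the affine node
    -- division by u v turns these into u⁻¹ and v⁻¹, as y_0 requires.
    have e4 := congrArg (fun M => (if i = 0 then (u * v)⁻¹ else 1) • M)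
      (smul_right_injective _ hc key)
    rw [← smul_mul_assoc, ← mul_smul_comm] at e4
    simp only [smul_add, smul_smul] at e4
    have f1 : (if i = 0 then (u * v)⁻¹ else 1) * (if i = 0 then u else 1) =
        if i = 0 then v⁻¹ else 1 := by
      split_ifs <;> field_simp
    have f2 : (if i = 0 then (u * v)⁻¹ else 1) * (if i = 0 then v else 1) =
        if i = 0 then u⁻¹ else 1 := by
      split_ifs <;> field_simp
    rw [f1, f2] at e4
    exact e4.symm
  have hinj (M N : Mat2 t 𝕂) (h : (D ⊗ₖ D) * M = (D ⊗ₖ D) * N) : M = N := by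
    have := congrArg (fun Z => (D' ⊗ₖ D') * Z) h
    simpa only [← mul_assoc, hDD, one_mul] using this
  apply hinj
  rw [← mul_assoc, ← hk, mul_assoc, e1, ← mul_assoc, e2, e3]

end Intertwining

/-! ### From generators to the whole quantum affine algebra. -/

section Representations

variable {t : AffineType}

/-- Homomorphisms from `U_q(ĝ)` are determined by the images of the generators. -/
theorem Uq.hom_ext {B : Type*} [Ring B] [Algebra 𝕂 B] {f g : Uq t →ₐ[𝕂] B}
    (hx : ∀ i, f (Uq.x i) = g (Uq.x i)) (hy : ∀ i, f (Uq.y i) = g (Uq.y i))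
    (hk : ∀ i, f (Uq.k i) = g (Uq.k i)) (hk' : ∀ i, f (Uq.k' i) = g (Uq.k' i)) : f = g := by
  have h : f.comp (Uq.mk t) = g.comp (Uq.mk t) := by
    apply FreeAlgebra.hom_ext
    funext a
    cases a with
    | x i => exact hx i
    | y i => exact hy i
    | k i => exact hk i
    | k' i => exact hk' i
  exact RingQuot.ringQuot_ext' 𝕂 f g h

theorem Uq.induction {p : Uq t → Prop} (hx : ∀ i, p (Uq.x i)) (hy : ∀ i, p (Uq.y i))
    (hk : ∀ i, p (Uq.k i)) (hk' : ∀ i, p (Uq.k' i)) (hc : ∀ c : 𝕂, p (algebraMap 𝕂 (Uq t) c))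
    (hadd : ∀ a b, p a → p b → p (a + b)) (hmul : ∀ a b, p a → p b → p (a * b)) (a : Uq t) :
    p a := by
  obtain ⟨w, rfl⟩ := RingQuot.mkAlgHom_surjective 𝕂 (UqRel t) a
  change p (Uq.mk t w)
  induction w using FreeAlgebra.induction with
  | grade0 c => rw [AlgHom.commutes]; exact hc c
  | grade1 g =>
    cases g with
    | x i => exact hx i
    | y i => exact hy i
    | k i => exact hk i
    | k' i => exact hk' i
  | mul a b ha hb => rw [map_mul]; exact hmul _ _ ha hb
  | add a b ha hb => rw [map_add]; exact hadd _ _ ha hb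

theorem extend_self (M : t.Mat 𝕂) : extend t 𝕂 M = M := by
  ext; rfl

theorem evalRep_x (u : 𝕂ˣ) (i : t.I) :
    evalRep t 𝕂 u (Uq.x i) = (if i = 0 then (u : 𝕂) else 1) • t.xMat i := by
  rw [evalRep, Uq.lift_x, extend_self, evalScale]
  split_ifs <;> rfl

theorem evalRep_y (u : 𝕂ˣ) (i : t.I) :
    evalRep t 𝕂 u (Uq.y i) = (if i = 0 then (u : 𝕂)⁻¹ else 1) • t.yMat i := by
  rw [evalRep, Uq.lift_y, extend_self, evalScale]
  split_ifs <;> simp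

theorem evalRep_k (u : 𝕂ˣ) (i : t.I) : evalRep t 𝕂 u (Uq.k i) = t.qDiag (t.kExp i) := by
  rw [evalRep, Uq.lift_k, extend_self]

theorem evalRep_k' (u : 𝕂ˣ) (i : t.I) : evalRep t 𝕂 u (Uq.k' i) = t.qDiag (-t.kExp i) := by
  rw [evalRep, Uq.lift_k', extend_self]

section

variable {A : Type} [CommRing A] [Algebra 𝕂 A]

theorem tensorLeft_apply (M : t.Mat A) : tensorLeft t A M = M ⊗ₖ (1 : t.Mat A) := rfl

theorem tensorRight_apply (M : t.Mat A) : tensorRight t A M = (1 : t.Mat A) ⊗ₖ M := rfl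

end

/-- The representation `T_u ⊗ T_v` of `U_q(ĝ) ⊗ U_q(ĝ)`. -/
noncomputable def tensorLift (t : AffineType) (u v : 𝕂ˣ) : Uq t ⊗[𝕂] Uq t →ₐ[𝕂] Mat2 t 𝕂 :=
  Algebra.TensorProduct.lift ((tensorLeft t 𝕂).comp (evalRep t 𝕂 u))
    ((tensorRight t 𝕂).comp (evalRep t 𝕂 v)) fun _ _ => tensor_commute t 𝕂 _ _

theorem tensorLift_tmul (u v : 𝕂ˣ) (a b : Uq t) :
    tensorLift t u v (a ⊗ₜ b) = evalRep t 𝕂 u a ⊗ₖ evalRep t 𝕂 v b := by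
  refine (Algebra.TensorProduct.lift_tmul _ _ _ a b).trans ?_
  rw [AlgHom.comp_apply, AlgHom.comp_apply, tensorLeft_apply, tensorRight_apply,
    ← Matrix.mul_kronecker_mul, mul_one, one_mul]

theorem tensorRep_apply (u v : 𝕂ˣ) (b : Uq t) :
    tensorRep t 𝕂 u v b = tensorLift t u v (Uq.comul t b) := rfl

theorem tensorRep_x (u v : 𝕂ˣ) (i : t.I) : tensorRep t 𝕂 u v (Uq.x i) =
    (if i = 0 then (u : 𝕂) else 1) • (t.xMat i ⊗ₖ (1 : t.Mat 𝕂))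
      + (if i = 0 then (v : 𝕂) else 1) • (t.qDiag (t.kExp i) ⊗ₖ t.xMat i) := by
  rw [tensorRep_apply, Uq.comul, Uq.lift_x, map_add, tensorLift_tmul, tensorLift_tmul, evalRep_x,
    evalRep_x, evalRep_k, map_one, Matrix.smul_kronecker, Matrix.kronecker_smul]

theorem tensorRep_y (u v : 𝕂ˣ) (i : t.I) : tensorRep t 𝕂 u v (Uq.y i) =
    (if i = 0 then (u : 𝕂)⁻¹ else 1) • (t.yMat i ⊗ₖ t.qDiag (-t.kExp i))
      + (if i = 0 then (v : 𝕂)⁻¹ else 1) • ((1 : t.Mat 𝕂) ⊗ₖ t.yMat i) := by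
  rw [tensorRep_apply, Uq.comul, Uq.lift_y, map_add, tensorLift_tmul, tensorLift_tmul, evalRep_y,
    evalRep_y, evalRep_k', map_one, Matrix.smul_kronecker, Matrix.kronecker_smul]

theorem tensorRep_k (u v : 𝕂ˣ) (i : t.I) :
    tensorRep t 𝕂 u v (Uq.k i) = t.qDiag (t.kExp i) ⊗ₖ t.qDiag (t.kExp i) := by
  rw [tensorRep_apply, Uq.comul, Uq.lift_k, tensorLift_tmul, evalRep_k, evalRep_k]

theorem tensorRep_k' (u v : 𝕂ˣ) (i : t.I) :
    tensorRep t 𝕂 u v (Uq.k' i) = t.qDiag (-t.kExp i) ⊗ₖ t.qDiag (-t.kExp i) := by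
  rw [tensorRep_apply, Uq.comul, Uq.lift_k', tensorLift_tmul, evalRep_k', evalRep_k']

theorem P_conj_kronecker (X Y : t.Mat 𝕂) : P t * (X ⊗ₖ Y) * P t = Y ⊗ₖ X := by
  rw [P_mul_kronecker, mul_assoc, P_mul_P, mul_one]

theorem P_conj_mul (M N : Mat2 t 𝕂) : P t * (M * N) * P t = P t * M * P t * (P t * N * P t) := by
  calc P t * (M * N) * P t = P t * M * 1 * N * P t := by simp only [mul_assoc, one_mul]
    _ = _ := by rw [← P_mul_P]; simp only [mul_assoc]

/-- The R-matrix intertwines the coproduct and its opposite in `T_u ⊗ T_v`. -/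
theorem Rhom_intertwines (u v : 𝕂ˣ) (b : Uq t) :
    Rhom t 𝕂 u v * (P t * tensorRep t 𝕂 v u b * P t) = tensorRep t 𝕂 u v b * Rhom t 𝕂 u v := by
  induction b using Uq.induction with
  | hx i =>
    rw [tensorRep_x, tensorRep_x, mul_add, add_mul, mul_smul_comm, mul_smul_comm, smul_mul_assoc,
      smul_mul_assoc, P_conj_kronecker, P_conj_kronecker]
    exact Rhom_mul_x_scaled i u v
  | hy i =>
    rw [tensorRep_y, tensorRep_y, mul_add, add_mul, mul_smul_comm, mul_smul_comm, smul_mul_assoc,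
      smul_mul_assoc, P_conj_kronecker, P_conj_kronecker]
    exact Rhom_mul_y_scaled i u v u.ne_zero v.ne_zero
  | hk i =>
    have h := Rhom_comm_diag i 1 (u : 𝕂) v
    rw [one_smul] at h
    rw [tensorRep_k, tensorRep_k, P_conj_kronecker, h]
  | hk' i =>
    have h := Rhom_comm_diag i (-1) (u : 𝕂) v
    rw [neg_smul, one_smul] at h
    rw [tensorRep_k', tensorRep_k', P_conj_kronecker, h]
  | hc c =>
    rw [AlgHom.commutes, AlgHom.commutes, Algebra.algebraMap_eq_smul_one, mul_smul_comm, mul_one,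
      smul_mul_assoc, P_mul_P, mul_smul_comm, smul_mul_assoc, mul_one, one_mul]
  | hadd a b ha hb =>
    rw [map_add, map_add, mul_add, add_mul, mul_add, add_mul, ha, hb]
  | hmul a b ha hb =>
    rw [map_mul, map_mul, P_conj_mul, ← mul_assoc, ha, mul_assoc, hb, mul_assoc]

/-- Change of the coefficient ring. -/
theorem evalRep_map {A A' : Type} [CommRing A] [Algebra 𝕂 A] [CommRing A'] [Algebra 𝕂 A']
    (f : A →ₐ[𝕂] A') (u : Aˣ) (b : Uq t) :
    evalRep t A' (Units.map f.toRingHom.toMonoidHom u) b = (evalRep t A u b).map f := by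
  have hext (M : t.Mat 𝕂) : (extend t A M).map f = extend t A' M := by
    ext i j
    exact f.commutes (M i j)
  have h : evalRep t A' (Units.map f.toRingHom.toMonoidHom u) =
      (f.mapMatrix (m := t.Idx)).comp (evalRep t A u) := by
    apply Uq.hom_ext <;> intro i <;>
      simp only [evalRep, AlgHom.comp_apply, Uq.lift_x, Uq.lift_y, Uq.lift_k, Uq.lift_k',
        AlgHom.mapMatrix_apply]
    · rw [← hext]
      ext a b
      simp only [Matrix.smul_apply, Matrix.map_apply, smul_eq_mul, map_mul, evalScale]
      split_ifs <;> simp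
    · rw [← hext]
      ext a b
      simp only [Matrix.smul_apply, Matrix.map_apply, smul_eq_mul, map_mul, evalScale]
      split_ifs <;> simp [← map_inv]
    · rw [← hext]
    · rw [← hext]
  rw [h]
  rfl

end Representations

/-! ### Intertwiners on B at fixed values of the parameters. -/

section Pointwise

variable {t : AffineType}

/-- `M` intertwines the maps `f` and `g` on `B`. -/
def IntertwinesOn (B : Subalgebra 𝕂 (Uq t)) (M : Mat2 t 𝕂) (f g : Uq t → Mat2 t 𝕂) : Prop :=
  ∀ b ∈ B, M * f b = g b * M

variable {B : Subalgebra 𝕂 (Uq t)}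

theorem IntertwinesOn.mul {M N : Mat2 t 𝕂} {f g h : Uq t → Mat2 t 𝕂} (hN : IntertwinesOn B N g h)
    (hM : IntertwinesOn B M f g) : IntertwinesOn B (N * M) f h := fun b hb => by
  rw [mul_assoc, hM b hb, ← mul_assoc, hN b hb, mul_assoc]

/-- The representation `T_u ⊗ T_v` twisted by the opposite coproduct. -/
noncomputable def opRep (t : AffineType) (u v : 𝕂ˣ) (b : Uq t) : Mat2 t 𝕂 :=
  P t * tensorRep t 𝕂 u v b * P t

theorem P_conj_P_conj (M : Mat2 t 𝕂) : P t * (P t * M * P t) * P t = M := by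
  rw [show P t * (P t * M * P t) * P t = P t * P t * M * (P t * P t) by simp only [mul_assoc],
    P_mul_P, one_mul, mul_one]

theorem IntertwinesOn.conj {M : Mat2 t 𝕂} {f g : Uq t → Mat2 t 𝕂} (h : IntertwinesOn B M f g) :
    IntertwinesOn B (P t * M * P t) (fun b => P t * f b * P t) fun b => P t * g b * P t :=
  fun b hb => by rw [← P_conj_mul, h b hb, P_conj_mul]

/-- Homogeneity: up to a scalar the matrix depends on a/b alone. Hence R at (ηu, η/v) may be written
with the arguments u v and 1, and η disappears. -/
theorem Rhom_smul (c a b : 𝕂) : Rhom t 𝕂 (c * a) (c * b) = c ^ 2 • Rhom t 𝕂 a b := by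
  simp only [Rhom_self]
  module

theorem Rhom_intertwinesOn (B : Subalgebra 𝕂 (Uq t)) {u v : 𝕂ˣ} (c : 𝕂) {x y : 𝕂} (hx : x = c * u)
    (hy : y = c * v) : IntertwinesOn B (Rhom t 𝕂 x y) (opRep t v u) (tensorRep t 𝕂 u v) := by
  intro b _
  rw [hx, hy, Rhom_smul, smul_mul_assoc, mul_smul_comm, ← Rhom_intertwines]
  rfl

/-- Conjugation by P gives R_{21}, which leads back from the coproduct to its opposite. -/
theorem Rhom_conj_intertwinesOn (B : Subalgebra 𝕂 (Uq t)) {u v : 𝕂ˣ} (c : 𝕂) {x y : 𝕂}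
    (hx : x = c * u) (hy : y = c * v) :
    IntertwinesOn B (P t * Rhom t 𝕂 x y * P t) (tensorRep t 𝕂 v u) (opRep t u v) := by
  intro b hb
  have := (Rhom_intertwinesOn B c hx hy).conj b hb
  simp only [opRep, P_conj_P_conj] at this
  exact this

/-- This is where the right coideal property enters: Δ(b) is a sum of tensors x ⊗ y with x in B, and
K intertwines the action of each x while 1 commutes with the action of y. -/
theorem kronecker_one_intertwinesOn (hB : IsRightCoideal B) {K : t.Mat 𝕂} {u u' : 𝕂ˣ}
    (hK : ∀ b ∈ B, K * evalRep t 𝕂 u b = evalRep t 𝕂 u' b * K) (v : 𝕂ˣ) :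
    IntertwinesOn B (K ⊗ₖ (1 : t.Mat 𝕂)) (tensorRep t 𝕂 u v) (tensorRep t 𝕂 u' v) := by
  intro b hb
  obtain ⟨z, hz⟩ := hB b hb
  rw [tensorRep_apply, tensorRep_apply, ← hz]
  clear hz
  change _ * tensorLift t u v (Algebra.TensorProduct.map B.val (AlgHom.id 𝕂 (Uq t)) z) =
    tensorLift t u' v (Algebra.TensorProduct.map B.val (AlgHom.id 𝕂 (Uq t)) z) * _
  induction z using TensorProduct.induction_on with
  | zero => simp only [map_zero, mul_zero, zero_mul]
  | tmul x y =>
    rw [Algebra.TensorProduct.map_tmul, tensorLift_tmul, tensorLift_tmul,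
      ← Matrix.mul_kronecker_mul, ← Matrix.mul_kronecker_mul, one_mul, mul_one, Subalgebra.coe_val,
      hK x x.2]
  | add x y hx hy => simp only [map_add, mul_add, add_mul, hx, hy]

/-- Under the opposite coproduct the B-component of Δ(b) acts on the second leg, where K now stands.
-/
theorem one_kronecker_intertwinesOn (hB : IsRightCoideal B) {K : t.Mat 𝕂} {u u' : 𝕂ˣ}
    (hK : ∀ b ∈ B, K * evalRep t 𝕂 u b = evalRep t 𝕂 u' b * K) (v : 𝕂ˣ) :
    IntertwinesOn B ((1 : t.Mat 𝕂) ⊗ₖ K) (opRep t u v) (opRep t u' v) := by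
  have := (kronecker_one_intertwinesOn hB hK v).conj
  rwa [P_conj_kronecker] at this

/-- Schur's lemma. -/
theorem ActsIrreducibly.eq_smul_one {ι : Type} [Fintype ι] [DecidableEq ι]
    {S : Set (Matrix ι ι 𝕂)} (hS : ActsIrreducibly S) {C : Matrix ι ι 𝕂}
    (hC : ∀ M ∈ S, C * M = M * C) : ∃ c : 𝕂, C = c • 1 := by
  obtain ⟨hn, hW⟩ := hS
  obtain ⟨c, hc⟩ := Module.End.exists_eigenvalue (Matrix.toLin' C)
  refine ⟨c, ?_⟩
  have hinv : ∀ M ∈ S, ∀ w ∈ Module.End.eigenspace (Matrix.toLin' C) c,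
      M.mulVec w ∈ Module.End.eigenspace (Matrix.toLin' C) c := by
    intro M hM w hw
    rw [Module.End.mem_eigenspace_iff, Matrix.toLin'_apply] at hw ⊢
    rw [Matrix.mulVec_mulVec, hC M hM, ← Matrix.mulVec_mulVec, hw, Matrix.mulVec_smul]
  rcases hW (Module.End.eigenspace (Matrix.toLin' C) c) hinv with h | h
  · exact absurd h hc
  · apply Matrix.toLin'.injective
    refine LinearMap.ext fun w => ?_
    have hw : w ∈ Module.End.eigenspace (Matrix.toLin' C) c := by rw [h]; trivial
    rw [Module.End.mem_eigenspace_iff] at hw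
    rw [hw, map_smul, Matrix.toLin'_one]
    rfl

variable (t)

/-- The left hand side of the reflection equation with denominators cleared. -/
noncomputable def reflectionLeft (S : Type) [CommRing S] [Algebra 𝕂 S] (u v : S) (K K' : t.Mat S) :
    Mat2 t S :=
  (P t).map (algebraMap 𝕂 S) * Rhom t S u v * (P t).map (algebraMap 𝕂 S) * (K ⊗ₖ (1 : t.Mat S)) *
    Rhom t S (u * v) 1 * ((1 : t.Mat S) ⊗ₖ K')

/-- The right hand side of the reflection equation with denominators cleared. -/
noncomputable def reflectionRight (S : Type) [CommRing S] [Algebra 𝕂 S] (u v : S)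
    (K K' : t.Mat S) : Mat2 t S :=
  ((1 : t.Mat S) ⊗ₖ K') *
    ((P t).map (algebraMap 𝕂 S) * Rhom t S (u * v) 1 * (P t).map (algebraMap 𝕂 S)) *
    (K ⊗ₖ (1 : t.Mat S)) * Rhom t S u v

variable {t}

/-- Both sides intertwine the same two representations of B. With the right side R invertible, R⁻¹ L
is an endomorphism of the irreducible source, hence a scalar. -/
theorem reflection_proportional (hB : IsRightCoideal B) {η u v : 𝕂ˣ} {K K' : t.Mat 𝕂}
    (hK : ∀ b ∈ B, K * evalRep t 𝕂 (η * u) b = evalRep t 𝕂 (η / u) b * K)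
    (hK' : ∀ b ∈ B, K' * evalRep t 𝕂 (η * v) b = evalRep t 𝕂 (η / v) b * K')
    (hirr : ActsIrreducibly (tensorRep t 𝕂 (η * v) (η * u) '' (B : Set (Uq t))))
    (hdet : (reflectionRight t 𝕂 (u : 𝕂) v K K').det ≠ 0) :
    ∃ c : 𝕂, reflectionLeft t 𝕂 (u : 𝕂) v K K' = c • reflectionRight t 𝕂 (u : 𝕂) v K K' := by
  have hP : (P t).map (algebraMap 𝕂 𝕂) = P t := by ext; rfl
  have e1 : (u : 𝕂) = (η : 𝕂)⁻¹ * ((η * u : 𝕂ˣ) : 𝕂) := by simp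
  have e2 : (v : 𝕂) = (η : 𝕂)⁻¹ * ((η * v : 𝕂ˣ) : 𝕂) := by simp
  -- Reading the factors from right to left, the parameters (first, second leg) are (ηu, ηv), (ηu,
  -- η/v) after K₂, the same after R with the coproduct no longer opposite, (η/u, η/v) after K₁, and
  -- the opposite coproduct again after R₂₁. The third argument given to the R-lemmas is the factor
  -- that clears η.
  have hL : IntertwinesOn B (reflectionLeft t 𝕂 (u : 𝕂) v K K') (opRep t (η * v) (η * u))
      (opRep t (η / v) (η / u)) := by
    rw [reflectionLeft, hP]
    refine (((Rhom_conj_intertwinesOn B (u := η / v) (v := η / u) (u * v * (η : 𝕂)⁻¹) ?_ ?_).mul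
      (kronecker_one_intertwinesOn hB hK (η / v))).mul
      (Rhom_intertwinesOn B (u := η * u) (v := η / v) (v * (η : 𝕂)⁻¹) ?_ ?_)).mul
      (one_kronecker_intertwinesOn hB hK' (η * u)) <;> simp <;> field_simp
  -- Here the legs change in the other order: (ηu, ηv) up to K₁, then (η/u, ηv), and finally (η/u,
  -- η/v) after K₂.
  have hR : IntertwinesOn B (reflectionRight t 𝕂 (u : 𝕂) v K K') (opRep t (η * v) (η * u))
      (opRep t (η / v) (η / u)) := by
    rw [reflectionRight, hP]
    refine (((one_kronecker_intertwinesOn hB hK' (η / u)).mul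
      (Rhom_conj_intertwinesOn B (u := η * v) (v := η / u) (u * (η : 𝕂)⁻¹) ?_ ?_)).mul
      (kronecker_one_intertwinesOn hB hK (η * v))).mul
      (Rhom_intertwinesOn B (η : 𝕂)⁻¹ e1 e2) <;> simp <;> field_simp
  set L := reflectionLeft t 𝕂 (u : 𝕂) v K K'
  set R := reflectionRight t 𝕂 (u : 𝕂) v K K'
  have hu : IsUnit R.det := isUnit_iff_ne_zero.2 hdet
  have hcomm : IntertwinesOn B (R⁻¹ * L) (opRep t (η * v) (η * u)) (opRep t (η * v) (η * u)) := by
    intro b hb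
    rw [mul_assoc, hL b hb]
    have h := congrArg (fun M => R⁻¹ * M * (R⁻¹ * L)) (hR b hb)
    simp only [← mul_assoc, Matrix.nonsing_inv_mul R hu, one_mul] at h
    rw [mul_assoc (R⁻¹ * _) R, Matrix.mul_nonsing_inv R hu, mul_one] at h
    simpa only [mul_assoc] using h.symm
  -- Irreducibility is given for the coproduct itself with the legs exchanged, so the endomorphism
  -- is conjugated by P before Schur's lemma applies.
  obtain ⟨c, hc⟩ := hirr.eq_smul_one (C := P t * (R⁻¹ * L) * P t) (by
    rintro _ ⟨b, hb, rfl⟩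
    have h := hcomm.conj b hb
    simp only [opRep, P_conj_P_conj] at h
    exact h)
  refine ⟨c, ?_⟩
  have h1 := congrArg (fun M => P t * M * P t) hc
  simp only [P_conj_P_conj, mul_smul_comm, smul_mul_assoc, mul_one, P_mul_P] at h1
  calc L = R * (R⁻¹ * L) := by rw [← mul_assoc, Matrix.mul_nonsing_inv R hu, one_mul]
    _ = c • R := by rw [h1, mul_smul_comm, mul_one]

/-- An intertwiner between the evaluation representations is invertible if one of them has an
irreducible tensor product with an evaluation representation. -/
theorem det_ne_zero_of_intertwines (hB : IsRightCoideal B) {K : t.Mat 𝕂} {u u' v : 𝕂ˣ}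
    (hK : ∀ b ∈ B, K * evalRep t 𝕂 u b = evalRep t 𝕂 u' b * K) (hK0 : K ≠ 0)
    (hirr : ActsIrreducibly (tensorRep t 𝕂 u v '' (B : Set (Uq t)))) : K.det ≠ 0 := by
  have hint := kronecker_one_intertwinesOn hB hK v
  intro hdet
  have hdet2 : (K ⊗ₖ (1 : t.Mat 𝕂)).det = 0 := by
    obtain ⟨a, b, -⟩ : ∃ a b, K a b ≠ 0 := by
      by_contra! h
      exact hK0 (Matrix.ext h)
    have : Nonempty t.Idx := ⟨a⟩
    rw [Matrix.det_kronecker, hdet, zero_pow Fintype.card_ne_zero, zero_mul]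
  -- The kernel of an intertwiner is invariant under its source, so it is zero or everything.
  rcases hirr.2 (LinearMap.ker (Matrix.toLin' (K ⊗ₖ (1 : t.Mat 𝕂)))) (by
    rintro _ ⟨b, hb, rfl⟩ w hw
    rw [LinearMap.mem_ker, Matrix.toLin'_apply] at hw ⊢
    rw [Matrix.mulVec_mulVec, hint b hb, ← Matrix.mulVec_mulVec, hw, Matrix.mulVec_zero]) with h | h
  · obtain ⟨w, hw0, hw⟩ := Matrix.exists_mulVec_eq_zero_iff.2 hdet2
    refine hw0 ?_
    have : w ∈ LinearMap.ker (Matrix.toLin' (K ⊗ₖ (1 : t.Mat 𝕂))) := by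
      rw [LinearMap.mem_ker, Matrix.toLin'_apply, hw]
    rwa [h, Submodule.mem_bot] at this
  -- A full kernel means K ⊗ 1 = 0, whose entry at ((a, a), (b, a)) is K a b.
  · rw [LinearMap.ker_eq_top, LinearEquiv.map_eq_zero_iff] at h
    apply hK0
    ext a b
    have := congrFun (congrFun h (a, a)) (b, a)
    simpa using this

end Pointwise

/-! ### Change of scalars, determinants, and the case u = v. -/

section BaseChange

variable {t : AffineType} {S S' : Type} [CommRing S] [Algebra 𝕂 S] [CommRing S'] [Algebra 𝕂 S']

theorem map_algebraMap (M : Mat2 t 𝕂) (f : S →ₐ[𝕂] S') :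
    (M.map (algebraMap 𝕂 S)).map f = M.map (algebraMap 𝕂 S') := by
  ext i j
  exact f.commutes _

theorem map_kronecker (M N : t.Mat S) (f : S →ₐ[𝕂] S') : (M ⊗ₖ N).map f = M.map f ⊗ₖ N.map f := by
  ext i j
  exact map_mul f _ _

theorem map_one_mat (f : S →ₐ[𝕂] S') : (1 : t.Mat S).map f = 1 :=
  Matrix.map_one _ (map_zero f) (map_one f)

theorem Rhom_map (f : S →ₐ[𝕂] S') (a b : S) :
    (Rhom t S a b).map f = Rhom t S' (f a) (f b) := by
  ext i j
  simp only [Rhom, Matrix.map_apply, Matrix.add_apply, Matrix.sub_apply, Matrix.smul_apply,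
    smul_eq_mul, map_add, map_sub, map_mul, AlgHom.commutes]

theorem reflectionLeft_map (f : S →ₐ[𝕂] S') (u v : S) (K K' : t.Mat S) :
    (reflectionLeft t S u v K K').map f = reflectionLeft t S' (f u) (f v) (K.map f) (K'.map f) := by
  simp only [reflectionLeft, Matrix.map_mul, map_algebraMap, map_kronecker, map_one_mat, Rhom_map,
    map_mul, map_one]

theorem reflectionRight_map (f : S →ₐ[𝕂] S') (u v : S) (K K' : t.Mat S) :
    (reflectionRight t S u v K K').map f =
      reflectionRight t S' (f u) (f v) (K.map f) (K'.map f) := by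
  simp only [reflectionRight, Matrix.map_mul, map_algebraMap, map_kronecker, map_one_mat, Rhom_map,
    map_mul, map_one]

theorem P_map_mul_P_map :
    (P t).map (algebraMap 𝕂 S) * (P t).map (algebraMap 𝕂 S) = 1 := by
  rw [← Matrix.map_mul, P_mul_P, Matrix.map_one _ (map_zero _) (map_one _)]

theorem det_P_map_mul :
    ((P t).map (algebraMap 𝕂 S)).det * ((P t).map (algebraMap 𝕂 S)).det = 1 := by
  rw [← Matrix.det_mul, P_map_mul_P_map, Matrix.det_one]

theorem det_reflectionRight (u v : S) (K K' : t.Mat S) : (reflectionRight t S u v K K').det =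
    ((1 : t.Mat S) ⊗ₖ K').det * (Rhom t S (u * v) 1).det * (K ⊗ₖ (1 : t.Mat S)).det *
      (Rhom t S u v).det := by
  have h := det_P_map_mul (t := t) (S := S)
  simp only [reflectionRight, Matrix.det_mul]
  linear_combination ((1 : t.Mat S) ⊗ₖ K').det * (Rhom t S (u * v) 1).det *
    (K ⊗ₖ (1 : t.Mat S)).det * (Rhom t S u v).det * h

/-- The same four matrices occur on both sides; the order is irrelevant for determinants and the two
factors P contribute det(P)² = 1. -/
theorem det_reflectionLeft (u v : S) (K K' : t.Mat S) :
    (reflectionLeft t S u v K K').det = (reflectionRight t S u v K K').det := by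
  have h := det_P_map_mul (t := t) (S := S)
  rw [det_reflectionRight]
  simp only [reflectionLeft, Matrix.det_mul]
  linear_combination ((1 : t.Mat S) ⊗ₖ K').det * (Rhom t S (u * v) 1).det *
    (K ⊗ₖ (1 : t.Mat S)).det * (Rhom t S u v).det * h

/-- The terms with R_q and Q_q carry the factor b - a, so only P remains. -/
theorem Rhom_diag (a : S) : Rhom t S a a =
    (algebraMap 𝕂 S ((q - q⁻¹) * (q ^ twoKappa t - 1)) * a ^ 2) •
      (P t).map (algebraMap 𝕂 S) := by
  rw [Rhom, sub_self, zero_mul, zero_smul, zero_smul, sub_zero, zero_add, smul_smul]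
  congr 1
  simp only [map_mul, map_sub, map_one]
  ring

theorem P_map_mul_kronecker (K K' : t.Mat S) :
    (P t).map (algebraMap 𝕂 S) * (K ⊗ₖ K') = (K' ⊗ₖ K) * (P t).map (algebraMap 𝕂 S) := by
  ext ⟨a, b⟩ ⟨c, d⟩
  rw [Matrix.mul_apply, Matrix.mul_apply, Fintype.sum_eq_single (b, a), Fintype.sum_eq_single (d,
    c)]
  · simp [P_apply]; ring
  · rintro ⟨m, n⟩ h
    rw [Matrix.map_apply, P_apply, if_neg, map_zero, mul_zero]
    exact fun e => h (Prod.ext (Subtype.ext e.1) (Subtype.ext e.2))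
  · rintro ⟨m, n⟩ h
    rw [Matrix.map_apply, P_apply, if_neg, map_zero, zero_mul]
    exact fun e => h (Prod.ext (Subtype.ext e.2.symm) (Subtype.ext e.1.symm))

/-- The reflection equation holds when the spectral parameters coincide. -/
theorem reflection_diag (u : S) (K : t.Mat S) :
    reflectionLeft t S u u K K = reflectionRight t S u u K K := by
  have hP := P_map_mul_P_map (t := t) (S := S)
  have hK := P_map_mul_kronecker K (1 : t.Mat S)
  have hK' := P_map_mul_kronecker (1 : t.Mat S) K
  -- With the outer R-matrix replaced by a multiple of P, both sides reduce to that multiple of K₂ P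
  -- R(u²) K₂, because P exchanges K ⊗ 1 and 1 ⊗ K.
  rw [reflectionLeft, reflectionRight, Rhom_diag]
  set T := (P t).map (algebraMap 𝕂 S)
  simp only [mul_smul_comm, smul_mul_assoc]
  congr 1
  rw [hP, one_mul]
  calc T * (K ⊗ₖ (1 : t.Mat S)) * Rhom t S (u * u) 1 * ((1 : t.Mat S) ⊗ₖ K)
      = ((1 : t.Mat S) ⊗ₖ K) * (T * Rhom t S (u * u) 1 * ((1 : t.Mat S) ⊗ₖ K)) := by
        rw [hK]; simp only [mul_assoc]
    _ = ((1 : t.Mat S) ⊗ₖ K) * (T * Rhom t S (u * u) 1 * (T * T) * ((1 : t.Mat S) ⊗ₖ K)) := by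
        rw [hP, mul_one]
    _ = ((1 : t.Mat S) ⊗ₖ K) * (T * Rhom t S (u * u) 1 * T * (T * ((1 : t.Mat S) ⊗ₖ K))) := by
        simp only [mul_assoc]
    _ = _ := by rw [hK']; simp only [mul_assoc]

end BaseChange

/-! ### Laurent polynomials and their evaluations. -/

section Laurent

open scoped LaurentPolynomial

/-- Evaluation of Laurent polynomials at an invertible element. -/
noncomputable def laurentEval {A : Type} [CommRing A] [Algebra 𝕂 A] (w : Aˣ) :
    LaurentPolynomial 𝕂 →ₐ[𝕂] A :=
  { LaurentPolynomial.eval₂ (algebraMap 𝕂 A) w with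
    commutes' := fun c => LaurentPolynomial.eval₂_C (algebraMap 𝕂 A) w c }

/-- The indeterminate of the ring of Laurent polynomials. -/
noncomputable def laurentVar : (LaurentPolynomial 𝕂)ˣ where
  val := LaurentPolynomial.T 1
  inv := LaurentPolynomial.T (-1)
  val_inv := by rw [← LaurentPolynomial.T_add]; exact LaurentPolynomial.T_zero
  inv_val := by rw [← LaurentPolynomial.T_add]; exact LaurentPolynomial.T_zero

variable {A : Type} [CommRing A] [Algebra 𝕂 A]

theorem laurentEval_toLaurent (w : Aˣ) (p : Polynomial 𝕂) :
    laurentEval w (Polynomial.toLaurent p) = Polynomial.aeval (w : A) p :=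
  LaurentPolynomial.eval₂_toLaurent (algebraMap 𝕂 A) w p

theorem laurentEval_var (w : Aˣ) :
    Units.map (laurentEval w).toRingHom.toMonoidHom laurentVar = w := by
  ext
  change laurentEval w (LaurentPolynomial.T 1) = w
  rw [← Polynomial.toLaurent_X, laurentEval_toLaurent, Polynomial.aeval_X]

/-- A scalar as an invertible element of a `𝕂`-algebra. -/
noncomputable def scalarUnit (A : Type) [CommRing A] [Algebra 𝕂 A] (η : 𝕂ˣ) : Aˣ :=
  Units.map (algebraMap 𝕂 A).toMonoidHom η

theorem laurentEval_scalar (w : Aˣ) (η : 𝕂ˣ) :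
    Units.map (laurentEval w).toRingHom.toMonoidHom (scalarUnit (LaurentPolynomial 𝕂) η) =
      scalarUnit A η := by
  ext
  exact (laurentEval w).commutes η

theorem aeval_varU (p : Polynomial 𝕂) :
    Polynomial.aeval (varU : RatFunc 𝕂) p = algebraMap (Polynomial 𝕂) (RatFunc 𝕂) p := by
  rw [varU, Units.val_mk0, ← RatFunc.algebraMap_X, Polynomial.aeval_algebraMap_apply,
    Polynomial.aeval_X_left_apply]

/-- A power of the variable turns a Laurent polynomial into a polynomial, polynomials embed in
rational functions, and the variable is a unit. -/
theorem laurentEval_varU_injective : Function.Injective (laurentEval varU) := by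
  rw [injective_iff_map_eq_zero]
  intro p hp
  obtain ⟨n, p', hp'⟩ := LaurentPolynomial.exists_T_pow p
  have h := congrArg (laurentEval varU) hp'
  rw [map_mul, hp, zero_mul, laurentEval_toLaurent, aeval_varU] at h
  rw [RatFunc.algebraMap_injective 𝕂 (h.trans (map_zero _).symm), map_zero] at hp'
  exact ((LaurentPolynomial.isUnit_T (n : ℤ)).mul_left_eq_zero).1 hp'.symm

end Laurent

/-! ### Clearing denominators in K and specialising its parameter. -/

section Clearing

variable {t : AffineType} {B : Subalgebra 𝕂 (Uq t)}

/-- The boundary intertwining equation at a point, for a matrix with cleared denominators. -/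
theorem BoundaryIntertwining.eval {K : t.Mat (RatFunc 𝕂)} {η : 𝕂ˣ}
    (h : BoundaryIntertwining B K η) {L : t.Mat (Polynomial 𝕂)} {d : RatFunc 𝕂}
    (hL : L.map (algebraMap (Polynomial 𝕂) (RatFunc 𝕂)) = d • K) (w : 𝕂ˣ) (b : Uq t) (hb : b ∈ B) :
    L.map (Polynomial.aeval (w : 𝕂)) * evalRep t 𝕂 (η * w) b =
      evalRep t 𝕂 (η / w) b * L.map (Polynomial.aeval (w : 𝕂)) := by
  have hmap {A : Type} [CommRing A] [Algebra 𝕂 A] (w : Aˣ) :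
      (L.map Polynomial.toLaurent).map (laurentEval w) = L.map (Polynomial.aeval (w : A)) := by
    ext i j
    exact laurentEval_toLaurent w (L i j)
  have e1 {A : Type} [CommRing A] [Algebra 𝕂 A] (w : Aˣ) :
      (evalRep t (LaurentPolynomial 𝕂) (scalarUnit _ η * laurentVar) b).map (laurentEval w) =
        evalRep t A (scalarUnit A η * w) b := by
    rw [← evalRep_map, map_mul, laurentEval_scalar, laurentEval_var]
  have e2 {A : Type} [CommRing A] [Algebra 𝕂 A] (w : Aˣ) :
      (evalRep t (LaurentPolynomial 𝕂) (scalarUnit _ η / laurentVar) b).map (laurentEval w) =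
        evalRep t A (scalarUnit A η / w) b := by
    rw [← evalRep_map, map_div, laurentEval_scalar, laurentEval_var]
  -- Both T_{ηu} and T_{η/u} have entries in 𝕂[u, u⁻¹]. The equation therefore descends from 𝕂(u) to
  -- Laurent polynomials, which, unlike rational functions, can be evaluated at every unit w.
  have key : L.map Polynomial.toLaurent *
      evalRep t (LaurentPolynomial 𝕂) (scalarUnit _ η * laurentVar) b =
      evalRep t (LaurentPolynomial 𝕂) (scalarUnit _ η / laurentVar) b *
        L.map Polynomial.toLaurent := by
    apply Matrix.map_injective laurentEval_varU_injective
    dsimp only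
    have hL' : L.map (Polynomial.aeval (varU : RatFunc 𝕂)) = d • K := by
      rw [← hL]
      ext i j
      exact aeval_varU _
    rw [Matrix.map_mul, Matrix.map_mul, hmap, e1, e2, hL', smul_mul_assoc, mul_smul_comm]
    exact congrArg (d • ·) (h b hb)
  have := congrArg (fun M => M.map (laurentEval w)) key
  rw [Matrix.map_mul, Matrix.map_mul, hmap, e1, e2] at this
  exact this

theorem exists_clear_denominators (K : t.Mat (RatFunc 𝕂)) :
    ∃ (L : t.Mat (Polynomial 𝕂)) (d : Polynomial 𝕂), d ≠ 0 ∧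
      L.map (algebraMap (Polynomial 𝕂) (RatFunc 𝕂)) =
        algebraMap (Polynomial 𝕂) (RatFunc 𝕂) d • K := by
  obtain ⟨d, hd⟩ := IsLocalization.exist_integer_multiples_of_finite
    (nonZeroDivisors (Polynomial 𝕂)) (fun x : t.Idx × t.Idx => K x.1 x.2)
  choose L hL using hd
  refine ⟨Matrix.of fun i j => L (i, j), d, nonZeroDivisors.coe_ne_zero d, ?_⟩
  ext i j
  rw [Matrix.map_apply, Matrix.of_apply, hL, Matrix.smul_apply, Algebra.smul_def, smul_eq_mul]

end Clearing

/-! ### Generic points and the constancy of the scalar. -/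

section Generic

open MvPolynomial

variable {t : AffineType} {B : Subalgebra 𝕂 (Uq t)}

/-- Multiplying F by both variables forces the coordinates of the point to be invertible. -/
theorem exists_eval_ne_zero {F : MvPolynomial (Fin 2) 𝕂} (hF : F ≠ 0) :
    ∃ u v : 𝕂ˣ, eval ![(u : 𝕂), (v : 𝕂)] F ≠ 0 := by
  have h : F * X 0 * X 1 ≠ 0 := mul_ne_zero (mul_ne_zero hF (X_ne_zero 0)) (X_ne_zero 1)
  obtain ⟨x, hx⟩ : ∃ x, eval x (F * X 0 * X 1) ≠ 0 := by
    by_contra! h0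
    exact h (MvPolynomial.funext fun x => by rw [h0, map_zero])
  simp only [map_mul, eval_X] at hx
  refine ⟨Units.mk0 (x 0) (right_ne_zero_of_mul (left_ne_zero_of_mul hx)),
    Units.mk0 (x 1) (right_ne_zero_of_mul hx), ?_⟩
  have e : ![x 0, x 1] = x := by
    ext i; fin_cases i <;> rfl
  rw [Units.val_mk0, Units.val_mk0, e]
  exact left_ne_zero_of_mul (left_ne_zero_of_mul hx)

/-- Swapping and rescaling the variables of a polynomial. -/
theorem exists_rescaled_swap {p : MvPolynomial (Fin 2) 𝕂} (hp : p ≠ 0) (η : 𝕂ˣ) :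
    ∃ p' : MvPolynomial (Fin 2) 𝕂, p' ≠ 0 ∧
      ∀ u v : 𝕂, eval ![u, v] p' = eval ![η * v, η * u] p := by
  have key (u v : 𝕂) : eval ![u, v] (bind₁ ![C (η : 𝕂) * X 1, C (η : 𝕂) * X 0] p) =
      eval ![η * v, η * u] p := by
    rw [← coe_aeval_eq_eval, ← coe_aeval_eq_eval, RingHom.coe_coe, aeval_bind₁]
    have e : (fun i => aeval ![u, v] (![C (η : 𝕂) * X 1, C (η : 𝕂) * X 0] i)) =
        ![(η : 𝕂) * v, (η : 𝕂) * u] := by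
      ext i
      fin_cases i <;> simp
    rw [e]
    rfl
  -- The substitution is invertible: a value of p at (u, v) is the value of the new polynomial at
  -- (η⁻¹ v, η⁻¹ u).
  refine ⟨_, fun h => ?_, key⟩
  obtain ⟨u, v, huv⟩ := exists_eval_ne_zero hp
  apply huv
  have h' := key ((η : 𝕂)⁻¹ * v) ((η : 𝕂)⁻¹ * u)
  rw [h, map_zero] at h'
  simpa using h'.symm

theorem q_zpow_ne_one {m : ℤ} (hm : 0 < m) : q ^ m ≠ 1 := by
  obtain ⟨k, rfl⟩ := Int.eq_ofNat_of_zero_le hm.le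
  rw [zpow_natCast]
  exact q_pow_ne_one (by omega)

theorem twoKappa_pos (t : AffineType) : 0 < twoKappa t := by
  have hn := t.le_n
  unfold twoKappa
  cases hl : t.letter <;> simp only [hl, Letter.minRank] at hn ⊢
  -- The case n = 1 is separate because n + 1 - 2 = 0 there; positivity comes from (-1)^n = -1.
  · rcases eq_or_lt_of_le hn with h | h
    · rw [← h]; norm_num
    · rcases neg_one_pow_eq_or ℤ t.n with h' | h' <;> rw [h'] <;> omega
  all_goals omega

/-- At equal parameters the matrix is (q - q⁻¹)(q^{2κ} - 1) P, and neither factor vanishes because q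
is not a root of unity and 2κ > 0. -/
theorem det_Rhom_one : (Rhom t 𝕂 1 1).det ≠ 0 := by
  rw [Rhom_diag, Matrix.det_smul, one_pow, mul_one]
  refine mul_ne_zero (pow_ne_zero _ (mul_ne_zero ?_ ?_)) ?_
  · have h := q_pow_ne_one two_ne_zero
    have hq := q_ne_zero
    intro h0
    apply h
    have h0' : q - q⁻¹ = 0 := h0
    field_simp at h0'
    linear_combination h0'
  · exact sub_ne_zero.2 (q_zpow_ne_one (twoKappa_pos t))
  · exact left_ne_zero_of_mul (by rw [det_P_map_mul]; exact one_ne_zero)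

theorem det_map_algHom {ι S S' : Type} [Fintype ι] [DecidableEq ι] [CommRing S] [Algebra 𝕂 S]
    [CommRing S'] [Algebra 𝕂 S'] (f : S →ₐ[𝕂] S') (M : Matrix ι ι S) :
    (M.map f).det = f M.det :=
  (f.toRingHom.map_det M).symm

/-- Both R-factors become `Rhom` at (1, 1) when the variable is set to 1, so their determinants are
nonzero polynomials; the K-factors contribute powers of det L. -/
theorem det_reflectionRight_diag {L : t.Mat (Polynomial 𝕂)} (hL : L.det ≠ 0) :
    (reflectionRight t (Polynomial 𝕂) Polynomial.X Polynomial.X L L).det ≠ 0 := by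
  have key {a b : Polynomial 𝕂} (ha : Polynomial.aeval (1 : 𝕂) a = 1)
      (hb : Polynomial.aeval (1 : 𝕂) b = 1) : (Rhom t (Polynomial 𝕂) a b).det ≠ 0 := by
    intro h
    have h' := det_map_algHom (Polynomial.aeval (1 : 𝕂)) (Rhom t (Polynomial 𝕂) a b)
    rw [h, map_zero, Rhom_map, ha, hb] at h'
    exact det_Rhom_one h'
  rw [det_reflectionRight, Matrix.det_kronecker, Matrix.det_kronecker, Matrix.det_one, one_pow,
    mul_one, one_mul]
  exact mul_ne_zero (mul_ne_zero (mul_ne_zero (pow_ne_zero _ hL) (key (by simp) (by simp)))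
    (pow_ne_zero _ hL)) (key (by simp) (by simp))

/-- A matrix over an integral `𝕂`-algebra that is proportional to another one with the same
determinant is a constant multiple of it. -/
theorem exists_smul_of_proportional {ι S : Type} [Fintype ι] [DecidableEq ι] [Nonempty ι]
    [CommRing S] [IsDomain S] [Algebra 𝕂 S] {L R : Matrix ι ι S}
    (h : ∀ i j k l, L i j * R k l = L k l * R i j) (hdet : L.det = R.det) (hR : R.det ≠ 0) :
    ∃ z : 𝕂, L = algebraMap 𝕂 S z • R := by
  obtain ⟨k, l, hr⟩ : ∃ k l, R k l ≠ 0 := by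
    by_contra! h0
    apply hR
    rw [show R = 0 from Matrix.ext h0, Matrix.det_zero]
  have hsmul : R k l • L = L k l • R := by
    ext i j
    rw [Matrix.smul_apply, Matrix.smul_apply, smul_eq_mul, smul_eq_mul, mul_comm, h]
  -- Taking determinants in R_{kl} L = L_{kl} R and cancelling the common determinant leaves an
  -- equality of powers of two single entries.
  have hpow : L k l ^ Fintype.card ι - R k l ^ Fintype.card ι = 0 := by
    have := congrArg Matrix.det hsmul
    rw [Matrix.det_smul, Matrix.det_smul, hdet] at this
    rw [mul_right_cancel₀ hR this, sub_self]
  have : CharZero 𝕂 := charZero_of_injective_algebraMap (algebraMap (RatFunc ℂ) 𝕂).injective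
  have : NeZero (Fintype.card ι) := ⟨Fintype.card_ne_zero⟩
  have : NeZero ((Fintype.card ι : ℕ) : 𝕂) := ⟨Nat.cast_ne_zero.2 Fintype.card_ne_zero⟩
  -- The ground field contains all roots of unity of this order, so the difference of powers splits
  -- into linear factors over the domain S, and one of them vanishes. Hence the ratio of the entries
  -- is a constant.
  obtain ⟨ζ, hζ⟩ := HasEnoughRootsOfUnity.exists_primitiveRoot 𝕂 (Fintype.card ι)
  have hζ' := hζ.map_of_injective (f := algebraMap 𝕂 S) (algebraMap 𝕂 S).injective
  rw [hζ'.pow_sub_pow_eq_prod_sub_mul _ _ Fintype.card_pos, Finset.prod_eq_zero_iff] at hpow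
  obtain ⟨ξ, hξ, hl⟩ := hpow
  rw [Polynomial.mem_nthRootsFinset Fintype.card_pos] at hξ
  obtain ⟨i, -, rfl⟩ := hζ'.eq_pow_of_pow_eq_one hξ
  refine ⟨ζ ^ i, ?_⟩
  ext a b
  have hab := h a b k l
  rw [sub_eq_zero.1 hl] at hab
  apply mul_right_cancel₀ hr
  rw [hab, Matrix.smul_apply, smul_eq_mul, map_pow]
  ring

end Generic

/-! ### The reflection equation for polynomial K-matrices. -/

section Polynomial

open MvPolynomial

variable {t : AffineType} {B : Subalgebra 𝕂 (Uq t)}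

theorem GenericallyIrreducible.rescaled_swap (h : GenericallyIrreducible B) (η : 𝕂ˣ) :
    ∃ p : MvPolynomial (Fin 2) 𝕂, p ≠ 0 ∧ ∀ u v : 𝕂ˣ, eval ![(u : 𝕂), (v : 𝕂)] p ≠ 0 →
      ActsIrreducibly (tensorRep t 𝕂 (η * v) (η * u) '' (B : Set (Uq t))) := by
  obtain ⟨p, hp, hirr⟩ := h
  obtain ⟨p', hp', he⟩ := exists_rescaled_swap hp η
  refine ⟨p', hp', fun u v huv => hirr _ _ ?_⟩
  rwa [he] at huv

theorem aeval_aeval_X (x : Fin 2 → 𝕂) (s : Fin 2) (f : Polynomial 𝕂) :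
    aeval x (Polynomial.aeval (X s : MvPolynomial (Fin 2) 𝕂) f) = Polynomial.aeval (x s) f := by
  rw [← Polynomial.aeval_algHom_apply, aeval_X]

theorem map_aeval_X (x : Fin 2 → 𝕂) (s : Fin 2) (L : t.Mat (Polynomial 𝕂)) :
    (L.map (Polynomial.aeval (X s : MvPolynomial (Fin 2) 𝕂))).map (aeval x) =
      L.map (Polynomial.aeval (x s)) := by
  ext i j
  exact aeval_aeval_X x s _

theorem aeval_X_ne_zero (s : Fin 2) {f : Polynomial 𝕂} (hf : f ≠ 0) :
    Polynomial.aeval (X s : MvPolynomial (Fin 2) 𝕂) f ≠ 0 :=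
  (map_ne_zero_iff _ (transcendental_iff_injective.1 (transcendental_X 𝕂 s))).2 hf

variable {η : 𝕂ˣ} {L : t.Mat (Polynomial 𝕂)}

/-- At a point where a chosen entry of L is nonzero and the representation is irreducible, the
specialised L is a nonzero intertwiner, hence invertible; so det L is not the zero polynomial. -/
theorem det_ne_zero_of_evals (hB : IsRightCoideal B) (hirr : GenericallyIrreducible B) (hL0 : L ≠ 0)
    (hL : ∀ w : 𝕂ˣ, ∀ b ∈ B, L.map (Polynomial.aeval (w : 𝕂)) * evalRep t 𝕂 (η * w) b =
      evalRep t 𝕂 (η / w) b * L.map (Polynomial.aeval (w : 𝕂))) : L.det ≠ 0 := by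
  obtain ⟨p, hp, hirr⟩ := hirr.rescaled_swap η
  obtain ⟨i, j, hij⟩ : ∃ i j, L i j ≠ 0 := by
    by_contra! h
    exact hL0 (Matrix.ext h)
  obtain ⟨u, v, huv⟩ := exists_eval_ne_zero (mul_ne_zero hp (aeval_X_ne_zero 1 hij))
  rw [map_mul] at huv
  have hv := right_ne_zero_of_mul huv
  rw [← coe_aeval_eq_eval, RingHom.coe_coe, aeval_aeval_X] at hv
  have := det_ne_zero_of_intertwines hB (hL v)
    (fun h => hv (congrFun (congrFun h i) j)) (hirr u v (left_ne_zero_of_mul huv))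
  rw [det_map_algHom] at this
  exact fun h => this (by rw [h, map_zero])

/-- The reflection equation for a polynomial matrix intertwining generically irreducible
evaluation representations. -/
theorem reflection_of_evals (hB : IsRightCoideal B) (hirr : GenericallyIrreducible B) (hL0 : L ≠ 0)
    (hL : ∀ w : 𝕂ˣ, ∀ b ∈ B, L.map (Polynomial.aeval (w : 𝕂)) * evalRep t 𝕂 (η * w) b =
      evalRep t 𝕂 (η / w) b * L.map (Polynomial.aeval (w : 𝕂))) :
    reflectionLeft t (MvPolynomial (Fin 2) 𝕂) (X 0) (X 1) (L.map (Polynomial.aeval (X 0)))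
      (L.map (Polynomial.aeval (X 1))) =
    reflectionRight t (MvPolynomial (Fin 2) 𝕂) (X 0) (X 1) (L.map (Polynomial.aeval (X 0)))
      (L.map (Polynomial.aeval (X 1))) := by
  have hdiag := det_reflectionRight_diag (det_ne_zero_of_evals hB hirr hL0 hL)
  obtain ⟨p, hp, hirr⟩ := hirr.rescaled_swap η
  have hdet := det_reflectionLeft (X 0 : MvPolynomial (Fin 2) 𝕂) (X 1)
    (L.map (Polynomial.aeval (X 0))) (L.map (Polynomial.aeval (X 1)))
  -- Restriction to the diagonal u = v, which is used both for the nonvanishing of the determinant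
  -- and to find the constant.
  set φ : MvPolynomial (Fin 2) 𝕂 →ₐ[𝕂] Polynomial 𝕂 := aeval fun _ => Polynomial.X
  have hφL (s : Fin 2) : (L.map (Polynomial.aeval (X s : MvPolynomial (Fin 2) 𝕂))).map φ = L := by
    ext1 i j
    change φ (Polynomial.aeval (X s) (L i j)) = L i j
    rw [← Polynomial.aeval_algHom_apply, aeval_X, Polynomial.aeval_X_left_apply]
  have hleft := reflectionLeft_map φ (X 0) (X 1) (L.map (Polynomial.aeval (X 0)))
    (L.map (Polynomial.aeval (X 1)))
  have hright := reflectionRight_map φ (X 0) (X 1) (L.map (Polynomial.aeval (X 0)))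
    (L.map (Polynomial.aeval (X 1)))
  rw [hφL, hφL, aeval_X, aeval_X] at hleft hright
  have hx (u v : 𝕂) := reflectionLeft_map (aeval ![u, v]) (X 0) (X 1)
    (L.map (Polynomial.aeval (X 0))) (L.map (Polynomial.aeval (X 1)))
  have hy (u v : 𝕂) := reflectionRight_map (aeval ![u, v]) (X 0) (X 1)
    (L.map (Polynomial.aeval (X 0))) (L.map (Polynomial.aeval (X 1)))
  simp only [map_aeval_X, aeval_X, Matrix.cons_val_zero, Matrix.cons_val_one] at hx hy
  generalize reflectionLeft t (MvPolynomial (Fin 2) 𝕂) (X 0) (X 1) (L.map (Polynomial.aeval (X 0)))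
      (L.map (Polynomial.aeval (X 1))) = M at *
  generalize reflectionRight t (MvPolynomial (Fin 2) 𝕂) (X 0) (X 1)
      (L.map (Polynomial.aeval (X 0))) (L.map (Polynomial.aeval (X 1))) = N at *
  have hN : N.det ≠ 0 := by
    intro h
    apply hdiag
    rw [← hright, det_map_algHom, h, map_zero]
  obtain ⟨a⟩ : Nonempty t.Idx := by
    by_contra h
    rw [not_nonempty_iff] at h
    exact hL0 (Subsingleton.elim _ _)
  have : Nonempty (t.Idx × t.Idx) := ⟨(a, a)⟩
  -- If some 2 × 2 minor were a nonzero polynomial, there would be a point where it, the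
  -- irreducibility polynomial and det N are all nonzero. Proportionality at that point contradicts
  -- the nonvanishing of the minor.
  obtain ⟨z, hz⟩ := exists_smul_of_proportional (L := M) (R := N) (fun i j k l => by
    by_contra hne
    obtain ⟨u, v, huv⟩ := exists_eval_ne_zero
      (mul_ne_zero (mul_ne_zero (sub_ne_zero.2 hne) hp) hN)
    rw [map_mul, map_mul] at huv
    have hd := right_ne_zero_of_mul huv
    rw [← coe_aeval_eq_eval, RingHom.coe_coe, ← det_map_algHom, hy] at hd
    obtain ⟨c, hc⟩ := reflection_proportional hB (hL u) (hL v)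
      (hirr u v (right_ne_zero_of_mul (left_ne_zero_of_mul huv))) hd
    rw [← hx, ← hy] at hc
    have hc' (i j) : aeval ![(u : 𝕂), (v : 𝕂)] (M i j) = c * aeval ![(u : 𝕂), (v : 𝕂)] (N i j) :=
      congrFun (congrFun hc i) j
    apply left_ne_zero_of_mul (left_ne_zero_of_mul huv)
    rw [← coe_aeval_eq_eval, RingHom.coe_coe, map_sub, map_mul, map_mul, hc', hc']
    ring) hdet hN
  -- On the diagonal the two matrices agree and are nonzero, which fixes the constant.
  have hz1 : z = 1 := by
    have h := congrArg (fun A => A.map φ) hz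
    simp only [hleft, reflection_diag] at h
    rw [← hright] at h hdiag
    obtain ⟨k, l, hkl⟩ : ∃ k l, N.map φ k l ≠ 0 := by
      by_contra! h0
      apply hdiag
      rw [show N.map φ = 0 from Matrix.ext h0, Matrix.det_zero]
    have h' : φ (N k l) = φ (algebraMap 𝕂 _ z * N k l) := congrFun (congrFun h k) l
    rw [map_mul, AlgHom.commutes] at h'
    have h1 := mul_right_cancel₀ hkl ((one_mul (φ (N k l))).trans h')
    exact (algebraMap 𝕂 (Polynomial 𝕂)).injective (by rw [← h1, map_one])
  rw [hz, hz1, map_one, one_smul]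

end Polynomial

/-! ### Back to rational functions of u and v. -/

section Transfer

variable {t : AffineType}

theorem aeval_var (s : Fin 2) (f : Polynomial 𝕂) : Polynomial.aeval (var s) f =
    algebraMap (MvPolynomial (Fin 2) 𝕂) 𝕂₂ (Polynomial.aeval (MvPolynomial.X s) f) := by
  rw [var, Polynomial.aeval_algebraMap_apply]

theorem subst_algebraMap (s : Fin 2) (f : Polynomial 𝕂) :
    subst s (algebraMap (Polynomial 𝕂) (RatFunc 𝕂) f) = Polynomial.aeval (var s) f := by
  have h := RatFunc.liftAlgHom_apply_div' (φ := Polynomial.aeval (R := 𝕂) (var s))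
    (nonZeroDivisors_le_comap_nonZeroDivisors_of_injective _ (aeval_var_injective s)) f 1
  rw [map_one, map_one, map_one, div_one, div_one] at h
  exact h

theorem map_subst {K : t.Mat (RatFunc 𝕂)} {L : t.Mat (Polynomial 𝕂)} {d : Polynomial 𝕂} (hd : d ≠ 0)
    (hL : L.map (algebraMap (Polynomial 𝕂) (RatFunc 𝕂)) =
      algebraMap (Polynomial 𝕂) (RatFunc 𝕂) d • K) (s : Fin 2) :
    K.map (subst s) = (Polynomial.aeval (var s) d)⁻¹ • L.map (Polynomial.aeval (var s)) := by
  have hd' : Polynomial.aeval (var s) d ≠ 0 := (map_ne_zero_iff _ (aeval_var_injective s)).2 hd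
  ext i j
  have h := congrArg (subst s) (congrFun (congrFun hL i) j)
  rw [Matrix.map_apply, Matrix.smul_apply, smul_eq_mul, map_mul, subst_algebraMap,
    subst_algebraMap] at h
  rw [Matrix.smul_apply, Matrix.map_apply, Matrix.map_apply, h, smul_eq_mul,
    inv_mul_cancel_left₀ hd']

variable {F : Type} [Field F] [Algebra 𝕂 F]

/-- The R-matrix at a quotient is a multiple of the homogeneous R-matrix. -/
theorem R_div {a b : F} (hb : b ≠ 0) (h1 : algebraMap 𝕂 F q * b - algebraMap 𝕂 F q⁻¹ * a ≠ 0)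
    (h2 : algebraMap 𝕂 F (q ^ twoKappa t) * b - a ≠ 0) :
    R t (a / b) = ((algebraMap 𝕂 F q * b - algebraMap 𝕂 F q⁻¹ * a) *
      (algebraMap 𝕂 F (q ^ twoKappa t) * b - a))⁻¹ • Rhom t F a b := by
  have e1 : algebraMap 𝕂 F q - algebraMap 𝕂 F q⁻¹ * (a / b) =
      (algebraMap 𝕂 F q * b - algebraMap 𝕂 F q⁻¹ * a) / b := by field_simp
  have e2 : algebraMap 𝕂 F (q ^ twoKappa t) - a / b =
      (algebraMap 𝕂 F (q ^ twoKappa t) * b - a) / b := by field_simp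
  have e3 : 1 - a / b = (b - a) / b := by field_simp
  simp only [R, Rhom, e1, e2, e3]
  generalize algebraMap 𝕂 F q * b - algebraMap 𝕂 F q⁻¹ * a = A at *
  generalize algebraMap 𝕂 F (q ^ twoKappa t) * b - a = C at *
  match_scalars <;> field_simp

/-- Evaluation at (0, 1) sends the expression to c. Both argument pairs of the R-matrix, (u, v) and
(u v, 1), become (0, 1) there, so this handles every denominator. -/
theorem linear_ne_zero {c d : 𝕂} (hc : c ≠ 0) {a b : MvPolynomial (Fin 2) 𝕂}
    (ha : MvPolynomial.aeval ![(0 : 𝕂), 1] a = 0) (hb : MvPolynomial.aeval ![(0 : 𝕂), 1] b = 1) :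
    algebraMap 𝕂 (MvPolynomial (Fin 2) 𝕂) c * b -
      algebraMap 𝕂 (MvPolynomial (Fin 2) 𝕂) d * a ≠ 0 := by
  intro h
  have h' := congrArg (MvPolynomial.aeval ![(0 : 𝕂), 1]) h
  rw [map_sub, map_mul, map_mul, ha, hb, AlgHom.commutes, mul_zero, sub_zero, mul_one,
    map_zero] at h'
  exact hc h'

theorem R_div_poly {a b : MvPolynomial (Fin 2) 𝕂}
    (ha : MvPolynomial.aeval ![(0 : 𝕂), 1] a = 0) (hb : MvPolynomial.aeval ![(0 : 𝕂), 1] b = 1) :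
    ∃ c : 𝕂₂, R t (algebraMap _ 𝕂₂ a / algebraMap _ 𝕂₂ b) =
      c • Rhom t 𝕂₂ (algebraMap _ 𝕂₂ a) (algebraMap _ 𝕂₂ b) := by
  have hinj := IsFractionRing.injective (MvPolynomial (Fin 2) 𝕂) 𝕂₂
  refine ⟨_, R_div ?_ ?_ ?_⟩
  · rw [map_ne_zero_iff _ hinj]
    rintro rfl
    rw [map_zero] at hb
    exact zero_ne_one hb
  · have h := linear_ne_zero (d := q⁻¹) q_ne_zero ha hb
    rwa [← map_ne_zero_iff _ hinj, map_sub, map_mul, map_mul, ← IsScalarTower.algebraMap_apply,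
      ← IsScalarTower.algebraMap_apply] at h
  · have h := linear_ne_zero (d := 1) (zpow_ne_zero (twoKappa t) q_ne_zero) ha hb
    rwa [← map_ne_zero_iff _ hinj, map_sub, map_mul, map_one, one_mul,
      ← IsScalarTower.algebraMap_apply] at h

/-- Each side contains R(u/v), R(uv), K(u) and K(v) once, with conjugation by P possibly applied.
Both therefore differ from the cleared versions by the same scalar. -/
theorem reflectionEquation_of_polynomial {K : t.Mat (RatFunc 𝕂)} {L : t.Mat (Polynomial 𝕂)}
    {d : Polynomial 𝕂} (hd : d ≠ 0)
    (hL : L.map (algebraMap (Polynomial 𝕂) (RatFunc 𝕂)) =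
      algebraMap (Polynomial 𝕂) (RatFunc 𝕂) d • K)
    (h : reflectionLeft t (MvPolynomial (Fin 2) 𝕂) (MvPolynomial.X 0) (MvPolynomial.X 1)
      (L.map (Polynomial.aeval (MvPolynomial.X 0))) (L.map (Polynomial.aeval (MvPolynomial.X 1))) =
      reflectionRight t (MvPolynomial (Fin 2) 𝕂) (MvPolynomial.X 0) (MvPolynomial.X 1)
      (L.map (Polynomial.aeval (MvPolynomial.X 0))) (L.map (Polynomial.aeval (MvPolynomial.X 1)))) :
    ReflectionEquation K := by
  set f : MvPolynomial (Fin 2) 𝕂 →ₐ[𝕂] 𝕂₂ := IsScalarTower.toAlgHom 𝕂 _ _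
  have hf (s : Fin 2) : (L.map (Polynomial.aeval (MvPolynomial.X s : MvPolynomial (Fin 2) 𝕂))).map f
      = L.map (Polynomial.aeval (var s)) := by
    ext1 i j
    exact (aeval_var s _).symm
  have hv (s : Fin 2) : f (MvPolynomial.X s) = var s := rfl
  have key := congrArg (fun M => M.map f) h
  simp only [reflectionLeft_map, reflectionRight_map, hf, hv] at key
  obtain ⟨c₁, h₁⟩ := R_div_poly (t := t) (a := MvPolynomial.X 0) (b := MvPolynomial.X 1)
    (by simp) (by simp)
  -- The argument u v is treated as the quotient of u v by 1.
  obtain ⟨c₂, h₂⟩ := R_div_poly (t := t) (a := MvPolynomial.X 0 * MvPolynomial.X 1) (b := 1)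
    (by simp) (by simp)
  rw [map_one, div_one, map_mul] at h₂
  change R t (var 0 / var 1) = c₁ • Rhom t 𝕂₂ (var 0) (var 1) at h₁
  change R t (var 0 * var 1) = c₂ • Rhom t 𝕂₂ (var 0 * var 1) 1 at h₂
  rw [reflectionLeft, reflectionRight] at key
  simp only [ReflectionEquation, R21, h₁, h₂, map_subst hd hL, Matrix.smul_kronecker,
    Matrix.kronecker_smul, mul_smul_comm, smul_mul_assoc]
  rw [key]
  simp only [smul_smul]
  congr 1
  ring

end Transfer

end QRefl

/-- Let `B` be a right coideal subalgebra of `U_q(ĝ)` and `(K(u), η)` a nontrivial solution of the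
untwisted boundary intertwining equation. If `(T_u ⊗ T_v)|_B` is irreducible for generic `u, v`,
then `K(u)` satisfies the untwisted reflection equation. -/
theorem propositionP (t : QRefl.AffineType) (B : Subalgebra QRefl.𝕂 (QRefl.Uq t))
    (hB : QRefl.IsRightCoideal B) (K : t.Mat (RatFunc QRefl.𝕂)) (η : QRefl.𝕂ˣ) (hK : K ≠ 0)
    (hint : QRefl.BoundaryIntertwining B K η) (hirr : QRefl.GenericallyIrreducible B) :
    QRefl.ReflectionEquation K := by
  obtain ⟨L, d, hd, hL⟩ := QRefl.exists_clear_denominators K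
  have hL0 : L ≠ 0 := by
    rintro rfl
    rw [Matrix.map_zero _ (map_zero _), eq_comm,
      smul_eq_zero_iff_right (RatFunc.algebraMap_ne_zero hd)] at hL
    exact hK hL
  exact QRefl.reflectionEquation_of_polynomial hd hL
    (QRefl.reflection_of_evals hB hirr hL0 (hint.eval hL))
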